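/- Let $q>1$ be real and $p=1/q$. Put $[n]_q^!=\prod_{k=1}^n(1+q+\dots+q^{k-1})$, $e_q(x)=\sum_{n\ge0}x^n/[n]_q^!$, $\theta_p(x)=\sum_{n\in\mathbb Z}p^{n(n-1)/2}x^n$, $[\lambda;q]=\lambda q^{\mathbb Z}$, and $\int_{\lambda p^{\mathbb Z}}F(\xi)\,d_p\xi=(1-p)\lambda\sum_{n\in\mathbb Z}F(\lambda p^n)p^n$. For $\hat f=\sum_{n\ge0}a_nx^{n+1}\in x\mathbb C[[x]]$ put $\mathcal B_q\hat f=\sum_n\frac{a_n}{[n]_q^!}\xi^n$ and $B_q\hat f=\sum_n\frac{a_n}{q^{n(n-1)/2}}\xi^n$. A germ $\phi$ of analytic function at $0$ belongs to $\mathbb H^{[\lambda;q]}$ if there are a connected open set $\Omega\ni0$ and $r>0$ such that $\Omega$ contains the discs $\{|\xi-\lambda q^m|<rq^m\}$, $m\in\mathbb Z$, and $\phi$ continues analytically to $\Omega$ with $|\phi(\xi)|<K|\xi|^{\mu}e_q(|\xi|)$ for $\xi\in\Omega$, $|\xi|$ large, for some $K,\mu>0$. The set $DS(\hat f)$ of singular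 directions of $\hat f$ is the set of spirals $[\lambda;q]$, $\lambda\in\mathbb C^*$, such that $B_q\hat f\notin\mathbb H^{[\lambda;q]}$. When $B_q\hat f\in\mathbb H^{[\lambda;q]}$, respectively $\mathcal B_q\hat f\in\mathbb H^{[\lambda/(1-p);q]}$, put $$S_q^{[\lambda]}\hat f(x)=\frac q{1-p}\int_{\lambda p^{\mathbb Z}}\frac{(B_q\hat f)(\xi)}{\theta_p(q\xi/x)}d_p\xi,\qquad \mathcal S_q^{[\lambda]}\hat f(x)=\frac q{1-p}\int_{\lambda p^{\mathbb Z}}\frac{(\mathcal B_q\hat f)(\xi/(1-p))}{e_q\left(q\xi/((1-p)x)\right)}d_p\xi ,$$ and when $B_q\hat f$, respectively $\mathcal B_q\hat f$, belongs to $\mathbb H^{[\lambda;q]}$ for all $\lambda\in(0,e^{id}\infty)$, put $$S_q^{d}\hat f(x)=\frac q{\ln q}\int_0^{e^{id}\infty}\frac{(B_q\hat f)(\xi)}{\theta_p(q\xi/x)}d\xi,\qquad \mathcal S_q^{d}\hat f(x)=\frac{q-1}{\ln q}\int_0^{e^{id}\infty}\frac{(\mathcal B_q\hat f)(\xi)}{e_q(q\xi/x)}d\xi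 .$$ **Theorem.** Let $\hat f\in x\mathbb C[[x]]$ be a generic $q$-Gevrey series, i.e. $\Delta\hat f\in\mathbb C\{x\}$ for some $\Delta=a_0(x)(x\sigma_q)^n+a_1(x)(x\sigma_q)^{n-1}+\dots+a_n(x)$ with $n\ge0$, $a_j\in\mathbb C\{x\}$, $a_0(0)a_n(0)\ne0$, where $\sigma_qf(x)=f(qx)$. Then $DS(\hat f)$ is finite, and: 1. If $\lambda\in\mathbb C^*$ and $[\lambda;q]\notin DS(\hat f)$, there is $R>0$ such that for all $x$ with $0<|x|<R$ and $x\notin-\lambda q^{\mathbb Z}$ both discrete sums are defined (the memberships above hold, the Jackson integrals converge absolutely, and the values do not depend on the analytic continuation used) and $S_q^{[\lambda]}\hat f(x)=\mathcal S_q^{[\lambda]}\hat f(x)$. 2. If $d\in[-\pi,\pi)$ and no spiral $[\lambda;q]$ with $\lambda\in(0,e^{id}\infty)$ lies in $DS(\hat f)$, there is $R>0$ such that for all $x$ with $0<|x|<R$ in the open sector $|\arg x-d|<\pi$ both continuous sums are defined (the memberships hold, the integrals converge absolutely, and the values do not depend on the continuation used) and $S_q^d\hat f(x)=\mathcal S_q^d\hat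 f(x)$. Moreover, for these $x$, $\mathcal S_q^{[\lambda]}\hat f(x)$ is defined for every $\lambda\in[e^{id},qe^{id}]$, is integrable in $\lambda$ with respect to $d\lambda/\lambda$ on this segment, and $$\mathcal S_q^d\hat f(x)=\frac1{\ln q}\int_{e^{id}}^{qe^{id}}\mathcal S_q^{[\lambda]}\hat f(x)\,\frac{d\lambda}\lambda .$$ -/

import Mathlib

open Complex Filter Topology MeasureTheory

noncomputable section

/-- `ℂ{x}`: power series with a positive radius of convergence. -/
def IsConvergentSeries (g : PowerSeries ℂ) : Prop :=
  ∃ r : ℝ, 0 < r ∧ Summable fun n : ℕ => ‖PowerSeries.coeff n g‖ * r ^ n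

/-- The operator `x σ_q`, `f(x) ↦ x f(q x)`, on formal power series. -/
def xSigma (q : ℝ) (f : PowerSeries ℂ) : PowerSeries ℂ :=
  PowerSeries.X * PowerSeries.rescale (q : ℂ) f

/-- Generic `q`-Gevrey series: `Δ f ∈ ℂ{x}` for some
`Δ = a₀ (xσ_q)ⁿ + a₁ (xσ_q)ⁿ⁻¹ + ⋯ + aₙ` with `a_j ∈ ℂ{x}` and `a₀(0) aₙ(0) ≠ 0`. -/
def IsGenericQGevrey (q : ℝ) (f : PowerSeries ℂ) : Prop :=
  ∃ (n : ℕ) (a : ℕ → PowerSeries ℂ),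
    (∀ j ≤ n, IsConvergentSeries (a j)) ∧
    PowerSeries.constantCoeff (a 0) ≠ 0 ∧
    PowerSeries.constantCoeff (a n) ≠ 0 ∧
    IsConvergentSeries (∑ j ∈ Finset.range (n + 1), a j * (xSigma q)^[n - j] f)

/-- `[n]_q = 1 + q + ⋯ + q^(n-1)`. -/
def qNumber (q : ℝ) (n : ℕ) : ℝ := ∑ i ∈ Finset.range n, q ^ i

/-- `[n]_q^! = [1]_q [2]_q ⋯ [n]_q`. -/
def qFactorial (q : ℝ) (n : ℕ) : ℝ := ∏ k ∈ Finset.range n, qNumber q (k + 1)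

/-- `e_q(x) = ∑ xⁿ / [n]_q^!`, an entire function when `q > 1`. -/
def qExp (q : ℝ) (x : ℂ) : ℂ := ∑' n : ℕ, x ^ n / (qFactorial q n : ℂ)

/-- `θ_p(x) = ∑_{n ∈ ℤ} p^(n(n-1)/2) xⁿ`, for `0 < p < 1` and `x ≠ 0`
(the division `n(n-1)/2` is exact). -/
def qTheta (p : ℝ) (x : ℂ) : ℂ := ∑' n : ℤ, (p : ℂ) ^ (n * (n - 1) / 2) * x ^ n

/-- The formal Borel transform `𝓑_q : ∑ aₙ xⁿ⁺¹ ↦ ∑ aₙ / [n]_q^! ξⁿ`. -/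
def borelExp (q : ℝ) (f : PowerSeries ℂ) : PowerSeries ℂ :=
  PowerSeries.mk fun n => PowerSeries.coeff (n + 1) f / (qFactorial q n : ℂ)

/-- The formal Borel transform `B_q : ∑ aₙ xⁿ⁺¹ ↦ ∑ aₙ / q^(n(n-1)/2) ξⁿ`. -/
def borelTheta (q : ℝ) (f : PowerSeries ℂ) : PowerSeries ℂ :=
  PowerSeries.mk fun n => PowerSeries.coeff (n + 1) f / (q : ℂ) ^ (n * (n - 1) / 2)

/-- The spiral `[λ;q] = λ q^ℤ`. -/
def qSpiral (q : ℝ) (lam : ℂ) : Set ℂ := Set.range fun m : ℤ => lam * (q : ℂ) ^ m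

/-- `Φ` has `q`-exponential growth of order 1 at infinity on `Ω`. -/
def HasQExpGrowth (q : ℝ) (Ω : Set ℂ) (Φ : ℂ → ℂ) : Prop :=
  ∃ K : ℝ, 0 < K ∧ ∃ μ : ℝ, 0 < μ ∧ ∃ A : ℝ, ∀ x ∈ Ω, A ≤ ‖x‖ →
    ‖Φ x‖ < K * ‖x‖ ^ μ * ‖qExp q (‖x‖ : ℂ)‖

/-- `(Ω, Φ)` witnesses that the germ at `0` with Taylor series `g` belongs to `ℍ^{[λ;q]}`:
`Ω` is a domain containing `0` and a disc of radius `r qᵐ` about each point `λ qᵐ` of the spiral,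
and `Φ` continues the germ analytically to `Ω`, with `q`-exponential growth of order 1.
(All `m ∈ ℤ` are taken, so that the notion depends only on the spiral `[λ;q]`; the discs with
`m` very negative lie in any neighbourhood of `0` once `r < |λ|`.) -/
structure IsContinuationAlong (q : ℝ) (lam : ℂ) (g : PowerSeries ℂ)
    (Ω : Set ℂ) (Φ : ℂ → ℂ) : Prop where
  isOpen : IsOpen Ω
  isConnected : IsConnected Ω
  zero_mem : (0 : ℂ) ∈ Ω
  discs : ∃ r : ℝ, 0 < r ∧ ∀ m : ℤ, Metric.ball (lam * (q : ℂ) ^ m) (r * q ^ m) ⊆ Ω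
  germ : ∀ᶠ x in 𝓝 (0 : ℂ), HasSum (fun n : ℕ => PowerSeries.coeff n g * x ^ n) (Φ x)
  analytic : AnalyticOnNhd ℂ Φ Ω
  growth : HasQExpGrowth q Ω Φ

/-- The germ with Taylor series `g` belongs to `ℍ^{[λ;q]}`. -/
def MemHSpiral (q : ℝ) (lam : ℂ) (g : PowerSeries ℂ) : Prop :=
  ∃ (Ω : Set ℂ) (Φ : ℂ → ℂ), IsContinuationAlong q lam g Ω Φ

/-- `f` is `q`-Borel summable along `[λ;q]`: `B_q f ∈ ℍ^{[λ;q]}`. -/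
def IsQBorelSummableAlong (q : ℝ) (lam : ℂ) (f : PowerSeries ℂ) : Prop :=
  MemHSpiral q lam (borelTheta q f)

/-- The set of singular directions of `f`: the spirals `[λ;q]`, `λ ≠ 0`, along which `f` is not
`q`-Borel summable. -/
def singularDirections (q : ℝ) (f : PowerSeries ℂ) : Set (Set ℂ) :=
  {C | ∃ lam : ℂ, lam ≠ 0 ∧ C = qSpiral q lam ∧ ¬ IsQBorelSummableAlong q lam f}

/-- The Jackson integral `∫_{λ p^ℤ} F(ξ) d_p ξ = (1-p) λ ∑_{n ∈ ℤ} F(λ pⁿ) pⁿ` converges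
and equals `s`. -/
def HasJacksonIntegral (p : ℝ) (lam : ℂ) (F : ℂ → ℂ) (s : ℂ) : Prop :=
  HasSum (fun n : ℤ => (1 - (p : ℂ)) * lam * (F (lam * (p : ℂ) ^ n) * (p : ℂ) ^ n)) s

/-- The discrete sum `S_q^{[λ]} f = L_q^{[λ]} (B_q f)` is defined at `x` and equals `s`:
`B_q f ∈ ℍ^{[λ;q]}` and, whichever continuation `Φ` of `B_q f` along `[λ;q]` is used,
`s = q/(1-p) ∫_{λ p^ℤ} Φ(ξ) / θ_p(q ξ / x) d_p ξ`, where `p = 1/q`. -/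
def HasDiscreteThetaSum (q : ℝ) (lam : ℂ) (f : PowerSeries ℂ) (x s : ℂ) : Prop :=
  MemHSpiral q lam (borelTheta q f) ∧
  ∀ (Ω : Set ℂ) (Φ : ℂ → ℂ), IsContinuationAlong q lam (borelTheta q f) Ω Φ →
    ∃ J : ℂ, HasJacksonIntegral q⁻¹ lam (fun ξ => Φ ξ / qTheta q⁻¹ (q * ξ / x)) J ∧
      s = q / (1 - (q : ℂ)⁻¹) * J

/-- The discrete sum `𝓢_q^{[λ]} f = 𝓛_q^{[λ]} (𝓑_q f)` is defined at `x` and equals `s`: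
`𝓑_q f ∈ ℍ^{[λ/(1-p);q]}` and, whichever continuation `Ψ` of `𝓑_q f` along `[λ/(1-p);q]` is used,
`s = q/(1-p) ∫_{λ p^ℤ} Ψ(ξ/(1-p)) / e_q(q ξ / ((1-p) x)) d_p ξ`, where `p = 1/q`. -/
def HasDiscreteExpSum (q : ℝ) (lam : ℂ) (f : PowerSeries ℂ) (x s : ℂ) : Prop :=
  MemHSpiral q (lam / (1 - (q : ℂ)⁻¹)) (borelExp q f) ∧
  ∀ (Ω : Set ℂ) (Ψ : ℂ → ℂ),
    IsContinuationAlong q (lam / (1 - (q : ℂ)⁻¹)) (borelExp q f) Ω Ψ →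
    ∃ J : ℂ, HasJacksonIntegral q⁻¹ lam
        (fun ξ => Ψ (ξ / (1 - (q : ℂ)⁻¹)) / qExp q (q * ξ / ((1 - (q : ℂ)⁻¹) * x))) J ∧
      s = q / (1 - (q : ℂ)⁻¹) * J

/-- The point `t e^{id}` of the half line `(0, e^{id}∞)`. -/
def rayPoint (d t : ℝ) : ℂ := t * Complex.exp (d * Complex.I)

/-- `u t`, `t > 0`, is the value at `ξ = t e^{id}` of a continuation along `[ξ;q]` of the germ with
Taylor series `g`.  Such a `u` exists if and only if the germ belongs to
`ℍ_q^d = ⋂_{ξ ∈ (0, e^{id}∞)} ℍ^{[ξ;q]}`. -/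
def IsRayContinuation (q d : ℝ) (g : PowerSeries ℂ) (u : ℝ → ℂ) : Prop :=
  ∀ t : ℝ, 0 < t → ∃ (Ω : Set ℂ) (Φ : ℂ → ℂ),
    IsContinuationAlong q (rayPoint d t) g Ω Φ ∧ u t = Φ (rayPoint d t)

/-- The continuous sum `S_q^d f = L_q^d (B_q f)` is defined at `x` and equals `s`:
`B_q f ∈ ℍ_q^d` and `s = q/ln q ∫_0^{e^{id}∞} (B_q f)(ξ) / θ_p(q ξ / x) dξ`, the integral being
absolutely convergent (parametrised by `ξ = t e^{id}`). -/
def HasContinuousThetaSum (q d : ℝ) (f : PowerSeries ℂ) (x s : ℂ) : Prop :=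
  (∃ u, IsRayContinuation q d (borelTheta q f) u) ∧
  ∀ u, IsRayContinuation q d (borelTheta q f) u →
    IntegrableOn (fun t : ℝ => u t / qTheta q⁻¹ (q * rayPoint d t / x) *
      Complex.exp (d * Complex.I)) (Set.Ioi 0) ∧
    s = q / (Real.log q : ℂ) *
      ∫ t in Set.Ioi (0 : ℝ), u t / qTheta q⁻¹ (q * rayPoint d t / x) *
        Complex.exp (d * Complex.I)

/-- The continuous sum `𝓢_q^d f = 𝓛_q^d (𝓑_q f)` is defined at `x` and equals `s`:
`𝓑_q f ∈ ℍ_q^d` and `s = (q-1)/ln q ∫_0^{e^{id}∞} (𝓑_q f)(ξ) / e_q(q ξ / x) dξ`, the integral being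
absolutely convergent (parametrised by `ξ = t e^{id}`). -/
def HasContinuousExpSum (q d : ℝ) (f : PowerSeries ℂ) (x s : ℂ) : Prop :=
  (∃ u, IsRayContinuation q d (borelExp q f) u) ∧
  ∀ u, IsRayContinuation q d (borelExp q f) u →
    IntegrableOn (fun t : ℝ => u t / qExp q (q * rayPoint d t / x) *
      Complex.exp (d * Complex.I)) (Set.Ioi 0) ∧
    s = (q - 1) / (Real.log q : ℂ) *
      ∫ t in Set.Ioi (0 : ℝ), u t / qExp q (q * rayPoint d t / x) *
        Complex.exp (d * Complex.I)

end

/-! Put p = 1/q and E(y) = (-y;p)_∞ = ∑ p^(n(n-1)/2) yⁿ/(p;p)_n, which is `euler p y`. Then e_q(x) =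
E((1-p)x), and the triple product reads θ_p(y) = (p;p)_∞ E(y) E(p/y). Dividing Euler's series for
E(p/y) by θ_p(y) expresses one Laplace kernel through the other: 1/((p;p)_∞ E(y)) = ∑_k 1/((p;p)_k
θ_p(p^(-k) y)) (`hasSum_inv_qTheta`).

Let φ = B_q f, and let ψ be the series obtained by dividing the n-th coefficient of φ by (p;p)_n, so
that 𝓑_q f(η) = ψ((1-p)η). Then ψ(ξ) is a rapidly convergent combination of the values φ(p^k ξ)
(`divPoch`), hence it continues along with φ, and conversely φ(ξ) = (p;p)_∞ ∑_k p^k/(p;p)_k ψ(p^k ξ)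
(`hasSum_divPoch_inv`). With these two expansions both discrete sums become the same absolutely
convergent double series over ℤ × ℕ, summed along two different directions
(`exists_hasSum_theta_euler`).

The rest is analytic continuation. B_q turns x σ_q into multiplication by qξ, and multiplication by
x^k into h(ξ) ↦ p^(k(k-1)/2) ξ^k h(p^k ξ). So Δf ∈ ℂ{x} becomes P(ξ)φ(ξ) + ∑_{k≥1} Q_k(ξ)φ(p^k ξ) =
G(ξ), with P a polynomial of degree n and P(0) ≠ 0 (`IsGenericQGevrey.borelEquation`). Solving for
φ(ξ) enlarges the domain by a factor q at each step, away from the spirals of the roots of P, with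
growth bounded by a multiple of E(c‖ξ‖) (`BorelEquation.approx_bound`). Hence only those finitely
many spirals can be singular. Together with 0 they form a closed countable set, which does not
disconnect domains, so continuations are unique (`BorelEquation.eq_ext`, `BorelEquation.eq_psi`).

For the continuous sums, the half line is folded by p^ℤ onto one period
(`integral_Ioi_eq_integral_tsum`). Each integral becomes a mean of discrete sums over λ, and these
already agree. -/

noncomputable section

/-! ### Euler's series (-y;p)_∞: functional equation, zeros, growth. -/

/-- `(p;p)_n = (1 - p) (1 - p²) ⋯ (1 - pⁿ)`. -/
def qPoch (p : ℝ) (n : ℕ) : ℝ := ∏ i ∈ Finset.range n, (1 - p ^ (i + 1))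

/-- Taylor coefficients of `(-y;p)_∞`. -/
def eulerCoeff (p : ℝ) (n : ℕ) : ℝ := p ^ (n.choose 2) / qPoch p n

/-- Euler's series `∑ p^(n(n-1)/2) yⁿ / (p;p)_n = (-y;p)_∞`. -/
def euler (p : ℝ) (y : ℂ) : ℂ := ∑' n : ℕ, (eulerCoeff p n : ℂ) * y ^ n

/-- Euler's series at a real argument. -/
def eulerR (p t : ℝ) : ℝ := ∑' n : ℕ, eulerCoeff p n * t ^ n

lemma choose_two_succ (n : ℕ) : (n + 1).choose 2 = n.choose 2 + n := by
  rw [Nat.choose_succ_succ' n 1, Nat.choose_one_right, add_comm]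

lemma qPoch_succ (p : ℝ) (n : ℕ) : qPoch p (n + 1) = qPoch p n * (1 - p ^ (n + 1)) :=
  Finset.prod_range_succ _ _

@[simp] lemma qPoch_zero (p : ℝ) : qPoch p 0 = 1 := by simp [qPoch]

@[simp] lemma eulerCoeff_zero (p : ℝ) : eulerCoeff p 0 = 1 := by simp [eulerCoeff]

section
variable {p : ℝ} (hp0 : 0 < p) (hp1 : p < 1)
include hp0 hp1

lemma one_sub_pow_pos (n : ℕ) : 0 < 1 - p ^ (n + 1) :=
  sub_pos.2 (pow_lt_one₀ hp0.le hp1 n.succ_ne_zero)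

lemma qPoch_pos (n : ℕ) : 0 < qPoch p n :=
  Finset.prod_pos fun i _ => one_sub_pow_pos hp0 hp1 i

lemma qPoch_le_one (n : ℕ) : qPoch p n ≤ 1 :=
  Finset.prod_le_one (fun i _ => (one_sub_pow_pos hp0 hp1 i).le)
    fun i _ => by linarith [pow_pos hp0 (i + 1)]

lemma eulerCoeff_pos (n : ℕ) : 0 < eulerCoeff p n :=
  div_pos (pow_pos hp0 _) (qPoch_pos hp0 hp1 n)

lemma eulerCoeff_succ_mul (n : ℕ) :
    eulerCoeff p (n + 1) * (1 - p ^ (n + 1)) = p ^ n * eulerCoeff p n := by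
  have h1 := (qPoch_pos hp0 hp1 n).ne'
  have h2 := (one_sub_pow_pos hp0 hp1 n).ne'
  rw [eulerCoeff, eulerCoeff, qPoch_succ, choose_two_succ, pow_add]
  field_simp

lemma eulerCoeff_succ (n : ℕ) :
    eulerCoeff p (n + 1) = p ^ (n + 1) * eulerCoeff p (n + 1) + p ^ n * eulerCoeff p n := by
  linarith [eulerCoeff_succ_mul hp0 hp1 n]

lemma summable_eulerCoeff_mul_pow (t : ℝ) : Summable fun n => eulerCoeff p n * t ^ n := by
  rcases eq_or_ne t 0 with rfl | ht
  · exact summable_of_ne_finset_zero (s := {0}) fun n hn => by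
      simp at hn; simp [hn]
  refine summable_of_ratio_test_tendsto_lt_one (l := 0) one_pos
    (Eventually.of_forall fun n => mul_ne_zero (eulerCoeff_pos hp0 hp1 n).ne' (pow_ne_zero _ ht)) ?_
  have h : ∀ n, ‖eulerCoeff p (n + 1) * t ^ (n + 1)‖ / ‖eulerCoeff p n * t ^ n‖
      = p ^ n * (|t| / (1 - p ^ (n + 1))) := by
    intro n
    have h1 := eulerCoeff_pos hp0 hp1 n
    have h2 := one_sub_pow_pos hp0 hp1 n
    have h3 := eulerCoeff_succ_mul hp0 hp1 n
    have h4 : eulerCoeff p (n + 1) = p ^ n * eulerCoeff p n / (1 - p ^ (n + 1)) := by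
      rw [eq_div_iff h2.ne', h3]
    have h5 : |t| ≠ 0 := abs_ne_zero.2 ht
    rw [norm_mul, norm_mul, norm_pow, norm_pow, Real.norm_eq_abs, Real.norm_eq_abs,
      Real.norm_eq_abs, abs_of_pos h1, abs_of_pos (eulerCoeff_pos hp0 hp1 _), h4,
      pow_succ |t|]
    field_simp
  simp_rw [h]
  have hpn := tendsto_pow_atTop_nhds_zero_of_lt_one hp0.le hp1
  have := hpn.mul ((tendsto_const_nhds (x := |t|)).div
    ((tendsto_const_nhds (x := (1 : ℝ))).sub ((tendsto_add_atTop_iff_nat 1).2 hpn)) (by simp))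
  simpa using this

lemma summable_norm_euler (y : ℂ) : Summable fun n => ‖(eulerCoeff p n : ℂ) * y ^ n‖ := by
  refine (summable_eulerCoeff_mul_pow hp0 hp1 ‖y‖).congr fun n => ?_
  rw [norm_mul, norm_pow, Complex.norm_real, Real.norm_of_nonneg (eulerCoeff_pos hp0 hp1 n).le]

lemma hasSum_euler (y : ℂ) : HasSum (fun n => (eulerCoeff p n : ℂ) * y ^ n) (euler p y) :=
  (summable_norm_euler hp0 hp1 y).of_norm.hasSum

lemma hasSum_eulerR (t : ℝ) : HasSum (fun n => eulerCoeff p n * t ^ n) (eulerR p t) :=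
  (summable_eulerCoeff_mul_pow hp0 hp1 t).hasSum

omit hp0 hp1 in
lemma euler_ofReal (t : ℝ) : euler p (t : ℂ) = (eulerR p t : ℂ) := by
  simp [euler, eulerR, Complex.ofReal_tsum]

lemma norm_euler_le (y : ℂ) : ‖euler p y‖ ≤ eulerR p ‖y‖ := by
  refine (norm_tsum_le_tsum_norm (summable_norm_euler hp0 hp1 y)).trans (le_of_eq ?_)
  refine tsum_congr fun n => ?_
  rw [norm_mul, norm_pow, Complex.norm_real, Real.norm_of_nonneg (eulerCoeff_pos hp0 hp1 n).le]

/-- Coefficientwise this is `eulerCoeff_succ`. The product expansion and all growth estimates come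
from this equation. -/
lemma euler_eq (y : ℂ) : euler p y = (1 + y) * euler p (p * y) := by
  have h1 := hasSum_euler hp0 hp1 (p * y)
  have h2 := (hasSum_nat_add_iff' 1).2 h1
  have h3 := (hasSum_nat_add_iff' 1).2 (hasSum_euler hp0 hp1 y)
  have h4 := h2.add (h1.mul_left y)
  have h5 := h4.unique (h3.congr_fun ?_)
  · simp at h5
    linear_combination -h5
  · intro n
    have := congrArg (fun r : ℝ => (r : ℂ)) (eulerCoeff_succ hp0 hp1 n)
    push_cast at this
    linear_combination (-y ^ (n + 1)) * this

lemma eulerR_eq (t : ℝ) : eulerR p t = (1 + t) * eulerR p (p * t) := by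
  have := euler_eq hp0 hp1 (t : ℂ)
  rw [← Complex.ofReal_mul, euler_ofReal, euler_ofReal] at this
  exact_mod_cast this

lemma one_le_eulerR {t : ℝ} (ht : 0 ≤ t) : 1 ≤ eulerR p t := by
  have := (summable_eulerCoeff_mul_pow hp0 hp1 t).le_tsum 0
    fun n _ => mul_nonneg (eulerCoeff_pos hp0 hp1 n).le (pow_nonneg ht n)
  simpa [eulerR] using this

lemma eulerR_pos {t : ℝ} (ht : 0 ≤ t) : 0 < eulerR p t :=
  one_pos.trans_le (one_le_eulerR hp0 hp1 ht)

lemma eulerR_mono {s t : ℝ} (hs : 0 ≤ s) (h : s ≤ t) : eulerR p s ≤ eulerR p t :=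
  (summable_eulerCoeff_mul_pow hp0 hp1 s).tsum_le_tsum
    (fun n => mul_le_mul_of_nonneg_left (pow_le_pow_left₀ hs h n) (eulerCoeff_pos hp0 hp1 n).le)
    (summable_eulerCoeff_mul_pow hp0 hp1 t)

/-- Among the k factors 1 + p^j t split off from E(t), each is at least p^j t. This absorbs the
powers of ‖ξ‖ in the coefficients Q_k of the Borel equation. -/
lemma pow_mul_eulerR_le {t : ℝ} (ht : 0 ≤ t) (k : ℕ) :
    t ^ k * p ^ (k.choose 2) * eulerR p (p ^ k * t) ≤ eulerR p t := by
  induction k with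
  | zero => simp
  | succ k ih =>
    refine le_trans ?_ ih
    rw [eulerR_eq hp0 hp1 (p ^ k * t), choose_two_succ, pow_add, ← mul_assoc p, ← pow_succ']
    have h0 : 0 ≤ p ^ (k + 1) * t := by positivity
    have h1 := eulerR_pos hp0 hp1 h0
    have h2 : 0 ≤ t ^ k * p ^ (k.choose 2) * eulerR p (p ^ (k + 1) * t) := by positivity
    calc _ = (t ^ k * p ^ (k.choose 2) * eulerR p (p ^ (k + 1) * t)) * (p ^ k * t) := by ring
      _ ≤ (t ^ k * p ^ (k.choose 2) * eulerR p (p ^ (k + 1) * t)) * (1 + p ^ k * t) := by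
        gcongr; linarith
      _ = _ := by ring

lemma differentiable_euler : Differentiable ℂ (euler p) := by
  intro y
  have h : DifferentiableOn ℂ (fun y => ∑' n : ℕ, (eulerCoeff p n : ℂ) * y ^ n)
      (Metric.ball 0 (‖y‖ + 1)) := by
    refine differentiableOn_tsum_of_summable_norm
      (summable_eulerCoeff_mul_pow hp0 hp1 (‖y‖ + 1)) (fun n => by fun_prop)
      Metric.isOpen_ball fun n w hw => ?_
    rw [norm_mul, norm_pow, Complex.norm_real, Real.norm_of_nonneg (eulerCoeff_pos hp0 hp1 n).le]
    have : ‖w‖ ≤ ‖y‖ + 1 := by simpa using (mem_ball_zero_iff.1 hw).le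
    exact mul_le_mul_of_nonneg_left (pow_le_pow_left₀ (norm_nonneg _) this n)
      (eulerCoeff_pos hp0 hp1 n).le
  exact h.differentiableAt (Metric.isOpen_ball.mem_nhds (by simp))

omit hp0 hp1 in
@[simp] lemma euler_zero : euler p 0 = 1 := by
  rw [euler, tsum_eq_single 0 (fun n hn => by simp [hn])]; simp

lemma tendsto_pow_mul_zero (y : ℂ) : Tendsto (fun N : ℕ => (p : ℂ) ^ N * y) atTop (𝓝 0) := by
  have : Tendsto (fun N : ℕ => (p : ℂ) ^ N) atTop (𝓝 0) :=
    tendsto_pow_atTop_nhds_zero_of_norm_lt_one (by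
      rwa [Complex.norm_real, Real.norm_of_nonneg hp0.le])
  simpa using this.mul_const y

lemma tendsto_euler_pow_mul (y : ℂ) :
    Tendsto (fun N : ℕ => euler p ((p : ℂ) ^ N * y)) atTop (𝓝 1) := by
  have h := ((differentiable_euler hp0 hp1).continuous.tendsto 0).comp
    (tendsto_pow_mul_zero hp0 hp1 y)
  rwa [euler_zero] at h

lemma euler_eq_prod (N : ℕ) (y : ℂ) :
    euler p y = (∏ j ∈ Finset.range N, (1 + (p : ℂ) ^ j * y)) * euler p ((p : ℂ) ^ N * y) := by
  induction N with
  | zero => simp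
  | succ N ih =>
    rw [ih, Finset.prod_range_succ, euler_eq hp0 hp1 ((p : ℂ) ^ N * y), pow_succ']
    ring_nf

/-- The remaining factor E(p^N y) tends to 1, so it is nonzero once finitely many linear factors are
split off. -/
lemma euler_ne_zero {y : ℂ} (hy : ∀ j : ℕ, 1 + (p : ℂ) ^ j * y ≠ 0) : euler p y ≠ 0 := by
  obtain ⟨N, hN⟩ := ((tendsto_euler_pow_mul hp0 hp1 y).eventually_ne one_ne_zero).exists
  rw [euler_eq_prod hp0 hp1 N]
  exact mul_ne_zero (Finset.prod_ne_zero_iff.2 fun j _ => hy j) hN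

/-- E(-p) = (p;p)_∞ and E(-p^(n+1)) = (p^(n+1);p)_∞. -/
lemma qPoch_mul_euler (n : ℕ) :
    (qPoch p n : ℂ) * euler p (-(p : ℂ) ^ (n + 1)) = euler p (-p) := by
  rw [euler_eq_prod hp0 hp1 n (-p), qPoch]
  push_cast
  congr 1
  · exact Finset.prod_congr rfl fun i _ => by ring
  · congr 1; ring

lemma tendsto_qPoch : Tendsto (fun n => (qPoch p n : ℂ)) atTop (𝓝 (euler p (-p))) := by
  have h : Tendsto (fun n : ℕ => euler p (-(p : ℂ) ^ (n + 1))) atTop (𝓝 1) := by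
    refine (tendsto_euler_pow_mul hp0 hp1 (-p)).congr fun n => ?_
    congr 1; ring
  have h2 := (tendsto_const_nhds (x := euler p (-p))).div h one_ne_zero
  rw [div_one] at h2
  refine h2.congr' ?_
  filter_upwards [h.eventually_ne one_ne_zero] with n hn
  rw [Pi.div_apply, ← qPoch_mul_euler hp0 hp1 n]
  field_simp

omit hp0 hp1 in
lemma euler_neg_p_real : euler p (-p) = (eulerR p (-p) : ℂ) := by
  rw [← Complex.ofReal_neg, euler_ofReal]

lemma tendsto_qPoch_real : Tendsto (qPoch p) atTop (𝓝 (eulerR p (-p))) := by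
  have h := tendsto_qPoch hp0 hp1
  rw [euler_neg_p_real] at h
  exact tendsto_ofReal_iff.1 h

/-- The series alternates, so its terms give no sign. Nonnegativity comes from the limit of (p;p)_n,
strictness from the absence of zeros. -/
lemma eulerR_neg_p_pos : 0 < eulerR p (-p) := by
  have h1 : 0 ≤ eulerR p (-p) :=
    ge_of_tendsto' (tendsto_qPoch_real hp0 hp1) fun n => (qPoch_pos hp0 hp1 n).le
  refine lt_of_le_of_ne h1 fun h => ?_
  have : euler p (-p) ≠ 0 := euler_ne_zero hp0 hp1 fun j h => by
    have : (1 : ℝ) - p ^ (j + 1) = 0 := by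
      have : ((1 - p ^ (j + 1) : ℝ) : ℂ) = 0 := by push_cast; linear_combination h
      exact_mod_cast this
    exact (one_sub_pow_pos hp0 hp1 j).ne' this
  rw [euler_neg_p_real, ← h] at this
  simp at this

lemma eulerR_neg_p_le_qPoch (n : ℕ) : eulerR p (-p) ≤ qPoch p n := by
  refine Antitone.le_of_tendsto (antitone_nat_of_succ_le fun n => ?_) (tendsto_qPoch_real hp0 hp1) n
  rw [qPoch_succ]
  exact mul_le_of_le_one_right (qPoch_pos hp0 hp1 n).le (by linarith [pow_pos hp0 (n + 1)])

end

/-! ### The Jacobi triple product. -/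

/-- Laurent coefficients of Euler's series. -/
def eulerCoeffZ (p : ℝ) (j : ℤ) : ℝ := if 0 ≤ j then eulerCoeff p j.toNat else 0

/-- Laurent coefficients of `euler p y * euler p (p / y)`. -/
def jacobiCoeff (p : ℝ) (n : ℤ) : ℝ :=
  ∑' k : ℤ, eulerCoeffZ p (n + k) * (eulerCoeffZ p k * p ^ k)

@[simp] lemma eulerCoeffZ_natCast (p : ℝ) (n : ℕ) : eulerCoeffZ p n = eulerCoeff p n := by
  simp [eulerCoeffZ]

lemma eulerCoeffZ_of_neg (p : ℝ) {j : ℤ} (hj : j < 0) : eulerCoeffZ p j = 0 := by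
  simp [eulerCoeffZ, not_le.2 hj]

lemma triangular_succ (n : ℤ) : (n + 1) * (n + 1 - 1) / 2 = n * (n - 1) / 2 + n := by
  have : (n + 1) * (n + 1 - 1) = n * (n - 1) + n * 2 := by ring
  rw [this, Int.add_mul_ediv_right _ _ two_ne_zero]

lemma triangular_natCast (n : ℕ) : (n : ℤ) * (n - 1) / 2 = (n.choose 2 : ℕ) := by
  induction n with
  | zero => simp
  | succ n ih => push_cast; rw [triangular_succ, ih, choose_two_succ]; push_cast; ring

section
variable {p : ℝ} (hp0 : 0 < p) (hp1 : p < 1)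
include hp0 hp1

lemma eulerCoeffZ_nonneg (j : ℤ) : 0 ≤ eulerCoeffZ p j := by
  rw [eulerCoeffZ]; split_ifs
  exacts [(eulerCoeff_pos hp0 hp1 _).le, le_rfl]

lemma eulerCoeffZ_eq (j : ℤ) :
    eulerCoeffZ p (j + 1) = p ^ (j + 1) * eulerCoeffZ p (j + 1) + p ^ j * eulerCoeffZ p j := by
  rcases lt_or_ge j 0 with hj | hj
  · rw [eulerCoeffZ_of_neg p hj]
    rcases eq_or_lt_of_le (show j + 1 ≤ 0 by omega) with h | h
    · simp [h]
    · simp [eulerCoeffZ_of_neg p h]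
  · lift j to ℕ using hj
    have := eulerCoeff_succ hp0 hp1 j
    rw [← eulerCoeffZ_natCast, ← eulerCoeffZ_natCast] at this
    exact_mod_cast this

lemma hasSum_eulerZ {y : ℂ} :
    HasSum (fun j : ℤ => (eulerCoeffZ p j : ℂ) * y ^ j) (euler p y) := by
  refine (Function.Injective.hasSum_iff (f := fun j : ℤ => (eulerCoeffZ p j : ℂ) * y ^ j)
    (g := ((↑) : ℕ → ℤ)) Nat.cast_injective ?_).1 ?_
  · intro j hj
    have : j < 0 := by
      by_contra h
      exact hj ⟨j.toNat, Int.toNat_of_nonneg (not_lt.1 h)⟩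
    simp [eulerCoeffZ_of_neg p this]
  · refine (hasSum_euler hp0 hp1 y).congr_fun fun n => by simp

/-- The product of the two Laurent series is reindexed by the total exponent of y, the difference of
the two summation indices. -/
lemma hasSum_jacobi_double {y : ℂ} (hy : y ≠ 0) :
    HasSum (fun x : ℤ × ℤ => ((eulerCoeffZ p (x.1 + x.2) * (eulerCoeffZ p x.2 * p ^ x.2) : ℝ) : ℂ)
      * y ^ x.1) (euler p y * euler p (p / y)) := by
  set F : ℂ → ℤ → ℂ := fun y j => (eulerCoeffZ p j : ℂ) * y ^ j with hF
  have hF1 : ∀ y, HasSum (F y) (euler p y) := fun y => hasSum_eulerZ hp0 hp1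
  have hF2 : ∀ y, Summable fun j => ‖F y j‖ := fun y => (hF1 y).summable.norm
  have h0 : Summable fun x : ℤ × ℤ => F y x.1 * F (p / y) x.2 :=
    summable_mul_of_summable_norm (f := F y) (g := F (p / y)) (hF2 y) (hF2 _)
  have h : HasSum (fun x : ℤ × ℤ => F y x.1 * F (p / y) x.2) (euler p y * euler p (p / y)) :=
    HasSum.mul (f := F y) (g := F (p / y)) (hF1 y) (hF1 _) h0
  let e : ℤ × ℤ ≃ ℤ × ℤ :=
    { toFun := fun x => (x.1 + x.2, x.2)
      invFun := fun x => (x.1 - x.2, x.2)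
      left_inv := fun x => by simp
      right_inv := fun x => by simp }
  have h2 := e.hasSum_iff.2 h
  refine h2.congr_fun fun x => ?_
  change _ = ((eulerCoeffZ p (x.1 + x.2) : ℂ) * y ^ (x.1 + x.2)) *
    ((eulerCoeffZ p x.2 : ℂ) * (p / y) ^ x.2)
  rw [Complex.ofReal_mul, Complex.ofReal_mul, Complex.ofReal_zpow]
  rw [zpow_add₀ hy, div_zpow]
  field_simp

lemma summable_jacobiCoeff (n : ℤ) :
    Summable fun k : ℤ => eulerCoeffZ p (n + k) * (eulerCoeffZ p k * p ^ k) := by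
  have := (hasSum_jacobi_double hp0 hp1 (y := 1) one_ne_zero).summable.prod_factor n
  simp only [one_zpow, mul_one] at this
  exact Complex.summable_ofReal.1 this

lemma hasSum_jacobiCoeff {y : ℂ} (hy : y ≠ 0) :
    HasSum (fun n : ℤ => (jacobiCoeff p n : ℂ) * y ^ n) (euler p y * euler p (p / y)) := by
  refine (hasSum_jacobi_double hp0 hp1 hy).prod_fiberwise fun n => ?_
  have h : HasSum (fun k : ℤ => ((eulerCoeffZ p (n + k) * (eulerCoeffZ p k * p ^ k) : ℝ) : ℂ))
      (jacobiCoeff p n : ℂ) := Complex.hasSum_ofReal.2 (summable_jacobiCoeff hp0 hp1 n).hasSum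
  exact h.mul_right (y ^ n)

/-- Both sides split into the same two sums u(n) and u(n+1): for the left one the recurrence
`eulerCoeffZ_eq` is applied to the first factor, for the right one to the second factor, followed by
a shift of k. -/
lemma jacobiCoeff_succ (n : ℤ) : jacobiCoeff p (n + 1) = p ^ n * jacobiCoeff p n := by
  have hs : ∀ m : ℤ, Summable fun k : ℤ =>
      eulerCoeffZ p (m + k) * p ^ (m + k) * (eulerCoeffZ p k * p ^ k) := by
    intro m
    have h1 := summable_jacobiCoeff hp0 hp1 m
    refine Summable.of_nonneg_of_le (fun k => ?_) (fun k => ?_) h1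
    · have := eulerCoeffZ_nonneg hp0 hp1 (m + k)
      have := eulerCoeffZ_nonneg hp0 hp1 k
      positivity
    · have h2 := eulerCoeffZ_nonneg hp0 hp1 k
      rcases lt_or_ge (m + k) 0 with h | h
      · simp [eulerCoeffZ_of_neg p h]
      · have h3 := eulerCoeffZ_nonneg hp0 hp1 (m + k)
        refine mul_le_mul_of_nonneg_right (mul_le_of_le_one_right h3 ?_) (by positivity)
        lift (m + k) to ℕ using h with i
        rw [zpow_natCast]; exact pow_le_one₀ hp0.le hp1.le
  set u : ℤ → ℝ := fun m => ∑' k : ℤ,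
    eulerCoeffZ p (m + k) * p ^ (m + k) * (eulerCoeffZ p k * p ^ k) with hu
  have e1 : jacobiCoeff p (n + 1) = u (n + 1) + u n := by
    rw [hu, jacobiCoeff, ← (hs (n + 1)).tsum_add (hs n)]
    refine tsum_congr fun k => ?_
    have := eulerCoeffZ_eq hp0 hp1 (n + k)
    rw [show n + 1 + k = n + k + 1 by ring]
    linear_combination (eulerCoeffZ p k * p ^ k) * this
  have e2 : p ^ n * jacobiCoeff p n = u n + u (n + 1) := by
    have : u (n + 1) = ∑' k : ℤ, eulerCoeffZ p (n + k) * p ^ (n + k) *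
        (eulerCoeffZ p (k - 1) * p ^ (k - 1)) := by
      rw [hu]
      simp only
      rw [← (Equiv.subRight (1 : ℤ)).tsum_eq (fun k : ℤ =>
        eulerCoeffZ p (n + 1 + k) * p ^ (n + 1 + k) * (eulerCoeffZ p k * p ^ k))]
      refine tsum_congr fun k => ?_
      simp only [Equiv.subRight_apply]
      rw [show n + 1 + (k - 1) = n + k by ring]
    have hs' : Summable fun k : ℤ => eulerCoeffZ p (n + k) * p ^ (n + k) *
        (eulerCoeffZ p (k - 1) * p ^ (k - 1)) := by
      have := (Equiv.subRight (1 : ℤ)).summable_iff.2 (hs (n + 1))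
      refine this.congr fun k => ?_
      simp only [Equiv.subRight_apply, Function.comp]
      rw [show n + 1 + (k - 1) = n + k by ring]
    rw [this, hu, jacobiCoeff, ← tsum_mul_left, ← (hs n).tsum_add hs']
    refine tsum_congr fun k => ?_
    have := eulerCoeffZ_eq hp0 hp1 (k - 1)
    rw [sub_add_cancel] at this
    rw [zpow_add₀ hp0.ne']
    linear_combination (eulerCoeffZ p (n + k) * p ^ k * p ^ n) * this
  rw [e1, e2, add_comm]

lemma jacobiCoeff_eq (n : ℤ) : jacobiCoeff p n = p ^ (n * (n - 1) / 2) * jacobiCoeff p 0 := by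
  induction n using Int.induction_on with
  | zero => simp
  | succ n ih => rw [jacobiCoeff_succ hp0 hp1, ih, triangular_succ, zpow_add₀ hp0.ne']; ring
  | pred n ih =>
    have h := jacobiCoeff_succ hp0 hp1 (-(n : ℤ) - 1)
    have h2 := triangular_succ (-(n : ℤ) - 1)
    rw [sub_add_cancel] at h h2
    rw [ih, h2, zpow_add₀ hp0.ne'] at h
    have h3 : p ^ (-(n : ℤ) - 1) ≠ 0 := zpow_ne_zero _ hp0.ne'
    apply mul_left_cancel₀ h3
    rw [← h]; ring

/-- The recurrence leaves one constant free. For every n it expresses the coefficient of index 0 as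
∑_k g n k. As n → ∞ only k = 0 survives, with limit 1/(p;p)_∞. -/
lemma jacobiCoeff_zero : jacobiCoeff p 0 = (eulerR p (-p))⁻¹ := by
  set g : ℕ → ℕ → ℝ := fun n k =>
    p ^ (n * k + k.choose 2) / qPoch p (n + k) * (eulerCoeff p k * p ^ k) with hg
  have e : ∀ n : ℕ, jacobiCoeff p 0 = ∑' k : ℕ, g n k := by
    intro n
    have h := jacobiCoeff_eq hp0 hp1 n
    rw [triangular_natCast, zpow_natCast] at h
    apply mul_left_cancel₀ (pow_ne_zero (n.choose 2) hp0.ne')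
    rw [← h, jacobiCoeff, ← tsum_mul_left]
    have hz : ∀ j : ℤ, j ∉ Set.range ((↑) : ℕ → ℤ) → j < 0 := fun j hj => by
      by_contra h
      exact hj ⟨j.toNat, Int.toNat_of_nonneg (not_lt.1 h)⟩
    rw [← (Nat.cast_injective (R := ℤ)).tsum_eq]
    · refine tsum_congr fun k => ?_
      rw [eulerCoeffZ_natCast, zpow_natCast, show (n : ℤ) + k = ((n + k : ℕ) : ℤ) by push_cast; rfl,
        eulerCoeffZ_natCast, hg, eulerCoeff]
      have : (n + k).choose 2 = n.choose 2 + (n * k + k.choose 2) := by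
        
        clear * -
        induction k with
        | zero => simp
        | succ k ih => rw [← add_assoc, choose_two_succ, ih, choose_two_succ]; ring
      simp only
      rw [this, pow_add p (n.choose 2)]
      ring
    · intro j hj
      by_contra h
      exact hj (by simp [eulerCoeffZ_of_neg p (hz j h)])
  have hE := eulerR_neg_p_pos hp0 hp1
  have hlim : Tendsto (fun n : ℕ => ∑' k : ℕ, g n k) atTop
      (𝓝 (∑' k : ℕ, if k = 0 then (eulerR p (-p))⁻¹ else 0)) := by
    have hP : ∀ k, Tendsto (fun n => (qPoch p (n + k))⁻¹) atTop (𝓝 (eulerR p (-p))⁻¹) := fun k =>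
      ((tendsto_add_atTop_iff_nat k).2 (tendsto_qPoch_real hp0 hp1)).inv₀ hE.ne'
    refine tendsto_tsum_of_dominated_convergence
      (bound := fun k => (eulerR p (-p))⁻¹ * (eulerCoeff p k * p ^ k))
      ((summable_eulerCoeff_mul_pow hp0 hp1 p).mul_left _) (fun k => ?_)
      (Eventually.of_forall fun n k => ?_)
    · rcases Nat.eq_zero_or_pos k with rfl | hk
      · simpa [hg] using hP 0
      · have h1 : Tendsto (fun n : ℕ => p ^ (n * k + k.choose 2)) atTop (𝓝 0) := by
          have := (tendsto_pow_atTop_nhds_zero_of_lt_one hp0.le hp1)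
          refine this.comp (tendsto_atTop_mono (fun n => ?_) tendsto_id)
          exact (Nat.le_mul_of_pos_right n hk).trans (Nat.le_add_right _ _)
        have := (h1.mul (hP k)).mul_const (eulerCoeff p k * p ^ k)
        simpa [hg, hk.ne', div_eq_mul_inv] using this
    · have h1 := qPoch_pos hp0 hp1 (n + k)
      have h2 := eulerCoeff_pos hp0 hp1 k
      rw [hg, Real.norm_of_nonneg (by positivity)]
      simp only
      gcongr
      rw [div_eq_mul_inv]
      calc _ ≤ 1 * (qPoch p (n + k))⁻¹ := by gcongr; exact pow_le_one₀ hp0.le hp1.le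
        _ ≤ _ := by rw [one_mul]; exact inv_anti₀ hE (eulerR_neg_p_le_qPoch hp0 hp1 _)
  rw [tsum_ite_eq] at hlim
  refine tendsto_nhds_unique ?_ hlim
  simp_rw [← e]
  exact tendsto_const_nhds

/-- The Jacobi triple product. -/
lemma hasSum_qTheta {y : ℂ} (hy : y ≠ 0) :
    HasSum (fun n : ℤ => (p : ℂ) ^ (n * (n - 1) / 2) * y ^ n)
      (euler p (-p) * (euler p y * euler p (p / y))) := by
  refine ((hasSum_jacobiCoeff hp0 hp1 hy).mul_left (euler p (-p))).congr_fun fun n => ?_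
  have := (eulerR_neg_p_pos hp0 hp1).ne'
  rw [jacobiCoeff_eq hp0 hp1, jacobiCoeff_zero hp0 hp1, euler_neg_p_real]
  push_cast
  have : (eulerR p (-p) : ℂ) ≠ 0 := by exact_mod_cast this
  field_simp

lemma qTheta_eq {y : ℂ} (hy : y ≠ 0) :
    qTheta p y = euler p (-p) * (euler p y * euler p (p / y)) :=
  (hasSum_qTheta hp0 hp1 hy).tsum_eq

lemma qTheta_eq_mul {y : ℂ} (hy : y ≠ 0) : qTheta p y = y * qTheta p (p * y) := by
  have hp : (p : ℂ) ≠ 0 := by exact_mod_cast hp0.ne'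
  rw [qTheta_eq hp0 hp1 hy, qTheta_eq hp0 hp1 (mul_ne_zero hp hy), euler_eq hp0 hp1 y,
    show (p : ℂ) / (p * y) = 1 / y by field_simp, euler_eq hp0 hp1 (1 / y), mul_one_div]
  field_simp
  ring

lemma continuousOn_qTheta : ContinuousOn (qTheta p) {0}ᶜ := by
  have h := (differentiable_euler hp0 hp1).continuous
  have : ContinuousOn (fun y : ℂ => euler p (-p) * (euler p y * euler p (p / y))) {0}ᶜ :=
    continuousOn_const.mul (h.continuousOn.mul (h.comp_continuousOn
      (continuousOn_const.div continuousOn_id fun y hy => hy)))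
  exact this.congr fun y hy => qTheta_eq hp0 hp1 hy

lemma qTheta_ne_zero {y : ℂ} (hy : y ≠ 0) (h : ∀ m : ℤ, 1 + (p : ℂ) ^ m * y ≠ 0) :
    qTheta p y ≠ 0 := by
  have hp : (p : ℂ) ≠ 0 := by exact_mod_cast hp0.ne'
  rw [qTheta_eq hp0 hp1 hy]
  refine mul_ne_zero ?_ (mul_ne_zero (euler_ne_zero hp0 hp1 fun j => by simpa using h j)
    (euler_ne_zero hp0 hp1 fun j hj => h (-(j + 1 : ℕ)) ?_))
  · rw [euler_neg_p_real]; exact_mod_cast (eulerR_neg_p_pos hp0 hp1).ne'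
  · rw [zpow_neg, zpow_natCast, pow_succ]
    field_simp at hj ⊢
    linear_combination hj

end

/-! ### Lower bounds off the zeros of θ_p, and the expansion of one kernel in the other. -/

/-- `|θ_p(y)| / θ_p(|y|)`, a function of `y p^ℤ`. -/
def thetaRatio (p : ℝ) (y : ℂ) : ℝ :=
  ‖qTheta p y‖ / (eulerR p (-p) * (eulerR p ‖y‖ * eulerR p (p / ‖y‖)))

section
variable {p : ℝ} (hp0 : 0 < p) (hp1 : p < 1)
include hp0 hp1

lemma norm_qTheta {y : ℂ} (hy : y ≠ 0) :
    ‖qTheta p y‖ = eulerR p (-p) * (‖euler p y‖ * ‖euler p (p / y)‖) := by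
  rw [qTheta_eq hp0 hp1 hy, norm_mul, norm_mul, euler_neg_p_real, Complex.norm_real,
    Real.norm_of_nonneg (eulerR_neg_p_pos hp0 hp1).le]

lemma norm_euler_p_div_le (y : ℂ) : ‖euler p (p / y)‖ ≤ eulerR p (p / ‖y‖) := by
  refine (norm_euler_le hp0 hp1 _).trans (le_of_eq ?_)
  rw [norm_div, Complex.norm_real, Real.norm_of_nonneg hp0.le]

lemma thetaRatio_denom_pos (y : ℂ) :
    0 < eulerR p (-p) * (eulerR p ‖y‖ * eulerR p (p / ‖y‖)) :=
  mul_pos (eulerR_neg_p_pos hp0 hp1) (mul_pos (eulerR_pos hp0 hp1 (norm_nonneg y))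
    (eulerR_pos hp0 hp1 (by positivity)))

lemma thetaRatio_nonneg (y : ℂ) : 0 ≤ thetaRatio p y :=
  div_nonneg (norm_nonneg _) (thetaRatio_denom_pos hp0 hp1 y).le

lemma thetaRatio_pos {y : ℂ} (h : qTheta p y ≠ 0) : 0 < thetaRatio p y :=
  div_pos (norm_pos_iff.2 h) (thetaRatio_denom_pos hp0 hp1 y)

lemma thetaRatio_mul_eq (y : ℂ) :
    thetaRatio p y * (eulerR p (-p) * (eulerR p ‖y‖ * eulerR p (p / ‖y‖))) = ‖qTheta p y‖ :=
  div_mul_cancel₀ _ (thetaRatio_denom_pos hp0 hp1 y).ne'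

/-- The relation θ_p(y) = y θ_p(py) holds at y and at ‖y‖, and the factor ‖y‖ cancels. -/
lemma thetaRatio_p_mul {y : ℂ} (hy : y ≠ 0) : thetaRatio p (p * y) = thetaRatio p y := by
  have hy' : 0 < ‖y‖ := norm_pos_iff.2 hy
  have h1 := eulerR_eq hp0 hp1 ‖y‖
  have h2 := eulerR_eq hp0 hp1 (p / (p * ‖y‖))
  have h3 : ‖qTheta p y‖ = ‖y‖ * ‖qTheta p (p * y)‖ := by
    rw [qTheta_eq_mul hp0 hp1 hy, norm_mul]
  have h4 : ‖(p : ℂ) * y‖ = p * ‖y‖ := by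
    rw [norm_mul, Complex.norm_real, Real.norm_of_nonneg hp0.le]
  have e : p * (p / (p * ‖y‖)) = p / ‖y‖ := by field_simp
  rw [e] at h2
  have p1 := eulerR_neg_p_pos hp0 hp1
  have p2 := eulerR_pos hp0 hp1 (show 0 ≤ p * ‖y‖ by positivity)
  have p3 := eulerR_pos hp0 hp1 (show 0 ≤ p / ‖y‖ by positivity)
  rw [thetaRatio, thetaRatio, h4, h3, h1, h2, div_eq_div_iff (by positivity) (by positivity)]
  field_simp
  ring

lemma thetaRatio_zpow_mul {y : ℂ} (hy : y ≠ 0) (m : ℤ) :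
    thetaRatio p ((p : ℂ) ^ m * y) = thetaRatio p y := by
  have hp : (p : ℂ) ≠ 0 := by exact_mod_cast hp0.ne'
  induction m using Int.induction_on with
  | zero => simp
  | succ n ih =>
    rw [← ih, zpow_add₀ hp, zpow_one, mul_comm _ (p : ℂ), mul_assoc,
      thetaRatio_p_mul hp0 hp1 (mul_ne_zero (zpow_ne_zero _ hp) hy)]
  | pred n ih =>
    rw [← ih, ← thetaRatio_p_mul hp0 hp1 (mul_ne_zero (zpow_ne_zero _ hp) hy), ← mul_assoc,
      ← zpow_one_add₀ hp]
    congr 3; ring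

/-- In |θ_p(y)| only the factor E(p/y) is replaced by its majorant, which then cancels. -/
lemma thetaRatio_mul_eulerR_le_norm_euler {y : ℂ} (hy : y ≠ 0) :
    thetaRatio p y * eulerR p ‖y‖ ≤ ‖euler p y‖ := by
  have p1 := eulerR_neg_p_pos hp0 hp1
  have p3 := eulerR_pos hp0 hp1 (show 0 ≤ p / ‖y‖ by positivity)
  have h := thetaRatio_mul_eq hp0 hp1 y
  rw [norm_qTheta hp0 hp1 hy] at h
  have h2 : eulerR p (-p) * (‖euler p y‖ * ‖euler p (p / y)‖) ≤
      eulerR p (-p) * (‖euler p y‖ * eulerR p (p / ‖y‖)) := by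
    gcongr; exact norm_euler_p_div_le hp0 hp1 y
  have h3 : (thetaRatio p y * eulerR p ‖y‖) * (eulerR p (-p) * eulerR p (p / ‖y‖)) ≤
      ‖euler p y‖ * (eulerR p (-p) * eulerR p (p / ‖y‖)) := by
    calc _ = _ := by ring
      _ ≤ _ := h.le.trans h2
      _ = _ := by ring
  exact le_of_mul_le_mul_right h3 (by positivity)

/-- The same comparison, keeping the single factor 1 + y of E(y). With y = -ξ/a it bounds ‖ξ - a‖
from below off the spiral of a root a. -/
lemma thetaRatio_mul_one_add_le {y : ℂ} (hy : y ≠ 0) :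
    thetaRatio p y * (1 + ‖y‖) ≤ ‖1 + y‖ := by
  have p2 := eulerR_pos hp0 hp1 (show 0 ≤ p * ‖y‖ by positivity)
  have h := thetaRatio_mul_eulerR_le_norm_euler hp0 hp1 hy
  rw [euler_eq hp0 hp1 y, eulerR_eq hp0 hp1, norm_mul] at h
  have h2 : ‖euler p (p * y)‖ ≤ eulerR p (p * ‖y‖) := by
    refine (norm_euler_le hp0 hp1 _).trans (le_of_eq ?_)
    rw [norm_mul, Complex.norm_real, Real.norm_of_nonneg hp0.le]
  refine le_of_mul_le_mul_right ?_ p2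
  calc _ = _ := by ring
    _ ≤ _ := h
    _ ≤ _ := by gcongr

lemma thetaRatio_mul_eulerR_le_norm_qTheta (y : ℂ) :
    thetaRatio p y * (eulerR p (-p) * eulerR p ‖y‖) ≤ ‖qTheta p y‖ := by
  have p1 := eulerR_neg_p_pos hp0 hp1
  have p2 := eulerR_pos hp0 hp1 (norm_nonneg y)
  rw [← thetaRatio_mul_eq hp0 hp1 y]
  refine mul_le_mul_of_nonneg_left ?_ (thetaRatio_nonneg hp0 hp1 y)
  refine mul_le_mul_of_nonneg_left ?_ p1.le
  exact le_mul_of_one_le_right p2.le (one_le_eulerR hp0 hp1 (by positivity))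

lemma continuous_eulerR : Continuous (eulerR p) := by
  have : Continuous fun t : ℝ => (euler p (t : ℂ)).re :=
    Complex.continuous_re.comp ((differentiable_euler hp0 hp1).continuous.comp continuous_ofReal)
  simpa [euler_ofReal] using this

lemma continuousOn_thetaRatio : ContinuousOn (thetaRatio p) {0}ᶜ := by
  have h := continuous_eulerR hp0 hp1
  refine (continuousOn_qTheta hp0 hp1).norm.div (continuousOn_const.mul
    ((h.comp continuous_norm).continuousOn.mul (h.comp_continuousOn
      (continuousOn_const.div continuous_norm.continuousOn fun y hy => ?_))))
    fun y _ => (thetaRatio_denom_pos hp0 hp1 y).ne'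
  simpa using hy

lemma qTheta_mul_inv_pow {y : ℂ} (hy : y ≠ 0) (k : ℕ) :
    qTheta p (y * ((p : ℂ) ^ k)⁻¹) * (eulerCoeff p k * (p / y) ^ k * qPoch p k : ℂ)
      = qTheta p y := by
  have hp : (p : ℂ) ≠ 0 := by exact_mod_cast hp0.ne'
  induction k with
  | zero => simp
  | succ k ih =>
    rw [← ih]
    have h1 : y * ((p : ℂ) ^ (k + 1))⁻¹ ≠ 0 := mul_ne_zero hy (inv_ne_zero (pow_ne_zero _ hp))
    rw [qTheta_eq_mul hp0 hp1 h1]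
    have h2 : (p : ℂ) * (y * ((p : ℂ) ^ (k + 1))⁻¹) = y * ((p : ℂ) ^ k)⁻¹ := by
      rw [pow_succ]; field_simp
    have h3 := congrArg (fun r : ℝ => (r : ℂ)) (eulerCoeff_succ_mul hp0 hp1 k)
    push_cast at h3
    rw [h2, qPoch_succ]
    push_cast
    rw [div_pow, div_pow, pow_succ y]
    field_simp
    linear_combination (qTheta p (y / p ^ k) * qPoch p k) * h3

/-- `1 / θ_p` expands the kernel `1 / (-y;p)_∞`. -/
lemma inv_qPoch_mul_qTheta_eq {y : ℂ} (hy : y ≠ 0) (k : ℕ) :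
    ((qPoch p k : ℂ) * qTheta p (y * ((p : ℂ) ^ k)⁻¹))⁻¹ =
      eulerCoeff p k * (p / y) ^ k / qTheta p y := by
  have hp : (p : ℂ) ≠ 0 := by exact_mod_cast hp0.ne'
  have h1 : (qPoch p k : ℂ) ≠ 0 := by exact_mod_cast (qPoch_pos hp0 hp1 k).ne'
  have h2 : (eulerCoeff p k : ℂ) ≠ 0 := by exact_mod_cast (eulerCoeff_pos hp0 hp1 k).ne'
  have h3 : ((p : ℂ) / y) ^ k ≠ 0 := pow_ne_zero _ (div_ne_zero hp hy)
  rw [← qTheta_mul_inv_pow hp0 hp1 hy k]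
  rcases eq_or_ne (qTheta p (y * ((p : ℂ) ^ k)⁻¹)) 0 with h | h
  · rw [h]; simp
  · rw [eq_div_iff (mul_ne_zero h (mul_ne_zero (mul_ne_zero h2 h3) h1)),
      inv_mul_eq_iff_eq_mul₀ (mul_ne_zero h1 h)]
    ring

/-- Euler's series for E(p/y), divided by θ_p(y) = (p;p)_∞ E(y) E(p/y). -/
lemma hasSum_inv_qTheta {y : ℂ} (hy : y ≠ 0) (hθ : qTheta p y ≠ 0) :
    HasSum (fun k : ℕ => ((qPoch p k : ℂ) * qTheta p (y * ((p : ℂ) ^ k)⁻¹))⁻¹)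
      (euler p (-p) * euler p y)⁻¹ := by
  have h := (hasSum_euler hp0 hp1 (p / y)).div_const (qTheta p y)
  have e : euler p (p / y) / qTheta p y = (euler p (-p) * euler p y)⁻¹ := by
    rw [qTheta_eq hp0 hp1 hy] at hθ ⊢
    have h1 := left_ne_zero_of_mul hθ
    have h2 := left_ne_zero_of_mul (right_ne_zero_of_mul hθ)
    have h3 := right_ne_zero_of_mul (right_ne_zero_of_mul hθ)
    field_simp
  rw [e] at h
  exact h.congr_fun fun k => inv_qPoch_mul_qTheta_eq hp0 hp1 hy k

/-- The terms are those of Euler's series at p/‖y‖ over ‖θ_p(y)‖, so their absolute sum is explicit.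
It gives the absolute convergence of the double series behind the equality of the discrete sums. -/
lemma hasSum_norm_inv_qTheta {y : ℂ} (hy : y ≠ 0) (hθ : qTheta p y ≠ 0) :
    HasSum (fun k : ℕ => ‖((qPoch p k : ℂ) * qTheta p (y * ((p : ℂ) ^ k)⁻¹))⁻¹‖)
      (thetaRatio p y * (eulerR p (-p) * eulerR p ‖y‖))⁻¹ := by
  have h := (hasSum_eulerR hp0 hp1 (p / ‖y‖)).div_const ‖qTheta p y‖
  have hr := (thetaRatio_pos hp0 hp1 hθ).ne'
  have e : eulerR p (p / ‖y‖) / ‖qTheta p y‖ =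
      (thetaRatio p y * (eulerR p (-p) * eulerR p ‖y‖))⁻¹ := by
    rw [← thetaRatio_mul_eq hp0 hp1 y]
    have p1 := (eulerR_neg_p_pos hp0 hp1).ne'
    have p2 := (eulerR_pos hp0 hp1 (norm_nonneg y)).ne'
    have p3 := (eulerR_pos hp0 hp1 (show 0 ≤ p / ‖y‖ by positivity)).ne'
    field_simp
  rw [e] at h
  refine h.congr_fun fun k => ?_
  rw [inv_qPoch_mul_qTheta_eq hp0 hp1 hy k, norm_div, norm_mul, norm_pow, norm_div,
    Complex.norm_real, Complex.norm_real, Real.norm_of_nonneg hp0.le,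
    Real.norm_of_nonneg (eulerCoeff_pos hp0 hp1 k).le]

/-- Powers of t are paid for by a dilation of the argument: `pow_mul_eulerR_le` is used at s t /
p^N. The converse trade is `eulerR_le_one_add_pow_mul`. -/
lemma exists_pow_mul_eulerR_le (N : ℕ) {s : ℝ} (hs : 0 < s) :
    ∃ C c : ℝ, 0 < C ∧ 0 < c ∧ ∀ t, 0 ≤ t → t ^ N * eulerR p (s * t) ≤ C * eulerR p (c * t) := by
  refine ⟨(((s / p ^ N) ^ N) * p ^ (N.choose 2))⁻¹, s / p ^ N, by positivity, by positivity,
    fun t ht => ?_⟩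
  have h := pow_mul_eulerR_le hp0 hp1 (show 0 ≤ s / p ^ N * t by positivity) N
  rw [show p ^ N * (s / p ^ N * t) = s * t by field_simp, mul_pow] at h
  rw [inv_mul_eq_div, le_div_iff₀ (by positivity)]
  calc _ = _ := by ring
    _ ≤ _ := h

lemma eulerR_le_one_add_pow_mul {t : ℝ} (ht : 0 ≤ t) (N : ℕ) :
    eulerR p t ≤ (1 + t) ^ N * eulerR p (p ^ N * t) := by
  induction N with
  | zero => simp
  | succ N ih =>
    refine ih.trans ?_
    rw [eulerR_eq hp0 hp1 (p ^ N * t), pow_succ, mul_assoc, ← mul_assoc p, ← pow_succ']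
    have := eulerR_pos hp0 hp1 (show 0 ≤ p ^ (N + 1) * t by positivity)
    have : p ^ N * t ≤ t := mul_le_of_le_one_left ht (pow_le_one₀ hp0.le hp1.le)
    gcongr

/-- E(t/p²) = (1 + t/p²)(1 + t/p) E(t). The gain (1+t)⁻² is what makes the sums over p^ℤ and the
integrals over the half line converge. -/
lemma eulerR_div_eulerR_le {t : ℝ} (ht : 0 ≤ t) :
    eulerR p t ≤ eulerR p (t / p ^ 2) / (1 + t) ^ 2 := by
  have h1 := eulerR_eq hp0 hp1 (t / p ^ 2)
  have h2 := eulerR_eq hp0 hp1 (t / p)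
  rw [show p * (t / p ^ 2) = t / p by field_simp] at h1
  rw [show p * (t / p) = t by field_simp] at h2
  rw [h1, h2, le_div_iff₀ (by positivity)]
  have h3 := eulerR_pos hp0 hp1 ht
  have h4 : t ≤ t / p := by rw [le_div_iff₀ hp0]; nlinarith
  have h5 : t ≤ t / p ^ 2 := by
    rw [le_div_iff₀ (by positivity)]
    exact mul_le_of_le_one_right ht (pow_le_one₀ hp0.le hp1.le)
  calc eulerR p t * (1 + t) ^ 2 = (1 + t) * ((1 + t) * eulerR p t) := by ring
    _ ≤ _ := by gcongr

end

/-! ### The q-exponential, and q-exponential growth measured by Euler's series. -/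

section
variable {q : ℝ} (hq : 1 < q)
include hq

lemma qFactorial_mul (n : ℕ) :
    qFactorial q n * (eulerCoeff q⁻¹ n * (1 - q⁻¹) ^ n) = 1 := by
  have hq0 : 0 < q := by linarith
  induction n with
  | zero => simp [qFactorial]
  | succ n ih =>
    have h := eulerCoeff_succ_mul (inv_pos.2 hq0) (inv_lt_one_of_one_lt₀ hq) n
    have h0 := one_sub_pow_pos (inv_pos.2 hq0) (inv_lt_one_of_one_lt₀ hq) n
    have e : qNumber q (n + 1) * (1 - q⁻¹) * q⁻¹ ^ n = 1 - q⁻¹ ^ (n + 1) := by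
      rw [qNumber, geom_sum_eq hq.ne']
      have : q - 1 ≠ 0 := by linarith
      simp only [inv_pow, pow_succ]
      field_simp
    rw [qFactorial, Finset.prod_range_succ, ← qFactorial]
    apply mul_right_cancel₀ h0.ne'
    calc _ = qFactorial q n * qNumber q (n + 1) * (1 - q⁻¹) ^ (n + 1) *
          (eulerCoeff q⁻¹ (n + 1) * (1 - q⁻¹ ^ (n + 1))) := by ring
      _ = (qFactorial q n * (eulerCoeff q⁻¹ n * (1 - q⁻¹) ^ n)) *
          (qNumber q (n + 1) * (1 - q⁻¹) * q⁻¹ ^ n) := by rw [h]; ring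
      _ = _ := by rw [ih, e]

lemma inv_qFactorial (n : ℕ) : (qFactorial q n)⁻¹ = eulerCoeff q⁻¹ n * (1 - q⁻¹) ^ n :=
  inv_eq_of_mul_eq_one_right (qFactorial_mul hq n)

lemma qExp_eq (x : ℂ) : qExp q x = euler q⁻¹ ((1 - (q : ℂ)⁻¹) * x) := by
  refine tsum_congr fun n => ?_
  have := congrArg (fun r : ℝ => (r : ℂ)) (inv_qFactorial hq n)
  push_cast at this
  rw [div_eq_mul_inv, this, mul_pow]
  ring

lemma norm_qExp_ofReal {t : ℝ} (ht : 0 ≤ t) :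
    ‖qExp q (t : ℂ)‖ = eulerR q⁻¹ ((1 - q⁻¹) * t) := by
  have hq0 : 0 < q := by linarith
  have hp1 := inv_lt_one_of_one_lt₀ hq
  have h : (1 - (q : ℂ)⁻¹) * t = (((1 - q⁻¹) * t : ℝ) : ℂ) := by push_cast; rfl
  rw [qExp_eq hq, h, euler_ofReal, Complex.norm_real, Real.norm_of_nonneg]
  exact (eulerR_pos (inv_pos.2 hq0) hp1 (mul_nonneg (by linarith) ht)).le

/-- The bound C E(c‖x‖) with free constants is the working form of the growth condition. It is
stable under dilations of x, and `hasQExpGrowth_of_le` is the way back. -/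
lemma HasQExpGrowth.exists_eulerR {Ω : Set ℂ} {Φ : ℂ → ℂ} (h : HasQExpGrowth q Ω Φ) :
    ∃ C c A : ℝ, 0 < C ∧ 0 < c ∧ ∀ x ∈ Ω, A ≤ ‖x‖ → ‖Φ x‖ ≤ C * eulerR q⁻¹ (c * ‖x‖) := by
  have hq0 : 0 < q := by linarith
  have hp1 := inv_lt_one_of_one_lt₀ hq
  obtain ⟨K, hK, μ, hμ, A, hA⟩ := h
  obtain ⟨C, c, hC, hc, hCc⟩ := exists_pow_mul_eulerR_le (inv_pos.2 hq0) hp1 ⌈μ⌉₊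
    (s := 1 - q⁻¹) (by linarith)
  refine ⟨K * C, c, max A 1, by positivity, hc, fun x hx hxA => ?_⟩
  have h1 : 1 ≤ ‖x‖ := (le_max_right _ _).trans hxA
  refine (hA x hx ((le_max_left _ _).trans hxA)).le.trans ?_
  rw [norm_qExp_ofReal hq (norm_nonneg x), mul_assoc, mul_assoc]
  refine mul_le_mul_of_nonneg_left (le_trans ?_ (hCc _ (norm_nonneg x))) hK.le
  have h2 := eulerR_pos (inv_pos.2 hq0) hp1
    (show 0 ≤ (1 - q⁻¹) * ‖x‖ from mul_nonneg (by linarith) (norm_nonneg x))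
  refine mul_le_mul_of_nonneg_right ?_ h2.le
  rw [← Real.rpow_natCast]
  exact Real.rpow_le_rpow_of_exponent_le h1 (Nat.le_ceil μ)

lemma hasQExpGrowth_of_le {Ω : Set ℂ} {Φ : ℂ → ℂ} {C c A : ℝ} (hc : 0 < c)
    (h : ∀ x ∈ Ω, A ≤ ‖x‖ → ‖Φ x‖ ≤ C * eulerR q⁻¹ (c * ‖x‖)) : HasQExpGrowth q Ω Φ := by
  have hq0 : 0 < q := by linarith
  have hp0 := inv_pos.2 hq0
  have hp1 := inv_lt_one_of_one_lt₀ hq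
  -- The constant c is brought below the 1 - p of e_q(t) = E((1-p)t), at the price of a polynomial
  -- factor of degree N.
  obtain ⟨N, hN⟩ : ∃ N : ℕ, q⁻¹ ^ N * c ≤ 1 - q⁻¹ := by
    obtain ⟨N, hN⟩ := exists_pow_lt_of_lt_one (show 0 < (1 - q⁻¹) / c from div_pos (by linarith) hc)
      hp1
    exact ⟨N, ((lt_div_iff₀ hc).1 hN).le⟩
  -- The exponent N + 1 is positive even when N = 0, and |C| + 1 makes the inequality strict.
  refine ⟨(|C| + 1) * (1 + c) ^ N, by positivity, N + 1, by positivity, max A 1,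
    fun x hx hxA => ?_⟩
  have h1 : 1 ≤ ‖x‖ := (le_max_right _ _).trans hxA
  have e1 := h x hx ((le_max_left _ _).trans hxA)
  have hcx : 0 ≤ c * ‖x‖ := by positivity
  have e2 := eulerR_le_one_add_pow_mul hp0 hp1 hcx N
  have e3 : eulerR q⁻¹ (q⁻¹ ^ N * (c * ‖x‖)) ≤ eulerR q⁻¹ ((1 - q⁻¹) * ‖x‖) := by
    refine eulerR_mono hp0 hp1 (by positivity) ?_
    rw [← mul_assoc]; gcongr
  have e4 := eulerR_pos hp0 hp1
    (show 0 ≤ (1 - q⁻¹) * ‖x‖ from mul_nonneg (by linarith) (norm_nonneg x))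
  have e5 : (1 + c * ‖x‖) ^ N ≤ (1 + c) ^ N * ‖x‖ ^ (N + 1) := by
    calc (1 + c * ‖x‖) ^ N ≤ ((1 + c) * ‖x‖) ^ N := by gcongr; nlinarith
      _ = (1 + c) ^ N * ‖x‖ ^ N := mul_pow _ _ _
      _ ≤ _ := by gcongr; exact N.le_succ
  rw [norm_qExp_ofReal hq (norm_nonneg x)]
  have e6 : ‖x‖ ^ ((N : ℝ) + 1) = ‖x‖ ^ (N + 1) := by
    rw [← Real.rpow_natCast]; push_cast; rfl
  rw [e6]
  have e7 := eulerR_pos hp0 hp1 hcx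
  calc ‖Φ x‖ ≤ C * eulerR q⁻¹ (c * ‖x‖) := e1
    _ < (|C| + 1) * eulerR q⁻¹ (c * ‖x‖) := by gcongr; linarith [le_abs_self C]
    _ ≤ (|C| + 1) * (((1 + c) ^ N * ‖x‖ ^ (N + 1)) * eulerR q⁻¹ ((1 - q⁻¹) * ‖x‖)) := by
      gcongr
      exact e2.trans (mul_le_mul e5 e3 (eulerR_pos hp0 hp1 (by positivity)).le (by positivity))
    _ = _ := by ring

end

/-! ### Division of Taylor coefficients by (p;p)_n, and equality of the discrete sums. -/

lemma HasSum.antidiagonal {F : ℕ × ℕ → ℂ} {s : ℂ} (h : HasSum F s) :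
    HasSum (fun N => ∑ x ∈ Finset.HasAntidiagonal.antidiagonal N, F x) s := by
  have h2 := (Finset.HasAntidiagonal.sigmaAntidiagonalEquivProd (A := ℕ)).hasSum_iff.2 h
  refine h2.sigma fun N => ?_
  rw [← Finset.sum_coe_sort]
  exact hasSum_fintype _

/-- The operator on functions which divides the `n`-th Taylor coefficient at `0` by `(p;p)_n`. -/
def divPoch (p : ℝ) (b : ℂ → ℂ) (ξ : ℂ) : ℂ :=
  (euler p (-p))⁻¹ * ∑' k : ℕ, (eulerCoeff p k : ℂ) * (-p) ^ k * b ((p : ℂ) ^ k * ξ)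

section
variable {p : ℝ} (hp0 : 0 < p) (hp1 : p < 1)
include hp0 hp1

/-- The generating functions are F = 1/(pz;p)_∞ and G = (pz;p)_∞. Since F(pz) = (1-pz)F(z) and G(z)
= (1-pz)G(pz), the product FG is invariant under z ↦ pz, so it is constant. This inverts `divPoch`.
-/
lemma sum_antidiagonal_eulerCoeff (N : ℕ) :
    ∑ x ∈ Finset.HasAntidiagonal.antidiagonal N, (p ^ x.1 / qPoch p x.1) *
      (eulerCoeff p x.2 * (-p) ^ x.2) = if N = 0 then 1 else 0 := by
  set F : PowerSeries ℝ := PowerSeries.mk fun i => p ^ i / qPoch p i with hF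
  set G : PowerSeries ℝ := PowerSeries.mk fun i => eulerCoeff p i * (-p) ^ i with hG
  set P : PowerSeries ℝ := 1 - PowerSeries.X * PowerSeries.C p with hP
  have h1 : PowerSeries.rescale p F = P * F := by
    ext n
    rw [hP, sub_mul, one_mul, map_sub, mul_assoc]
    cases n with
    | zero => simp [hF]
    | succ n =>
      rw [PowerSeries.coeff_succ_X_mul, PowerSeries.coeff_C_mul, PowerSeries.coeff_rescale, hF,
        PowerSeries.coeff_mk, PowerSeries.coeff_mk, qPoch_succ]
      have := (qPoch_pos hp0 hp1 n).ne'
      have := (one_sub_pow_pos hp0 hp1 n).ne'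
      field_simp
      ring
  have h2 : G = P * PowerSeries.rescale p G := by
    ext n
    rw [hP, sub_mul, one_mul, map_sub, mul_assoc]
    cases n with
    | zero => simp [hG]
    | succ n =>
      rw [PowerSeries.coeff_succ_X_mul, PowerSeries.coeff_C_mul, PowerSeries.coeff_rescale,
        PowerSeries.coeff_rescale, hG, PowerSeries.coeff_mk, PowerSeries.coeff_mk]
      have := eulerCoeff_succ hp0 hp1 n
      linear_combination (-p) ^ (n + 1) * this
  have h3 : PowerSeries.rescale p (F * G) = F * G := by
    rw [map_mul, h1]
    conv_rhs => rw [h2]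
    ring
  have h4 := congrArg (PowerSeries.coeff N) h3
  rw [PowerSeries.coeff_rescale, PowerSeries.coeff_mul] at h4
  simp only [hF, hG, PowerSeries.coeff_mk] at h4
  split_ifs with hN
  · subst hN; simp
  · have h5 : p ^ N < 1 := pow_lt_one₀ hp0.le hp1 hN
    have h6 : (p ^ N - 1) ≠ 0 := by linarith
    apply mul_left_cancel₀ h6
    linear_combination h4

lemma summable_pow_div_qPoch : Summable fun k : ℕ => p ^ k / qPoch p k := by
  refine Summable.of_nonneg_of_le (fun k => div_nonneg (pow_pos hp0 k).le (qPoch_pos hp0 hp1 k).le)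
    (fun k => ?_) ((summable_geometric_of_lt_one hp0.le hp1).mul_right (eulerR p (-p))⁻¹)
  rw [div_eq_mul_inv]
  exact mul_le_mul_of_nonneg_left (inv_anti₀ (eulerR_neg_p_pos hp0 hp1)
    (eulerR_neg_p_le_qPoch hp0 hp1 k)) (pow_pos hp0 k).le

lemma euler_neg_p_ne_zero : euler p (-p) ≠ 0 := by
  rw [euler_neg_p_real]; exact_mod_cast (eulerR_neg_p_pos hp0 hp1).ne'

lemma norm_euler_neg_p : ‖euler p (-p)‖ = eulerR p (-p) := by
  rw [euler_neg_p_real, Complex.norm_real, Real.norm_of_nonneg (eulerR_neg_p_pos hp0 hp1).le]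

lemma norm_divPoch_term_le {w : ℂ} {M : ℝ} (hM : ‖w‖ ≤ M) (k : ℕ) :
    ‖(eulerCoeff p k : ℂ) * (-p) ^ k * w‖ ≤ eulerCoeff p k * p ^ k * M := by
  have := eulerCoeff_pos hp0 hp1 k
  rw [norm_mul, norm_mul, norm_pow, norm_neg, Complex.norm_real, Complex.norm_real,
    Real.norm_of_nonneg hp0.le, Real.norm_of_nonneg this.le]
  gcongr

lemma hasSum_divPoch {b : ℂ → ℂ} {ξ : ℂ} {M : ℝ} (hb : ∀ k : ℕ, ‖b ((p : ℂ) ^ k * ξ)‖ ≤ M) :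
    HasSum (fun k : ℕ => (eulerCoeff p k : ℂ) * (-p) ^ k * b ((p : ℂ) ^ k * ξ))
      (euler p (-p) * divPoch p b ξ) := by
  have : Summable fun k : ℕ => (eulerCoeff p k : ℂ) * (-p) ^ k * b ((p : ℂ) ^ k * ξ) :=
    Summable.of_norm_bounded ((summable_eulerCoeff_mul_pow hp0 hp1 p).mul_right M)
      fun k => norm_divPoch_term_le hp0 hp1 (hb k) k
  rw [divPoch, mul_inv_cancel_left₀ (euler_neg_p_ne_zero hp0 hp1)]
  exact this.hasSum

lemma norm_divPoch_le {b : ℂ → ℂ} {ξ : ℂ} {M : ℝ} (hb : ∀ k : ℕ, ‖b ((p : ℂ) ^ k * ξ)‖ ≤ M) :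
    ‖divPoch p b ξ‖ ≤ (eulerR p (-p))⁻¹ * (eulerR p p * M) := by
  rw [divPoch, norm_mul, norm_inv, norm_euler_neg_p hp0 hp1]
  refine mul_le_mul_of_nonneg_left ?_ (inv_pos.2 (eulerR_neg_p_pos hp0 hp1)).le
  exact tsum_of_norm_bounded ((hasSum_eulerR hp0 hp1 p).mul_right M)
    fun k => norm_divPoch_term_le hp0 hp1 (hb k) k

/-- Inversion of `divPoch`. -/
lemma hasSum_divPoch_inv {b : ℂ → ℂ} {ξ : ℂ} {M : ℝ} (hb : ∀ k : ℕ, ‖b ((p : ℂ) ^ k * ξ)‖ ≤ M) :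
    HasSum (fun k : ℕ => ((p ^ k / qPoch p k : ℝ) : ℂ) * divPoch p b ((p : ℂ) ^ k * ξ))
      (b ξ / euler p (-p)) := by
  have hE := euler_neg_p_ne_zero hp0 hp1
  set F : ℕ × ℕ → ℂ := fun x => ((p ^ x.1 / qPoch p x.1 : ℝ) : ℂ) *
    ((eulerCoeff p x.2 : ℂ) * (-p) ^ x.2 * b ((p : ℂ) ^ (x.1 + x.2) * ξ)) with hF
  have hq : ∀ k, 0 ≤ p ^ k / qPoch p k := fun k =>
    div_nonneg (pow_pos hp0 k).le (qPoch_pos hp0 hp1 k).le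
  have hsum : Summable F := by
    have h1 : Summable fun x : ℕ × ℕ =>
        (p ^ x.1 / qPoch p x.1) * (eulerCoeff p x.2 * p ^ x.2 * M) :=
      Summable.mul_of_nonneg (f := fun k : ℕ => p ^ k / qPoch p k)
        (g := fun k : ℕ => eulerCoeff p k * p ^ k * M) (summable_pow_div_qPoch hp0 hp1)
        ((summable_eulerCoeff_mul_pow hp0 hp1 p).mul_right M) hq
        fun k => mul_nonneg (mul_nonneg (eulerCoeff_pos hp0 hp1 k).le (pow_pos hp0 k).le)
          ((norm_nonneg _).trans (hb 0))
    refine Summable.of_norm_bounded h1 fun x => ?_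
    rw [hF, norm_mul, Complex.norm_real, Real.norm_of_nonneg (hq _)]
    exact mul_le_mul_of_nonneg_left (norm_divPoch_term_le hp0 hp1 (hb _) _) (hq _)
  have h1 : HasSum (fun N => ∑ x ∈ Finset.HasAntidiagonal.antidiagonal N, F x) (b ξ) := by
    have e : ∀ N, ∑ x ∈ Finset.HasAntidiagonal.antidiagonal N, F x = if N = 0 then b ξ else 0 := by
      intro N
      have h := congrArg (fun r : ℝ => (r : ℂ)) (sum_antidiagonal_eulerCoeff hp0 hp1 N)
      simp only [Complex.ofReal_sum] at h
      have : ∑ x ∈ Finset.HasAntidiagonal.antidiagonal N, F x =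
          (∑ x ∈ Finset.HasAntidiagonal.antidiagonal N, (((p ^ x.1 / qPoch p x.1) * (eulerCoeff p x.2 * (-p) ^ x.2) : ℝ) : ℂ)) *
            b ((p : ℂ) ^ N * ξ) := by
        rw [Finset.sum_mul]
        refine Finset.sum_congr rfl fun x hx => ?_
        rw [Finset.HasAntidiagonal.mem_antidiagonal] at hx
        rw [hF]; simp only [hx]; push_cast; ring
      rw [this, h]
      split_ifs with hN
      · simp [hN]
      · simp
    simp_rw [e]
    exact hasSum_ite_eq 0 (b ξ)
  have h2 : HasSum F (b ξ) := by
    have := hsum.hasSum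
    rwa [this.antidiagonal.unique h1] at this
  have h3 : ∀ k, HasSum (fun j => F (k, j))
      (((p ^ k / qPoch p k : ℝ) : ℂ) * (euler p (-p) * divPoch p b ((p : ℂ) ^ k * ξ))) := by
    intro k
    have := hasSum_divPoch hp0 hp1 (b := b) (ξ := (p : ℂ) ^ k * ξ) (M := M) fun j => by
      rw [← mul_assoc, ← pow_add]; exact hb _
    refine (this.mul_left _).congr_fun fun j => ?_
    rw [hF]; simp only
    rw [← mul_assoc _ _ ξ, ← pow_add, add_comm j k]
  refine ((h2.prod_fiberwise h3).div_const (euler p (-p))).congr_fun fun k => ?_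
  field_simp

/-- Equality of the two discrete `q`-Laplace sums. -/
lemma exists_hasSum_theta_euler {β γ : ℤ → ℂ} {z : ℂ} (hz : z ≠ 0) (hθ : qTheta p z ≠ 0)
    (hβ : ∀ m, HasSum (fun k : ℕ => ((p ^ k / qPoch p k : ℝ) : ℂ) * γ (m + k))
      (β m / euler p (-p)))
    (hγ : Summable fun m : ℤ => p ^ m * ‖γ m‖ / eulerR p ‖(p : ℂ) ^ m * z‖) :
    ∃ S, HasSum (fun m : ℤ => (p : ℂ) ^ m * β m / qTheta p ((p : ℂ) ^ m * z)) S ∧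
      HasSum (fun m : ℤ => (p : ℂ) ^ m * γ m / euler p ((p : ℂ) ^ m * z)) S := by
  have hp : (p : ℂ) ≠ 0 := by exact_mod_cast hp0.ne'
  have hE := euler_neg_p_ne_zero hp0 hp1
  have hEp := eulerR_neg_p_pos hp0 hp1
  have hrz := thetaRatio_pos hp0 hp1 hθ
  have hzm : ∀ m : ℤ, (p : ℂ) ^ m * z ≠ 0 := fun m => mul_ne_zero (zpow_ne_zero _ hp) hz
  have hθm : ∀ m : ℤ, qTheta p ((p : ℂ) ^ m * z) ≠ 0 := fun m h => by
    have := thetaRatio_zpow_mul hp0 hp1 hz m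
    rw [thetaRatio, h, norm_zero, zero_div] at this
    exact hrz.ne this
  -- For fixed m, the sum over k is the E-kernel term at p^m z. Along m = n + k the theta argument
  -- is pⁿ z for all k, and the sum over k rebuilds β n by `hβ`.
  set F : ℤ × ℕ → ℂ := fun x => (euler p (-p) * ((p : ℂ) ^ x.1 * γ x.1)) *
    ((qPoch p x.2 : ℂ) * qTheta p ((p : ℂ) ^ x.1 * z * ((p : ℂ) ^ x.2)⁻¹))⁻¹ with hF
  have hn : ∀ m, HasSum (fun k => ‖F (m, k)‖)
      ((thetaRatio p z)⁻¹ * (p ^ m * ‖γ m‖ / eulerR p ‖(p : ℂ) ^ m * z‖)) := by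
    intro m
    have h := (hasSum_norm_inv_qTheta hp0 hp1 (hzm m) (hθm m)).mul_left
      ‖euler p (-p) * ((p : ℂ) ^ m * γ m)‖
    rw [thetaRatio_zpow_mul hp0 hp1 hz] at h
    have h1 := eulerR_pos hp0 hp1 (norm_nonneg ((p : ℂ) ^ m * z))
    have e : (thetaRatio p z)⁻¹ * (p ^ m * ‖γ m‖ / eulerR p ‖(p : ℂ) ^ m * z‖) =
        ‖euler p (-p) * ((p : ℂ) ^ m * γ m)‖ *
          (thetaRatio p z * (eulerR p (-p) * eulerR p ‖(p : ℂ) ^ m * z‖))⁻¹ := by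
      rw [norm_mul (euler p (-p)), norm_euler_neg_p hp0 hp1, norm_mul _ (γ m), norm_zpow,
        Complex.norm_real, Real.norm_of_nonneg hp0.le]
      field_simp
    rw [e]
    exact h.congr_fun fun k => norm_mul _ _
  have hsum : Summable F := by
    refine Summable.of_norm ((summable_prod_of_nonneg fun x => norm_nonneg _).2
      ⟨fun m => (hn m).summable, ?_⟩)
    simp_rw [fun m => (hn m).tsum_eq]
    exact hγ.mul_left _
  refine ⟨∑' x, F x, ?_, hsum.hasSum.prod_fiberwise fun m => ?_⟩
  · let e : ℤ × ℕ ≃ ℤ × ℕ :=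
      { toFun := fun x => (x.1 + x.2, x.2)
        invFun := fun x => (x.1 - x.2, x.2)
        left_inv := fun x => by simp
        right_inv := fun x => by simp }
    have h2 := e.hasSum_iff.2 hsum.hasSum
    refine h2.prod_fiberwise fun n => ?_
    have h3 := (hβ n).mul_left ((euler p (-p) * (p : ℂ) ^ n) / qTheta p ((p : ℂ) ^ n * z))
    have e1 : (euler p (-p) * (p : ℂ) ^ n) / qTheta p ((p : ℂ) ^ n * z) * (β n / euler p (-p)) =
        (p : ℂ) ^ n * β n / qTheta p ((p : ℂ) ^ n * z) := by
      field_simp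
    rw [e1] at h3
    refine h3.congr_fun fun k => ?_
    change (euler p (-p) * ((p : ℂ) ^ (n + k : ℤ) * γ (n + k))) *
      ((qPoch p k : ℂ) * qTheta p ((p : ℂ) ^ (n + k : ℤ) * z * ((p : ℂ) ^ k)⁻¹))⁻¹ = _
    have e2 : (p : ℂ) ^ (n + k : ℤ) * z * ((p : ℂ) ^ k)⁻¹ = (p : ℂ) ^ n * z := by
      rw [zpow_add₀ hp, zpow_natCast]
      have : (p : ℂ) ^ k ≠ 0 := pow_ne_zero _ hp
      field_simp
    rw [e2, zpow_add₀ hp, zpow_natCast]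
    push_cast
    rw [mul_inv]
    ring
  · have h := (hasSum_inv_qTheta hp0 hp1 (hzm m) (hθm m)).mul_left
      (euler p (-p) * ((p : ℂ) ^ m * γ m))
    have e : (p : ℂ) ^ m * γ m / euler p ((p : ℂ) ^ m * z) =
        euler p (-p) * ((p : ℂ) ^ m * γ m) * (euler p (-p) * euler p ((p : ℂ) ^ m * z))⁻¹ := by
      rw [mul_inv, div_eq_mul_inv]
      field_simp
    rw [e]
    exact h

end

/-! ### The formal Borel transform B_q and its convergence. -/

lemma IsConvergentSeries.exists_bound {g : PowerSeries ℂ} (hg : IsConvergentSeries g) :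
    ∃ C r : ℝ, 0 < C ∧ 0 < r ∧ ∀ n, ‖PowerSeries.coeff n g‖ * r ^ n ≤ C := by
  obtain ⟨r, hr, h⟩ := hg
  refine ⟨(∑' n, ‖PowerSeries.coeff n g‖ * r ^ n) + 1, r, ?_, hr, fun n => ?_⟩
  · have : 0 ≤ ∑' n, ‖PowerSeries.coeff n g‖ * r ^ n := tsum_nonneg fun n => by positivity
    linarith
  · have := h.le_tsum n fun m _ => by positivity
    linarith

lemma exists_common_bound {ι : Type*} (s : Finset ι) (a : ι → PowerSeries ℂ)
    (h : ∀ i ∈ s, IsConvergentSeries (a i)) :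
    ∃ C r : ℝ, 0 < C ∧ 0 < r ∧ r ≤ 1 ∧
      ∀ i ∈ s, ∀ n, ‖PowerSeries.coeff n (a i)‖ * r ^ n ≤ C := by
  classical
  induction s using Finset.induction_on with
  | empty => exact ⟨1, 1, one_pos, one_pos, le_rfl, by simp⟩
  | insert i s hi ih =>
    obtain ⟨C, r, hC, hr, hr1, H⟩ := ih fun j hj => h j (Finset.mem_insert_of_mem hj)
    obtain ⟨C', r', hC', hr', H'⟩ := (h i (Finset.mem_insert_self i s)).exists_bound
    refine ⟨max C C', min r r', lt_max_of_lt_left hC, lt_min hr hr',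
      (min_le_left _ _).trans hr1, fun j hj n => ?_⟩
    have hm : 0 ≤ min r r' := (lt_min hr hr').le
    rcases Finset.mem_insert.1 hj with rfl | hj
    · refine le_trans ?_ ((H' n).trans (le_max_right _ _))
      gcongr; exact min_le_right _ _
    · refine le_trans ?_ ((H j hj n).trans (le_max_left _ _))
      gcongr; exact min_le_left _ _

lemma constantCoeff_xSigma (q : ℝ) (h : PowerSeries ℂ) :
    PowerSeries.constantCoeff (xSigma q h) = 0 := by simp [xSigma]

lemma coeff_borelTheta (q : ℝ) (f : PowerSeries ℂ) (n : ℕ) :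
    PowerSeries.coeff n (borelTheta q f) =
      PowerSeries.coeff (n + 1) f / (q : ℂ) ^ (n.choose 2) := by
  rw [borelTheta, PowerSeries.coeff_mk, Nat.choose_two_right]

lemma borelTheta_sum (q : ℝ) {ι : Type*} (s : Finset ι) (f : ι → PowerSeries ℂ) :
    borelTheta q (∑ i ∈ s, f i) = ∑ i ∈ s, borelTheta q (f i) := by
  ext n
  simp only [coeff_borelTheta, map_sum, Finset.sum_div]

/-- The constant term must vanish: B_q forgets it, whereas x σ_q would move it into degree 1, which
B_q sees. -/
lemma borelTheta_xSigma {q : ℝ} (hq : q ≠ 0) {h : PowerSeries ℂ}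
    (hh : PowerSeries.constantCoeff h = 0) :
    borelTheta q (xSigma q h) = PowerSeries.X * (PowerSeries.C (q : ℂ) * borelTheta q h) := by
  have hq' : (q : ℂ) ≠ 0 := by exact_mod_cast hq
  ext n
  cases n with
  | zero => simp [coeff_borelTheta, xSigma, hh]
  | succ n =>
    rw [PowerSeries.coeff_succ_X_mul, PowerSeries.coeff_C_mul, coeff_borelTheta, coeff_borelTheta,
      xSigma, PowerSeries.coeff_succ_X_mul, PowerSeries.coeff_rescale, choose_two_succ, pow_add,
      pow_succ]
    field_simp
    ring

/-- The series `(qX)ⁱ b`. -/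
def shiftIter (q : ℝ) (b : PowerSeries ℂ) (i : ℕ) : PowerSeries ℂ :=
  (fun h => PowerSeries.X * (PowerSeries.C (q : ℂ) * h))^[i] b

lemma shiftIter_succ (q : ℝ) (b : PowerSeries ℂ) (i : ℕ) :
    shiftIter q b (i + 1) = PowerSeries.X * (PowerSeries.C (q : ℂ) * shiftIter q b i) :=
  Function.iterate_succ_apply' _ _ _

lemma borelTheta_xSigma_iterate {q : ℝ} (hq : q ≠ 0) {h : PowerSeries ℂ}
    (hh : PowerSeries.constantCoeff h = 0) (i : ℕ) :
    PowerSeries.constantCoeff ((xSigma q)^[i] h) = 0 ∧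
      borelTheta q ((xSigma q)^[i] h) = shiftIter q (borelTheta q h) i := by
  induction i with
  | zero => exact ⟨hh, rfl⟩
  | succ i ih =>
    rw [Function.iterate_succ_apply', shiftIter_succ, borelTheta_xSigma hq ih.1, ih.2]
    exact ⟨constantCoeff_xSigma q _, rfl⟩

/-- Based on C(i+k,2) = C(i,2) + ik + C(k,2): the term x^i of a acts on the Borel transform as
p^C(i,2) ξ^i followed by the dilation ξ ↦ p^i ξ. -/
lemma coeff_borelTheta_mul {q : ℝ} (hq : q ≠ 0) (a : PowerSeries ℂ) {h : PowerSeries ℂ}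
    (hh : PowerSeries.constantCoeff h = 0) (N : ℕ) :
    PowerSeries.coeff N (borelTheta q (a * h)) =
      ∑ x ∈ Finset.HasAntidiagonal.antidiagonal N, PowerSeries.coeff x.1 a *
        ((q⁻¹ ^ (x.1.choose 2 + x.1 * x.2) : ℝ) : ℂ) * PowerSeries.coeff x.2 (borelTheta q h) := by
  have hq' : (q : ℂ) ≠ 0 := by exact_mod_cast hq
  rw [coeff_borelTheta, PowerSeries.coeff_mul, Finset.Nat.sum_antidiagonal_succ']
  simp only [PowerSeries.coeff_zero_eq_constantCoeff, hh, mul_zero, zero_add]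
  rw [Finset.sum_div]
  refine Finset.sum_congr rfl fun x hx => ?_
  rw [Finset.HasAntidiagonal.mem_antidiagonal] at hx
  have e : N.choose 2 = x.1.choose 2 + x.1 * x.2 + x.2.choose 2 := by
    rw [← hx]
    generalize x.1 = i
    generalize x.2 = k
    clear * -
    induction k with
    | zero => simp
    | succ k ih => rw [← add_assoc, choose_two_succ, ih, choose_two_succ]; ring
  rw [coeff_borelTheta, e, pow_add _ _ (x.2.choose 2)]
  push_cast
  rw [inv_pow]
  field_simp

lemma sum_norm_shiftIter_le {q r : ℝ} (hq : 0 ≤ q) (hr : 0 ≤ r) (hr1 : r ≤ 1)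
    (b : PowerSeries ℂ) (i N : ℕ) :
    ∑ l ∈ Finset.range (N + 1), r ^ l * ‖PowerSeries.coeff l (shiftIter q b (i + 1))‖ ≤
      q ^ (i + 1) * ∑ l ∈ Finset.range N, r ^ l * ‖PowerSeries.coeff l b‖ := by
  have key : ∀ i N, ∑ l ∈ Finset.range (N + 1),
      r ^ l * ‖PowerSeries.coeff l (shiftIter q b (i + 1))‖ ≤
      q * ∑ l ∈ Finset.range N, r ^ l * ‖PowerSeries.coeff l (shiftIter q b i)‖ := by
    intro i N
    rw [Finset.sum_range_succ', shiftIter_succ, Finset.mul_sum]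
    simp only [PowerSeries.coeff_succ_X_mul, PowerSeries.coeff_C_mul,
      PowerSeries.coeff_zero_X_mul, norm_zero, mul_zero, add_zero]
    refine Finset.sum_le_sum fun l _ => ?_
    rw [norm_mul, Complex.norm_real, Real.norm_of_nonneg hq, pow_succ]
    calc _ = r * (q * (r ^ l * ‖PowerSeries.coeff l (shiftIter q b i)‖)) := by ring
      _ ≤ _ := mul_le_of_le_one_left (by positivity) hr1
  have key2 : ∀ i N, ∑ l ∈ Finset.range N, r ^ l * ‖PowerSeries.coeff l (shiftIter q b i)‖ ≤
      q ^ i * ∑ l ∈ Finset.range N, r ^ l * ‖PowerSeries.coeff l b‖ := by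
    intro i
    induction i with
    | zero => intro N; simp [shiftIter]
    | succ i ih =>
      intro N
      cases N with
      | zero => simp
      | succ N =>
        refine (key i N).trans ?_
        rw [pow_succ', mul_assoc]
        refine mul_le_mul_of_nonneg_left ((ih N).trans ?_) hq
        refine mul_le_mul_of_nonneg_left ?_ (pow_nonneg hq i)
        exact Finset.sum_le_sum_of_subset_of_nonneg (by simp) fun _ _ _ => by positivity
  refine (key i N).trans ?_
  rw [pow_succ', mul_assoc]
  exact mul_le_mul_of_nonneg_left (key2 i N) hq

/-- Discrete Grönwall: 1 + ∑_{m<N} B m grows by a factor at most 1 + D at each step. -/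
lemma le_geometric_of_le_sum {B : ℕ → ℝ} {D : ℝ} (hD : 0 ≤ D)
    (h : ∀ N, B N ≤ D * (1 + ∑ m ∈ Finset.range N, B m)) (N : ℕ) : B N ≤ D * (1 + D) ^ N := by
  have key : ∀ N, 1 + ∑ m ∈ Finset.range N, B m ≤ (1 + D) ^ N := by
    intro N
    induction N with
    | zero => simp
    | succ N ih =>
      rw [Finset.sum_range_succ, pow_succ]
      have h1 := h N
      nlinarith
  exact (h N).trans (mul_le_mul_of_nonneg_left (key N) hD)

lemma sum_antidiagonal_shift_le {q r C : ℝ} (hq : 1 < q) (hr : 0 < r)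
    {a : PowerSeries ℂ} (ha : ∀ k, ‖PowerSeries.coeff k a‖ * r ^ k ≤ C) (h : PowerSeries ℂ)
    (N : ℕ) (S : Finset (ℕ × ℕ)) (hS : S ⊆ Finset.HasAntidiagonal.antidiagonal N) :
    ‖∑ x ∈ S, PowerSeries.coeff x.1 a *
        ((q⁻¹ ^ (x.1.choose 2 + x.1 * x.2) : ℝ) : ℂ) * PowerSeries.coeff x.2 h‖ * r ^ N ≤
      C * ∑ x ∈ S, r ^ x.2 * ‖PowerSeries.coeff x.2 h‖ := by
  have hp0 : 0 < q⁻¹ := inv_pos.2 (by linarith)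
  have hp1 := inv_lt_one_of_one_lt₀ hq
  refine (mul_le_mul_of_nonneg_right (norm_sum_le _ _) (by positivity)).trans ?_
  rw [Finset.sum_mul, Finset.mul_sum]
  refine Finset.sum_le_sum fun x hx => ?_
  have hx' := Finset.HasAntidiagonal.mem_antidiagonal.1 (hS hx)
  rw [norm_mul, norm_mul, Complex.norm_real, Real.norm_of_nonneg (by positivity), ← hx', pow_add]
  have h1 : q⁻¹ ^ (x.1.choose 2 + x.1 * x.2) ≤ 1 := pow_le_one₀ hp0.le hp1.le
  calc _ = (‖PowerSeries.coeff x.1 a‖ * r ^ x.1) * (r ^ x.2 * ‖PowerSeries.coeff x.2 h‖) *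
        q⁻¹ ^ (x.1.choose 2 + x.1 * x.2) := by ring
    _ ≤ (‖PowerSeries.coeff x.1 a‖ * r ^ x.1) * (r ^ x.2 * ‖PowerSeries.coeff x.2 h‖) :=
        mul_le_of_le_one_right (by positivity) h1
    _ ≤ _ := mul_le_mul_of_nonneg_right (ha _) (by positivity)

lemma sum_antidiagonal_snd (F : ℕ → ℝ) (N : ℕ) :
    ∑ x ∈ Finset.HasAntidiagonal.antidiagonal N, F x.2 = ∑ l ∈ Finset.range (N + 1), F l := by
  rw [← Finset.Nat.sum_antidiagonal_swap]
  exact Finset.Nat.sum_antidiagonal_eq_sum_range_succ (fun i _ => F i) N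

/-- The formal Borel transform of a generic `q`-Gevrey series converges. -/
lemma exists_norm_coeff_borelTheta_le {q : ℝ} (hq : 1 < q) {f : PowerSeries ℂ}
    (hf0 : PowerSeries.constantCoeff f = 0) {n : ℕ} {a : ℕ → PowerSeries ℂ} {g : PowerSeries ℂ}
    {C r : ℝ} (hC : 0 < C) (hr : 0 < r) (hr1 : r ≤ 1)
    (ha : ∀ j ∈ Finset.range (n + 1), ∀ k, ‖PowerSeries.coeff k (a j)‖ * r ^ k ≤ C)
    (hg : ∀ k, ‖PowerSeries.coeff k g‖ * r ^ k ≤ C)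
    (han : PowerSeries.constantCoeff (a n) ≠ 0)
    (hfg : ∑ j ∈ Finset.range (n + 1), a j * (xSigma q)^[n - j] f = g) :
    ∃ K s : ℝ, 0 < K ∧ 0 < s ∧ ∀ N, ‖PowerSeries.coeff N (borelTheta q f)‖ ≤ K * s ^ N := by
  have hq0 : 0 < q := by linarith
  set b := borelTheta q f with hb
  -- T j N is the N-th coefficient of B_q(a_j (xσ_q)^(n-j) f). The aim is to isolate a_n(0) b_N in
  -- the N-th coefficient of the equation.
  set T : ℕ → ℕ → ℂ := fun j N => ∑ x ∈ Finset.HasAntidiagonal.antidiagonal N,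
    PowerSeries.coeff x.1 (a j) * ((q⁻¹ ^ (x.1.choose 2 + x.1 * x.2) : ℝ) : ℂ) *
      PowerSeries.coeff x.2 (shiftIter q b (n - j)) with hT
  have hsum : ∀ N, ∑ j ∈ Finset.range n, T j N + T n N
      = PowerSeries.coeff N (borelTheta q g) := by
    intro N
    rw [← Finset.sum_range_succ, ← hfg, borelTheta_sum, map_sum]
    refine Finset.sum_congr rfl fun j _ => ?_
    have := borelTheta_xSigma_iterate hq0.ne' hf0 (n - j)
    rw [coeff_borelTheta_mul hq0.ne' (a j) this.1, this.2]
  set B : ℕ → ℝ := fun N => r ^ N * ‖PowerSeries.coeff N b‖ with hB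
  set α : ℝ := ‖PowerSeries.constantCoeff (a n)‖ with hα
  have hα0 : 0 < α := norm_pos_iff.2 han
  have hG : ∀ N, ‖PowerSeries.coeff N (borelTheta q g)‖ * r ^ N ≤ C / r := by
    intro N
    rw [coeff_borelTheta, norm_div, le_div_iff₀ hr, mul_assoc, ← pow_succ]
    refine le_trans ?_ (hg (N + 1))
    refine mul_le_mul_of_nonneg_right (div_le_self (norm_nonneg _) ?_) (by positivity)
    rw [norm_pow, Complex.norm_real, Real.norm_of_nonneg hq0.le]
    exact one_le_pow₀ hq.le
  -- For j < n the shift by X^(n-j) is nontrivial, so only b_m with m < N occur.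
  have hTj : ∀ N, ∀ j ∈ Finset.range n, ‖T j N‖ * r ^ N ≤
      C * q ^ n * ∑ m ∈ Finset.range N, B m := by
    intro N j hj
    have hjn := Finset.mem_range.1 hj
    have h1 := sum_antidiagonal_shift_le hq hr
      (ha j (Finset.mem_range.2 (by omega))) (shiftIter q b (n - j)) N _ subset_rfl
    refine h1.trans ?_
    rw [sum_antidiagonal_snd (fun l => r ^ l * ‖PowerSeries.coeff l (shiftIter q b (n - j))‖),
      mul_assoc]
    refine mul_le_mul_of_nonneg_left ?_ hC.le
    obtain ⟨i, hi⟩ : ∃ i, n - j = i + 1 := ⟨n - j - 1, by omega⟩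
    rw [hi]
    refine (sum_norm_shiftIter_le hq0.le hr.le hr1 b i N).trans ?_
    refine mul_le_mul_of_nonneg_right (pow_le_pow_right₀ hq.le (by omega)) ?_
    exact Finset.sum_nonneg fun _ _ => by positivity
  -- For j = n there is no shift. The pair (0, N) contributes a_n(0) b_N, and all other pairs
  -- involve earlier coefficients.
  have hTn : ∀ N, ‖T n N - PowerSeries.constantCoeff (a n) * PowerSeries.coeff N b‖ * r ^ N ≤
      C * ∑ m ∈ Finset.range N, B m := by
    intro N
    have hmem : ((0, N) : ℕ × ℕ) ∈ Finset.HasAntidiagonal.antidiagonal N := by simp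
    have e0 := Finset.add_sum_erase _ (fun x : ℕ × ℕ => PowerSeries.coeff x.1 (a n) *
      ((q⁻¹ ^ (x.1.choose 2 + x.1 * x.2) : ℝ) : ℂ) * PowerSeries.coeff x.2 b) hmem
    have e1 : T n N - PowerSeries.constantCoeff (a n) * PowerSeries.coeff N b =
        ∑ x ∈ (Finset.HasAntidiagonal.antidiagonal N).erase (0, N), PowerSeries.coeff x.1 (a n) *
          ((q⁻¹ ^ (x.1.choose 2 + x.1 * x.2) : ℝ) : ℂ) * PowerSeries.coeff x.2 b := by
      rw [hT]
      simp only [Nat.sub_self]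
      rw [show shiftIter q b 0 = b from rfl, ← e0]
      simp
    have e2 := Finset.add_sum_erase _ (fun x : ℕ × ℕ => r ^ x.2 * ‖PowerSeries.coeff x.2 b‖) hmem
    rw [sum_antidiagonal_snd (fun l => r ^ l * ‖PowerSeries.coeff l b‖), Finset.sum_range_succ,
      add_comm] at e2
    rw [e1]
    refine (sum_antidiagonal_shift_le hq hr (ha n (by simp)) b N _
      (Finset.erase_subset _ _)).trans (le_of_eq ?_)
    rw [add_right_cancel e2]
  set D : ℝ := (C / r + (n * (C * q ^ n) + C)) / α with hD
  have hD0 : 0 ≤ D := by positivity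
  have hBN : ∀ N, B N ≤ D * (1 + ∑ m ∈ Finset.range N, B m) := by
    intro N
    have hS : 0 ≤ ∑ m ∈ Finset.range N, B m := Finset.sum_nonneg fun _ _ => by positivity
    have e : PowerSeries.constantCoeff (a n) * PowerSeries.coeff N b =
        PowerSeries.coeff N (borelTheta q g) - ∑ j ∈ Finset.range n, T j N -
          (T n N - PowerSeries.constantCoeff (a n) * PowerSeries.coeff N b) := by
      rw [← hsum N]; ring
    have h1 : α * B N ≤ C / r + n * (C * q ^ n * ∑ m ∈ Finset.range N, B m) +
        C * ∑ m ∈ Finset.range N, B m := by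
      calc α * B N = ‖PowerSeries.constantCoeff (a n) * PowerSeries.coeff N b‖ * r ^ N := by
            rw [norm_mul, hB]; ring
        _ ≤ (‖PowerSeries.coeff N (borelTheta q g)‖ + ∑ j ∈ Finset.range n, ‖T j N‖ +
            ‖T n N - PowerSeries.constantCoeff (a n) * PowerSeries.coeff N b‖) * r ^ N := by
            rw [e]
            refine mul_le_mul_of_nonneg_right ((norm_sub_le _ _).trans ?_) (by positivity)
            rw [← e]
            gcongr
            exact (norm_sub_le _ _).trans (by gcongr; exact norm_sum_le _ _)
        _ ≤ _ := by
            rw [add_mul, add_mul, Finset.sum_mul]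
            refine add_le_add (add_le_add (hG N) ?_) (hTn N)
            refine (Finset.sum_le_sum (hTj N)).trans (le_of_eq ?_)
            rw [Finset.sum_const, Finset.card_range, nsmul_eq_mul]
    rw [hD, div_mul_eq_mul_div, le_div_iff₀ hα0, mul_comm]
    refine h1.trans ?_
    have hCr : 0 ≤ C / r := by positivity
    have hCq : 0 ≤ n * (C * q ^ n) + C := by positivity
    nlinarith
  refine ⟨D + 1, (1 + D) / r, by positivity, by positivity, fun N => ?_⟩
  have := le_geometric_of_le_sum hD0 hBN N
  rw [hB] at this
  simp only at this
  rw [div_pow, mul_div_assoc', le_div_iff₀ (by positivity), mul_comm]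
  refine this.trans ?_
  gcongr
  linarith

/-! ### The q-difference equation satisfied by the Borel transform. -/

/-- A functional equation `P(ξ) φ(ξ) + ∑_{k ≥ 1} Q_k(ξ) φ(p^k ξ) = G(ξ)` near `0`, with entire
coefficients, for the sum `φ` of the power series `g`. -/
structure BorelEquation (p : ℝ) (g : PowerSeries ℂ) where
  P : Polynomial ℂ
  Q : ℕ → ℂ → ℂ
  G : ℂ → ℂ
  φ : ℂ → ℂ
  C : ℝ
  s : ℝ
  ρ : ℝ
  C_pos : 0 < C
  s_pos : 0 < s
  ρ_pos : 0 < ρ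
  eval_ne_zero : ∀ ξ ∈ Metric.ball (0 : ℂ) ρ, P.eval ξ ≠ 0
  differentiable_Q : ∀ k, Differentiable ℂ (Q k)
  norm_Q_le : ∀ k ξ, ‖Q k ξ‖ ≤
    C * ((s * ‖ξ‖) ^ k * p ^ (k.choose 2) * (1 + ‖ξ‖) ^ P.natDegree)
  differentiable_G : Differentiable ℂ G
  norm_G_le : ∀ ξ, ‖G ξ‖ ≤ C * eulerR p (s * ‖ξ‖)
  hasSum_φ : ∀ ξ ∈ Metric.ball (0 : ℂ) ρ, HasSum (fun k => PowerSeries.coeff k g * ξ ^ k) (φ ξ)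
  differentiableOn_φ : DifferentiableOn ℂ φ (Metric.ball 0 ρ)
  norm_φ_le : ∀ ξ ∈ Metric.ball (0 : ℂ) ρ, ‖φ ξ‖ ≤ C
  hasSum_Q_mul : ∀ ξ ∈ Metric.ball (0 : ℂ) ρ,
    HasSum (fun k => Q (k + 1) ξ * φ ((p : ℂ) ^ (k + 1) * ξ)) (G ξ - P.eval ξ * φ ξ)

lemma hasSum_shiftIter (q : ℝ) {b : PowerSeries ℂ} {η w : ℂ}
    (h : HasSum (fun l => PowerSeries.coeff l b * η ^ l) w) (i : ℕ) :
    HasSum (fun l => PowerSeries.coeff l (shiftIter q b i) * η ^ l) ((q * η) ^ i * w) := by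
  induction i with
  | zero => simpa [shiftIter] using h
  | succ i ih =>
    refine (hasSum_nat_add_iff' 1).1 ?_
    have e : (q * η) ^ (i + 1) * w - ∑ l ∈ Finset.range 1,
        PowerSeries.coeff l (shiftIter q b (i + 1)) * η ^ l = (q * η) * ((q * η) ^ i * w) := by
      simp [shiftIter_succ]; ring
    rw [e]
    refine (ih.mul_left (q * η)).congr_fun fun l => ?_
    rw [shiftIter_succ, PowerSeries.coeff_succ_X_mul, PowerSeries.coeff_C_mul]
    ring

section
variable {p : ℝ} (hp0 : 0 < p) (hp1 : p < 1)
include hp0 hp1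

/-- Although a has only a finite radius of convergence, the factors p^(k(k-1)/2) make the sum over k
converge for every ξ, so the double series may be rearranged. -/
lemma exists_hasSum_borel_mul {a h : PowerSeries ℂ} {C r : ℝ} (hr : 0 < r)
    (ha : ∀ k, ‖PowerSeries.coeff k a‖ * r ^ k ≤ C) {H : ℂ → ℂ} {ξ : ℂ}
    (hH : ∀ k : ℕ, HasSum (fun l => PowerSeries.coeff l h * ((p : ℂ) ^ k * ξ) ^ l)
      (H ((p : ℂ) ^ k * ξ))) :
    ∃ S, HasSum (fun N => (∑ x ∈ Finset.HasAntidiagonal.antidiagonal N, PowerSeries.coeff x.1 a *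
        ((p ^ (x.1.choose 2 + x.1 * x.2) : ℝ) : ℂ) * PowerSeries.coeff x.2 h) * ξ ^ N) S ∧
      HasSum (fun k : ℕ => PowerSeries.coeff k a * (p : ℂ) ^ (k.choose 2) * ξ ^ k *
        H ((p : ℂ) ^ k * ξ)) S := by
  have hC : 0 ≤ C := (mul_nonneg (norm_nonneg _) (pow_nonneg hr.le 0)).trans (ha 0)
  set F : ℕ × ℕ → ℂ := fun x => (PowerSeries.coeff x.1 a * (p : ℂ) ^ (x.1.choose 2) * ξ ^ x.1) *
    (PowerSeries.coeff x.2 h * ((p : ℂ) ^ x.1 * ξ) ^ x.2) with hF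
  have hs2 : Summable fun l => ‖PowerSeries.coeff l h * ξ ^ l‖ := by
    have := (hH 0).summable.norm
    simpa using this
  have hb : ∀ k, ‖PowerSeries.coeff k a * (p : ℂ) ^ (k.choose 2) * ξ ^ k‖ ≤
      C * (eulerCoeff p k * (‖ξ‖ / r) ^ k) := by
    intro k
    have h1 : p ^ (k.choose 2) ≤ eulerCoeff p k :=
      le_div_self (pow_pos hp0 _).le (qPoch_pos hp0 hp1 k) (qPoch_le_one hp0 hp1 k)
    rw [norm_mul, norm_mul, norm_pow, norm_pow, Complex.norm_real, Real.norm_of_nonneg hp0.le,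
      div_pow]
    calc _ = (‖PowerSeries.coeff k a‖ * r ^ k) * (p ^ (k.choose 2) * (‖ξ‖ ^ k / r ^ k)) := by
          field_simp
      _ ≤ C * (eulerCoeff p k * (‖ξ‖ ^ k / r ^ k)) := by
          gcongr
          exact ha k
  have hs1 : Summable fun k => C * (eulerCoeff p k * (‖ξ‖ / r) ^ k) :=
    (summable_eulerCoeff_mul_pow hp0 hp1 _).mul_left C
  have hsum : Summable F := by
    have h1 : Summable fun x : ℕ × ℕ => (C * (eulerCoeff p x.1 * (‖ξ‖ / r) ^ x.1)) *
        ‖PowerSeries.coeff x.2 h * ξ ^ x.2‖ :=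
      Summable.mul_of_nonneg (f := fun k => C * (eulerCoeff p k * (‖ξ‖ / r) ^ k))
        (g := fun l => ‖PowerSeries.coeff l h * ξ ^ l‖) hs1 hs2
        (fun k => (norm_nonneg _).trans (hb k)) fun l => norm_nonneg _
    refine Summable.of_norm_bounded h1 fun x => ?_
    rw [hF, norm_mul]
    refine mul_le_mul (hb _) ?_ (norm_nonneg _) ((norm_nonneg _).trans (hb _))
    rw [norm_mul, norm_mul, norm_pow, norm_pow, norm_mul]
    refine mul_le_mul_of_nonneg_left (pow_le_pow_left₀ (by positivity) ?_ _) (norm_nonneg _)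
    refine mul_le_of_le_one_left (norm_nonneg _) ?_
    rw [norm_pow, Complex.norm_real, Real.norm_of_nonneg hp0.le]
    exact pow_le_one₀ hp0.le hp1.le
  have h1 := hsum.hasSum.antidiagonal
  have h2 : ∀ k, HasSum (fun l => F (k, l)) (PowerSeries.coeff k a * (p : ℂ) ^ (k.choose 2) *
      ξ ^ k * H ((p : ℂ) ^ k * ξ)) := by
    intro k
    rw [hF]
    exact (hH k).mul_left (PowerSeries.coeff k a * (p : ℂ) ^ (k.choose 2) * ξ ^ k)
  refine ⟨∑' x, F x, h1.congr_fun fun N => ?_, hsum.hasSum.prod_fiberwise h2⟩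
  rw [Finset.sum_mul]
  refine Finset.sum_congr rfl fun x hx => ?_
  rw [← Finset.HasAntidiagonal.mem_antidiagonal.1 hx]
  change _ = (PowerSeries.coeff x.1 a * (p : ℂ) ^ (x.1.choose 2) * ξ ^ x.1) *
    (PowerSeries.coeff x.2 h * ((p : ℂ) ^ x.1 * ξ) ^ x.2)
  rw [Complex.ofReal_pow]
  ring

lemma entire_of_norm_coeff_le {c : ℕ → ℂ} {K s : ℝ} (hK : 0 ≤ K) (hs : 0 ≤ s)
    (hc : ∀ N, ‖c N‖ ≤ K * (eulerCoeff p N * s ^ N)) :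
    (∀ ξ, HasSum (fun N => c N * ξ ^ N) (∑' N, c N * ξ ^ N)) ∧
    Differentiable ℂ (fun ξ : ℂ => ∑' N, c N * ξ ^ N) ∧
    ∀ ξ : ℂ, ‖∑' N, c N * ξ ^ N‖ ≤ K * eulerR p (s * ‖ξ‖) := by
  have hb : ∀ (ξ : ℂ) (t : ℝ), ‖ξ‖ ≤ t → ∀ N,
      ‖c N * ξ ^ N‖ ≤ K * (eulerCoeff p N * (s * t) ^ N) := by
    intro ξ t ht N
    have := eulerCoeff_pos hp0 hp1 N
    rw [norm_mul, norm_pow, mul_pow]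
    calc _ ≤ (K * (eulerCoeff p N * s ^ N)) * t ^ N := by
          gcongr; exact hc N
      _ = _ := by ring
  have hs' : ∀ t : ℝ, HasSum (fun N => K * (eulerCoeff p N * (s * t) ^ N))
      (K * eulerR p (s * t)) := fun t => (hasSum_eulerR hp0 hp1 _).mul_left K
  refine ⟨fun ξ => (Summable.of_norm_bounded (hs' ‖ξ‖).summable (hb ξ _ le_rfl)).hasSum,
    fun ξ => ?_, fun ξ => tsum_of_norm_bounded (hs' ‖ξ‖) (hb ξ _ le_rfl)⟩
  have h : DifferentiableOn ℂ (fun ξ : ℂ => ∑' N, c N * ξ ^ N) (Metric.ball 0 (‖ξ‖ + 1)) :=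
    differentiableOn_tsum_of_summable_norm (hs' (‖ξ‖ + 1)).summable (fun n => by fun_prop)
      Metric.isOpen_ball fun N w hw => hb w _ (mem_ball_zero_iff.1 hw).le N
  exact h.differentiableAt (Metric.isOpen_ball.mem_nhds (by simp))

omit hp0 hp1 in
lemma germ_of_norm_coeff_le {c : ℕ → ℂ} {K s : ℝ} (hs : 0 < s)
    (hc : ∀ N, ‖c N‖ ≤ K * s ^ N) :
    (∀ ξ ∈ Metric.ball (0 : ℂ) (2 * s)⁻¹, HasSum (fun N => c N * ξ ^ N) (∑' N, c N * ξ ^ N)) ∧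
    DifferentiableOn ℂ (fun ξ : ℂ => ∑' N, c N * ξ ^ N) (Metric.ball 0 (2 * s)⁻¹) ∧
    ∀ ξ ∈ Metric.ball (0 : ℂ) (2 * s)⁻¹, ‖∑' N, c N * ξ ^ N‖ ≤ K * 2 := by
  have hb : ∀ N, ∀ ξ ∈ Metric.ball (0 : ℂ) (2 * s)⁻¹, ‖c N * ξ ^ N‖ ≤ K * (1 / 2) ^ N := by
    intro N ξ hξ
    have hK : 0 ≤ K * s ^ N := (norm_nonneg _).trans (hc N)
    rw [norm_mul, norm_pow]
    calc _ ≤ (K * s ^ N) * ((2 * s)⁻¹) ^ N := by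
          gcongr
          exacts [hc N, (mem_ball_zero_iff.1 hξ).le]
      _ = _ := by rw [one_div, inv_pow, inv_pow, mul_pow]; field_simp
  have hs' : HasSum (fun N : ℕ => K * (1 / 2 : ℝ) ^ N) (K * 2) := hasSum_geometric_two.mul_left K
  exact ⟨fun ξ hξ => (Summable.of_norm_bounded hs'.summable fun N => hb N ξ hξ).hasSum,
    differentiableOn_tsum_of_summable_norm hs'.summable (fun n => by fun_prop)
      Metric.isOpen_ball hb, fun ξ hξ => tsum_of_norm_bounded hs' fun N => hb N ξ hξ⟩

end

theorem IsGenericQGevrey.borelEquation {q : ℝ} (hq : 1 < q) {f : PowerSeries ℂ}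
    (hf0 : PowerSeries.constantCoeff f = 0) (hf : IsGenericQGevrey q f) :
    Nonempty (BorelEquation q⁻¹ (borelTheta q f)) := by
  have hq0 : 0 < q := by linarith
  have hqc : (q : ℂ) ≠ 0 := by exact_mod_cast hq0.ne'
  have hp0 : 0 < q⁻¹ := inv_pos.2 hq0
  have hp1 := inv_lt_one_of_one_lt₀ hq
  obtain ⟨n, a, haconv, ha0, han, hgconv⟩ := hf
  set g := ∑ j ∈ Finset.range (n + 1), a j * (xSigma q)^[n - j] f with hg
  -- The right-hand side g takes the slot n + 1, so that one pair (C₁, r) serves all the series.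
  obtain ⟨C₁, r, hC₁, hr, hr1, hbd⟩ := exists_common_bound (Finset.range (n + 2))
    (fun j => if j = n + 1 then g else a j) fun j hj => by
      split_ifs with h
      · exact hgconv
      · exact haconv j (by have := Finset.mem_range.1 hj; omega)
  have ha : ∀ j ∈ Finset.range (n + 1), ∀ k, ‖PowerSeries.coeff k (a j)‖ * r ^ k ≤ C₁ := by
    intro j hj k
    have hj' := Finset.mem_range.1 hj
    have := hbd j (Finset.mem_range.2 (by omega)) k
    rwa [if_neg (by omega)] at this
  have hgb : ∀ k, ‖PowerSeries.coeff k g‖ * r ^ k ≤ C₁ := by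
    intro k
    have := hbd (n + 1) (by simp) k
    rwa [if_pos rfl] at this
  obtain ⟨K, s, hK, hs, hb⟩ := exists_norm_coeff_borelTheta_le hq hf0 hC₁ hr hr1 ha hgb han rfl
  set b := borelTheta q f with hbdef
  obtain ⟨φsum, φdiff, φbd⟩ := germ_of_norm_coeff_le hs hb
  set φ : ℂ → ℂ := fun ξ => ∑' N, PowerSeries.coeff N b * ξ ^ N with hφ
  have hGc : ∀ N, ‖PowerSeries.coeff N (borelTheta q g)‖ ≤
      C₁ / r * (eulerCoeff q⁻¹ N * r⁻¹ ^ N) := by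
    intro N
    have h1 : q⁻¹ ^ (N.choose 2) ≤ eulerCoeff q⁻¹ N :=
      le_div_self (pow_pos hp0 _).le (qPoch_pos hp0 hp1 N) (qPoch_le_one hp0 hp1 N)
    have h2 : ‖PowerSeries.coeff (N + 1) g‖ ≤ C₁ / r * r⁻¹ ^ N := by
      rw [inv_pow, ← div_eq_mul_inv, div_div, ← pow_succ', le_div_iff₀ (by positivity)]
      exact hgb (N + 1)
    rw [coeff_borelTheta, norm_div, norm_pow, Complex.norm_real, Real.norm_of_nonneg hq0.le,
      div_eq_mul_inv, ← inv_pow]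
    calc _ ≤ (C₁ / r * r⁻¹ ^ N) * eulerCoeff q⁻¹ N := by gcongr
      _ = _ := by ring
  obtain ⟨Gsum, Gdiff, Gbd⟩ := entire_of_norm_coeff_le hp0 hp1 (by positivity) (by positivity) hGc
  set G : ℂ → ℂ := fun ξ => ∑' N, PowerSeries.coeff N (borelTheta q g) * ξ ^ N with hG
  set Q : ℕ → ℂ → ℂ := fun k ξ => ∑ j ∈ Finset.range (n + 1), PowerSeries.coeff k (a j) *
    ((q⁻¹ : ℝ) : ℂ) ^ (k.choose 2) * ξ ^ k * (q * (((q⁻¹ : ℝ) : ℂ) ^ k * ξ)) ^ (n - j) with hQ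
  set P : Polynomial ℂ := ∑ j ∈ Finset.range (n + 1),
    Polynomial.C (PowerSeries.constantCoeff (a j) * (q : ℂ) ^ (n - j)) * Polynomial.X ^ (n - j)
    with hP
  have hPeval : ∀ ξ, P.eval ξ = Q 0 ξ := by
    intro ξ
    rw [hP, hQ, Polynomial.eval_finsetSum]
    refine Finset.sum_congr rfl fun j _ => ?_
    simp only [Polynomial.eval_mul, Polynomial.eval_C, Polynomial.eval_pow, Polynomial.eval_X,
      PowerSeries.coeff_zero_eq_constantCoeff]
    simp [mul_pow]
    ring
  -- Here a₀(0) ≠ 0 enters: P has the full degree n, so that it can compensate the factor (1 +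
  -- ‖ξ‖)^n in the bound on Q_k.
  have hPdeg : P.natDegree = n := by
    refine Polynomial.natDegree_eq_of_le_of_coeff_ne_zero ?_ (n := n) ?_
    · refine Polynomial.natDegree_sum_le_of_forall_le _ _ fun j _ => ?_
      exact (Polynomial.natDegree_C_mul_X_pow_le _ _).trans (Nat.sub_le _ _)
    · rw [hP, Polynomial.finsetSum_coeff, Finset.sum_eq_single 0]
      · rw [Polynomial.coeff_C_mul_X_pow]; simp [ha0, hqc]
      · intro j hj hj0
        rw [Polynomial.coeff_C_mul_X_pow, if_neg]
        have := Finset.mem_range.1 hj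
        omega
      · simp
  -- Here a_n(0) ≠ 0 enters: near 0 the equation can be solved for φ(ξ).
  have hP0 : P.eval 0 ≠ 0 := by
    rw [hPeval, hQ]
    simp only
    rw [Finset.sum_eq_single n]
    · simpa using han
    · intro j hj hj0
      have := Finset.mem_range.1 hj
      simp [show n - j ≠ 0 by omega]
    · simp
  obtain ⟨ρ₀, hρ₀, hPρ⟩ : ∃ ρ₀ > 0, ∀ ξ ∈ Metric.ball (0 : ℂ) ρ₀, P.eval ξ ≠ 0 := by
    have := P.continuous.continuousAt (x := 0) |>.eventually_ne hP0
    obtain ⟨ε, hε, h⟩ := Metric.eventually_nhds_iff_ball.1 this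
    exact ⟨ε, hε, h⟩
  set C₂ : ℝ := (n + 1) * (C₁ * q ^ n) with hC₂
  have hρle : ∀ {ξ : ℂ}, ξ ∈ Metric.ball (0 : ℂ) (min ρ₀ (2 * s)⁻¹) →
      ξ ∈ Metric.ball (0 : ℂ) (2 * s)⁻¹ := fun h =>
    Metric.ball_subset_ball (min_le_right _ _) h
  refine ⟨⟨P, Q, G, φ, C₁ / r + C₂ + K * 2, r⁻¹, min ρ₀ (2 * s)⁻¹, by positivity, by positivity,
    lt_min hρ₀ (by positivity), fun ξ hξ => hPρ ξ (Metric.ball_subset_ball (min_le_left _ _) hξ),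
    fun k => ?_, fun k ξ => ?_, Gdiff, fun ξ => ?_, fun ξ hξ => φsum ξ (hρle hξ),
    φdiff.mono fun ξ hξ => hρle hξ, fun ξ hξ => ?_, fun ξ hξ => ?_⟩⟩
  · rw [hQ]; fun_prop
  · rw [hPdeg]
    have h1 : ‖Q k ξ‖ ≤ C₂ * ((r⁻¹ * ‖ξ‖) ^ k * q⁻¹ ^ (k.choose 2) * (1 + ‖ξ‖) ^ n) := by
      rw [hQ]
      refine (norm_sum_le _ _).trans ?_
      have : ∀ j ∈ Finset.range (n + 1), ‖PowerSeries.coeff k (a j) *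
          ((q⁻¹ : ℝ) : ℂ) ^ (k.choose 2) * ξ ^ k * (q * (((q⁻¹ : ℝ) : ℂ) ^ k * ξ)) ^ (n - j)‖ ≤
          (C₁ * q ^ n) * ((r⁻¹ * ‖ξ‖) ^ k * q⁻¹ ^ (k.choose 2) * (1 + ‖ξ‖) ^ n) := by
        intro j hj
        have e1 : ‖PowerSeries.coeff k (a j)‖ ≤ C₁ * r⁻¹ ^ k := by
          rw [inv_pow, ← div_eq_mul_inv, le_div_iff₀ (by positivity)]
          exact ha j hj k
        have e2 : ‖((q : ℂ) * (((q⁻¹ : ℝ) : ℂ) ^ k * ξ)) ^ (n - j)‖ ≤ q ^ n * (1 + ‖ξ‖) ^ n := by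
          rw [norm_pow, norm_mul, norm_mul, norm_pow, Complex.norm_real, Complex.norm_real,
            Real.norm_of_nonneg hq0.le, Real.norm_of_nonneg hp0.le, ← mul_pow]
          have e3 : q * (q⁻¹ ^ k * ‖ξ‖) ≤ q * (1 + ‖ξ‖) := by
            gcongr
            have : q⁻¹ ^ k * ‖ξ‖ ≤ ‖ξ‖ :=
              mul_le_of_le_one_left (norm_nonneg _) (pow_le_one₀ hp0.le hp1.le)
            linarith
          refine (pow_le_pow_left₀ (by positivity) e3 _).trans ?_
          exact pow_le_pow_right₀ (one_le_mul_of_one_le_of_one_le hq.le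
            (by linarith [norm_nonneg ξ])) (Nat.sub_le _ _)
        rw [norm_mul, norm_mul, norm_mul, norm_pow, norm_pow, Complex.norm_real,
          Real.norm_of_nonneg hp0.le]
        calc _ ≤ (C₁ * r⁻¹ ^ k) * q⁻¹ ^ (k.choose 2) * ‖ξ‖ ^ k * (q ^ n * (1 + ‖ξ‖) ^ n) := by
              gcongr
          _ = _ := by rw [mul_pow]; ring
      refine (Finset.sum_le_sum this).trans (le_of_eq ?_)
      rw [Finset.sum_const, Finset.card_range, nsmul_eq_mul, hC₂]
      push_cast
      ring
    refine h1.trans (mul_le_mul_of_nonneg_right ?_ (by positivity))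
    have : 0 ≤ C₁ / r := by positivity
    linarith
  · refine (Gbd ξ).trans (mul_le_mul_of_nonneg_right ?_
      (eulerR_pos hp0 hp1 (by positivity)).le)
    have : 0 ≤ C₂ := by positivity
    linarith
  · refine (φbd ξ (hρle hξ)).trans ?_
    have : 0 ≤ C₁ / r + C₂ := by positivity
    linarith
  · have hmem : ∀ k : ℕ, ((q⁻¹ : ℝ) : ℂ) ^ k * ξ ∈ Metric.ball (0 : ℂ) (2 * s)⁻¹ := by
      intro k
      rw [mem_ball_zero_iff, norm_mul, norm_pow, Complex.norm_real, Real.norm_of_nonneg hp0.le]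
      exact (mul_le_of_le_one_left (norm_nonneg _) (pow_le_one₀ hp0.le hp1.le)).trans_lt
        (mem_ball_zero_iff.1 (hρle hξ))
    have hS : ∀ j ∈ Finset.range (n + 1), ∃ S,
        HasSum (fun N =>
          PowerSeries.coeff N (borelTheta q (a j * (xSigma q)^[n - j] f)) * ξ ^ N) S ∧
        HasSum (fun k : ℕ => PowerSeries.coeff k (a j) * ((q⁻¹ : ℝ) : ℂ) ^ (k.choose 2) * ξ ^ k *
          ((q * (((q⁻¹ : ℝ) : ℂ) ^ k * ξ)) ^ (n - j) * φ (((q⁻¹ : ℝ) : ℂ) ^ k * ξ))) S := by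
      intro j hj
      have h1 := borelTheta_xSigma_iterate hq0.ne' hf0 (n - j)
      obtain ⟨S, hS1, hS2⟩ := exists_hasSum_borel_mul hp0 hp1 hr (ha j hj)
        (h := shiftIter q b (n - j)) (H := fun η => (q * η) ^ (n - j) * φ η) (ξ := ξ)
        fun k => hasSum_shiftIter q (φsum _ (hmem k)) (n - j)
      refine ⟨S, hS1.congr_fun fun N => ?_, hS2⟩
      rw [coeff_borelTheta_mul hq0.ne' (a j) h1.1, h1.2]
    choose! S hS1 hS2 using hS
    have e1 := hasSum_sum hS1
    have e2 := hasSum_sum hS2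
    have e3 : ∑ j ∈ Finset.range (n + 1), S j = G ξ := by
      refine e1.unique ((Gsum ξ).congr_fun fun N => ?_)
      rw [hg, borelTheta_sum, map_sum, Finset.sum_mul]
    have e4 : HasSum (fun k => Q k ξ * φ (((q⁻¹ : ℝ) : ℂ) ^ k * ξ)) (G ξ) := by
      rw [← e3]
      refine e2.congr_fun fun k => ?_
      rw [hQ, Finset.sum_mul]
      refine Finset.sum_congr rfl fun j _ => ?_
      ring
    have e5 := (hasSum_nat_add_iff' 1).2 e4
    simpa [hPeval] using e5

/-! ### Analytic continuation by the functional equation, with growth. -/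

namespace BorelEquation

variable {p : ℝ} {g : PowerSeries ℂ} (E : BorelEquation p g)

/-- One step of the analytic continuation by the functional equation. -/
def step (u : ℂ → ℂ) (ξ : ℂ) : ℂ :=
  (E.G ξ - ∑' k : ℕ, E.Q (k + 1) ξ * u ((p : ℂ) ^ (k + 1) * ξ)) / E.P.eval ξ

/-- The continuation of the germ to `|ξ| < ρ p⁻ᴺ`. -/
def approx (N : ℕ) : ℂ → ℂ := E.step^[N] E.φ

lemma approx_succ (N : ℕ) : E.approx (N + 1) = E.step (E.approx N) :=
  Function.iterate_succ_apply' _ _ _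

section
variable (hp0 : 0 < p) (hp1 : p < 1)
include hp0 hp1

omit hp1 in
lemma norm_pow_mul (k : ℕ) (ξ : ℂ) : ‖(p : ℂ) ^ k * ξ‖ = p ^ k * ‖ξ‖ := by
  rw [norm_mul, norm_pow, Complex.norm_real, Real.norm_of_nonneg hp0.le]

/-- A step at ξ uses only the values at p^(k+1) ξ, and φ already solves the equation on the initial
disc. Hence a further step changes nothing where p^N‖ξ‖ < ρ. -/
lemma approx_succ_eq (N : ℕ) {ξ : ℂ} (hξ : p ^ N * ‖ξ‖ < E.ρ) :
    E.approx (N + 1) ξ = E.approx N ξ := by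
  induction N generalizing ξ with
  | zero =>
    have hξ' : ξ ∈ Metric.ball (0 : ℂ) E.ρ := by simpa using hξ
    rw [approx_succ, step]
    change (E.G ξ - ∑' k : ℕ, E.Q (k + 1) ξ * E.φ ((p : ℂ) ^ (k + 1) * ξ)) / _ = E.φ ξ
    rw [(E.hasSum_Q_mul ξ hξ').tsum_eq, sub_sub_cancel,
      mul_div_cancel_left₀ _ (E.eval_ne_zero ξ hξ')]
  | succ N ih =>
    rw [approx_succ, approx_succ E N, step, step]
    congr 2
    refine tsum_congr fun k => ?_
    rw [← approx_succ, ih]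
    rw [norm_pow_mul hp0]
    refine lt_of_le_of_lt ?_ hξ
    rw [← mul_assoc, ← pow_add]
    exact mul_le_mul_of_nonneg_right (pow_le_pow_of_le_one hp0.le hp1.le (by omega))
      (norm_nonneg _)

lemma approx_eq_of_le {M N : ℕ} (h : M ≤ N) {ξ : ℂ} (hξ : p ^ M * ‖ξ‖ < E.ρ) :
    E.approx N ξ = E.approx M ξ := by
  induction N, h using Nat.le_induction with
  | base => rfl
  | succ N h ih =>
    rw [approx_succ_eq E hp0 hp1 N, ih]
    refine lt_of_le_of_lt ?_ hξ
    exact mul_le_mul_of_nonneg_right (pow_le_pow_of_le_one hp0.le hp1.le h) (norm_nonneg _)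

lemma exists_pow_mul_lt (ξ : ℂ) : ∃ N : ℕ, p ^ N * ‖ξ‖ < E.ρ := by
  have h : Tendsto (fun N : ℕ => p ^ N * ‖ξ‖) atTop (𝓝 0) := by
    simpa using (tendsto_pow_atTop_nhds_zero_of_lt_one hp0.le hp1).mul_const ‖ξ‖
  exact (h.eventually_lt_const E.ρ_pos).exists

end

open Classical in
/-- The continuation of the germ by the functional equation (`0` at its poles). -/
def cont (ξ : ℂ) : ℂ :=
  if h : ∃ N : ℕ, p ^ N * ‖ξ‖ < E.ρ then E.approx (Nat.find h) ξ else 0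

section
variable (hp0 : 0 < p) (hp1 : p < 1)
include hp0 hp1

lemma cont_eq_approx {N : ℕ} {ξ : ℂ} (hξ : p ^ N * ‖ξ‖ < E.ρ) : E.cont ξ = E.approx N ξ := by
  classical
  have h : ∃ N : ℕ, p ^ N * ‖ξ‖ < E.ρ := ⟨N, hξ⟩
  rw [cont, dif_pos h, approx_eq_of_le E hp0 hp1 (Nat.find_min' h hξ) (Nat.find_spec h)]

lemma cont_eq_φ {ξ : ℂ} (hξ : ξ ∈ Metric.ball (0 : ℂ) E.ρ) : E.cont ξ = E.φ ξ :=
  E.cont_eq_approx hp0 hp1 (N := 0) (by simpa using hξ)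

lemma norm_Q_mul_le {C' c' : ℝ} (hC' : 0 ≤ C') (hc' : 0 < c') (u : ℂ → ℂ) (k : ℕ) (ξ : ℂ)
    (hu : ‖u ((p : ℂ) ^ k * ξ)‖ ≤ C' * eulerR p (c' * (p ^ k * ‖ξ‖))) :
    ‖E.Q k ξ * u ((p : ℂ) ^ k * ξ)‖ ≤
      (E.C * C' * (1 + ‖ξ‖) ^ E.P.natDegree * eulerR p (c' * ‖ξ‖)) * (E.s / c') ^ k := by
  have hC := E.C_pos
  have hs := E.s_pos
  have h1 := pow_mul_eulerR_le hp0 hp1 (show 0 ≤ c' * ‖ξ‖ by positivity) k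
  rw [show p ^ k * (c' * ‖ξ‖) = c' * (p ^ k * ‖ξ‖) by ring] at h1
  rw [norm_mul]
  have h2 := eulerR_pos hp0 hp1 (show 0 ≤ c' * (p ^ k * ‖ξ‖) by positivity)
  calc _ ≤ (E.C * ((E.s * ‖ξ‖) ^ k * p ^ (k.choose 2) * (1 + ‖ξ‖) ^ E.P.natDegree)) *
        (C' * eulerR p (c' * (p ^ k * ‖ξ‖))) :=
        mul_le_mul (E.norm_Q_le k ξ) hu (norm_nonneg _) (by positivity)
    _ = (E.C * C' * (1 + ‖ξ‖) ^ E.P.natDegree * (E.s / c') ^ k) *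
        ((c' * ‖ξ‖) ^ k * p ^ (k.choose 2) * eulerR p (c' * (p ^ k * ‖ξ‖))) := by
        rw [div_pow, mul_pow, mul_pow]; field_simp
    _ ≤ (E.C * C' * (1 + ‖ξ‖) ^ E.P.natDegree * (E.s / c') ^ k) * eulerR p (c' * ‖ξ‖) := by
        gcongr
    _ = _ := by ring

/-- The point is that C' and c' do not depend on N, so the bound passes to the limit function
`cont`. -/
lemma approx_bound {U : Set ℂ} (hUo : IsOpen U) (hU : ∀ ξ ∈ U, (p : ℂ) * ξ ∈ U) {c : ℝ}
    (hc : 0 < c) (hP : ∀ ξ ∈ U, c * (1 + ‖ξ‖) ^ E.P.natDegree ≤ ‖E.P.eval ξ‖) :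
    ∃ C' c' : ℝ, 0 < C' ∧ 0 < c' ∧ ∀ N : ℕ,
      (∀ ξ ∈ U, p ^ N * ‖ξ‖ < E.ρ → ‖E.approx N ξ‖ ≤ C' * eulerR p (c' * ‖ξ‖)) ∧
      DifferentiableOn ℂ (E.approx N) {ξ | ξ ∈ U ∧ p ^ N * ‖ξ‖ < E.ρ} := by
  have hC := E.C_pos
  have hs := E.s_pos
  -- With c' = s/δ the k-th term of the step is at most a constant times δ^k, and the sum over k ≥ 1
  -- of δ^k is at most 2δ. Then 2 E.C δ ≤ c/2 by the choice of δ, and E.C ≤ C' c/2 by that of C', so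
  -- division by P, at least c(1 + ‖ξ‖)^deg P in modulus, closes the induction.
  set δ : ℝ := min (1 / 2) (c / (4 * E.C)) with hδ
  have hδ0 : 0 < δ := lt_min (by norm_num) (by positivity)
  have hδ1 : δ ≤ 1 / 2 := min_le_left _ _
  have hδ2 : 4 * E.C * δ ≤ c := by
    have : δ ≤ c / (4 * E.C) := min_le_right _ _
    rw [le_div_iff₀ (by positivity)] at this
    linarith
  set C' : ℝ := max (2 * E.C / c) E.C with hC'
  have hC'0 : 0 < C' := lt_max_of_lt_right hC
  have hc'0 : 0 < E.s / δ := by positivity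
  have hsc : E.s ≤ E.s / δ := by
    rw [le_div_iff₀ hδ0]; nlinarith
  have hratio : E.s / (E.s / δ) = δ := by field_simp
  have hUk : ∀ k : ℕ, ∀ ξ ∈ U, (p : ℂ) ^ k * ξ ∈ U := by
    intro k
    induction k with
    | zero => simp
    | succ k ih =>
      intro ξ hξ
      rw [pow_succ', mul_assoc]
      exact hU _ (ih ξ hξ)
  have hgeo : HasSum (fun k : ℕ => δ ^ (k + 1)) (δ * (1 - δ)⁻¹) := by
    simp_rw [pow_succ']
    exact (hasSum_geometric_of_lt_one hδ0.le (by linarith)).mul_left δ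
  have hgeo2 : δ * (1 - δ)⁻¹ ≤ 2 * δ := by
    rw [← div_eq_mul_inv, div_le_iff₀ (by linarith)]; nlinarith
  refine ⟨C', E.s / δ, hC'0, hc'0, fun N => ?_⟩
  induction N with
  | zero =>
    constructor
    · intro ξ _ hξ
      have h1 := E.norm_φ_le ξ (by simpa using hξ)
      have h2 := one_le_eulerR hp0 hp1 (show 0 ≤ E.s / δ * ‖ξ‖ by positivity)
      change ‖E.φ ξ‖ ≤ _
      have h3 : E.C ≤ C' := le_max_right _ _
      nlinarith
    · refine E.differentiableOn_φ.mono fun ξ hξ => ?_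
      simpa using hξ.2
  | succ N ih =>
    have hmem : ∀ ξ, p ^ (N + 1) * ‖ξ‖ < E.ρ → ∀ k : ℕ,
        p ^ N * ‖(p : ℂ) ^ (k + 1) * ξ‖ < E.ρ := by
      intro ξ hξ k
      rw [norm_pow_mul hp0, ← mul_assoc, ← pow_add]
      exact (mul_le_mul_of_nonneg_right (pow_le_pow_of_le_one hp0.le hp1.le (by omega))
        (norm_nonneg _)).trans_lt hξ
    have hterm : ∀ ξ ∈ U, p ^ (N + 1) * ‖ξ‖ < E.ρ → ∀ k : ℕ,
        ‖E.Q (k + 1) ξ * E.approx N ((p : ℂ) ^ (k + 1) * ξ)‖ ≤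
        (E.C * C' * (1 + ‖ξ‖) ^ E.P.natDegree * eulerR p (E.s / δ * ‖ξ‖)) * δ ^ (k + 1) := by
      intro ξ hξU hξ k
      have := ih.1 _ (hUk (k + 1) ξ hξU) (hmem ξ hξ k)
      rw [norm_pow_mul hp0] at this
      have := E.norm_Q_mul_le hp0 hp1 hC'0.le hc'0 (E.approx N) (k + 1) ξ this
      rwa [hratio] at this
    constructor
    · intro ξ hξU hξ
      have hE1 := eulerR_pos hp0 hp1 (show 0 ≤ E.s / δ * ‖ξ‖ by positivity)
      have hE2 : eulerR p (E.s * ‖ξ‖) ≤ eulerR p (E.s / δ * ‖ξ‖) :=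
        eulerR_mono hp0 hp1 (by positivity) (by gcongr)
      have h1 := tsum_of_norm_bounded (hgeo.mul_left _) (hterm ξ hξU hξ)
      have hX : 1 ≤ (1 + ‖ξ‖) ^ E.P.natDegree := one_le_pow₀ (by linarith [norm_nonneg ξ])
      have hPpos : 0 < ‖E.P.eval ξ‖ := lt_of_lt_of_le (by positivity) (hP ξ hξU)
      rw [approx_succ, step, norm_div, div_le_iff₀ hPpos]
      set X := (1 + ‖ξ‖) ^ E.P.natDegree
      set Y := eulerR p (E.s / δ * ‖ξ‖)
      have h3 : 2 * E.C ≤ C' * c := by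
        have : 2 * E.C / c ≤ C' := le_max_left _ _
        rwa [div_le_iff₀ hc] at this
      calc _ ≤ E.C * Y + E.C * C' * X * Y * (2 * δ) := by
            refine (norm_sub_le _ _).trans (add_le_add ?_ (h1.trans ?_))
            · exact (E.norm_G_le ξ).trans (by gcongr)
            · gcongr
        _ ≤ E.C * (X * Y) + E.C * C' * X * Y * (2 * δ) := by
            gcongr
            exact le_mul_of_one_le_left hE1.le hX
        _ = (E.C + C' * (2 * E.C * δ)) * (X * Y) := by ring
        _ ≤ (C' * c) * (X * Y) := by
            refine mul_le_mul_of_nonneg_right ?_ (by positivity)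
            nlinarith
        _ = C' * Y * (c * X) := by ring
        _ ≤ C' * Y * ‖E.P.eval ξ‖ := by
            gcongr
            exact hP ξ hξU
    · have hVo : IsOpen {ξ | ξ ∈ U ∧ p ^ (N + 1) * ‖ξ‖ < E.ρ} :=
        hUo.inter (isOpen_lt (continuous_const.mul continuous_norm) continuous_const)
      rw [approx_succ]
      refine DifferentiableOn.div (E.differentiable_G.differentiableOn.sub ?_)
        E.P.differentiable.differentiableOn fun ξ hξ => ?_
      · have hρ := E.ρ_pos
        set M : ℝ := E.ρ / p ^ (N + 1)
        have hM0 : 0 ≤ M := by positivity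
        refine differentiableOn_tsum_of_summable_norm (u := fun k =>
          (E.C * C' * (1 + M) ^ E.P.natDegree * eulerR p (E.s / δ * M)) * δ ^ (k + 1))
          (hgeo.mul_left _).summable (fun k => ?_) hVo fun k ξ hξ => ?_
        · refine (E.differentiable_Q _).differentiableOn.mul ?_
          refine ih.2.comp (by fun_prop) fun ξ hξ => ⟨hUk _ ξ hξ.1, hmem ξ hξ.2 k⟩
        · refine (hterm ξ hξ.1 hξ.2 k).trans ?_
          have hM : ‖ξ‖ ≤ M := by
            rw [le_div_iff₀ (by positivity), mul_comm]; exact hξ.2.le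
          have hE2 : eulerR p (E.s / δ * ‖ξ‖) ≤ eulerR p (E.s / δ * M) :=
            eulerR_mono hp0 hp1 (by positivity) (by gcongr)
          have hE3 := (eulerR_pos hp0 hp1 (show 0 ≤ E.s / δ * ‖ξ‖ by positivity)).le
          gcongr
      · have := hP ξ hξ.1
        have h2 : 0 < c * (1 + ‖ξ‖) ^ E.P.natDegree := by positivity
        exact norm_pos_iff.1 (h2.trans_le this)

lemma cont_bound {U : Set ℂ} (hUo : IsOpen U) (hU : ∀ ξ ∈ U, (p : ℂ) * ξ ∈ U) {c : ℝ}
    (hc : 0 < c) (hP : ∀ ξ ∈ U, c * (1 + ‖ξ‖) ^ E.P.natDegree ≤ ‖E.P.eval ξ‖) :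
    (∃ C' c' : ℝ, 0 < C' ∧ 0 < c' ∧ ∀ ξ ∈ U, ‖E.cont ξ‖ ≤ C' * eulerR p (c' * ‖ξ‖)) ∧
      DifferentiableOn ℂ E.cont U := by
  obtain ⟨C', c', hC', hc', H⟩ := E.approx_bound hp0 hp1 hUo hU hc hP
  refine ⟨⟨C', c', hC', hc', fun ξ hξ => ?_⟩, fun ξ hξ => ?_⟩
  · obtain ⟨N, hN⟩ := E.exists_pow_mul_lt hp0 hp1 ξ
    rw [E.cont_eq_approx hp0 hp1 hN]
    exact (H N).1 ξ hξ hN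
  · obtain ⟨N, hN⟩ := E.exists_pow_mul_lt hp0 hp1 ξ
    have hVo : IsOpen {ξ | ξ ∈ U ∧ p ^ N * ‖ξ‖ < E.ρ} :=
      hUo.inter (isOpen_lt (continuous_const.mul continuous_norm) continuous_const)
    have h1 := (H N).2.differentiableAt (hVo.mem_nhds ⟨hξ, hN⟩)
    refine (h1.congr_of_eventuallyEq ?_).differentiableWithinAt
    filter_upwards [hVo.mem_nhds ⟨hξ, hN⟩] with w hw
    exact E.cont_eq_approx hp0 hp1 hw.2

end

end BorelEquation

/-! ### Identity theorem off a countable set, p^ℤ-saturations, connectedness. -/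

/-- The ball is homeomorphic to the plane, where the complement of a countable set is connected. -/
lemma IsPreconnected.ball_diff_countable (z : ℂ) {r : ℝ} (hr : 0 < r) {Z : Set ℂ}
    (hZ : Z.Countable) : IsPreconnected (Metric.ball z r \ Z) := by
  set e := OpenPartialHomeomorph.univBall z r
  have hinj : Function.Injective e := fun x y h => e.injOn (by simp [e]) (by simp [e]) h
  have h1 : (e ⁻¹' Z).Countable := hZ.preimage hinj
  have h2 : IsConnected (e ⁻¹' Z)ᶜ :=
    h1.isConnected_compl_of_one_lt_rank (Complex.rank_real_complex ▸ Nat.one_lt_ofNat)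
  have h3 := h2.isPreconnected.image e (OpenPartialHomeomorph.continuous_univBall z r).continuousOn
  convert h3 using 1
  have h4 : e.target = Metric.ball z r := OpenPartialHomeomorph.univBall_target z hr
  ext w
  constructor
  · rintro ⟨hw, hwZ⟩
    rw [← h4] at hw
    exact ⟨e.symm w, by simpa [e.right_inv hw] using hwZ, e.right_inv hw⟩
  · rintro ⟨v, hv, rfl⟩
    exact ⟨h4 ▸ e.map_source (by simp [e]), hv⟩

lemma countable_dense_compl {Z : Set ℂ} (hZ : Z.Countable) : Dense Zᶜ :=
  hZ.dense_compl ℝ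

/-- Identity theorem on a domain from which a closed countable set is removed. -/
lemma eqOn_zero_of_diff_countable {Ω Z : Set ℂ} (hΩo : IsOpen Ω) (hΩ : IsPreconnected Ω)
    (hZc : IsClosed Z) (hZ : Z.Countable) {h : ℂ → ℂ} (hh : DifferentiableOn ℂ h (Ω \ Z))
    {z₀ : ℂ} (hz₀ : z₀ ∈ Ω) (h0 : ∀ᶠ z in 𝓝 z₀, z ∉ Z → h z = 0) :
    ∀ z ∈ Ω \ Z, h z = 0 := by
  -- The set of points near which h vanishes off Z is open and relatively closed in Ω; connectedness
  -- of Ω itself then suffices.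
  set u : Set ℂ := {z | ∃ ε > 0, ∀ w ∈ Metric.ball z ε, w ∉ Z → h w = 0} with hu
  have hsub : Ω ⊆ u := by
    refine hΩ.subset_of_closure_inter_subset ?_ ⟨z₀, hz₀, Metric.eventually_nhds_iff_ball.1 h0⟩ ?_
    · refine Metric.isOpen_iff.2 fun z ⟨ε, hε, H⟩ => ⟨ε, hε, fun y hy => ?_⟩
      obtain ⟨δ, hδ, hδs⟩ := Metric.isOpen_iff.1 Metric.isOpen_ball y hy
      exact ⟨δ, hδ, fun w hw => H w (hδs hw)⟩
    · rintro z ⟨hzc, hzΩ⟩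
      obtain ⟨ε, hε, hεΩ⟩ := Metric.isOpen_iff.1 hΩo z hzΩ
      refine ⟨ε, hε, ?_⟩
      obtain ⟨y, hyu, hyz⟩ := Metric.mem_closure_iff.1 hzc ε hε
      obtain ⟨δ, hδ, H⟩ := hyu
      have hy : y ∈ Metric.ball z ε := by rwa [Metric.mem_ball, dist_comm]
      have hO : IsOpen (Metric.ball z ε ∩ Metric.ball y δ) :=
        Metric.isOpen_ball.inter Metric.isOpen_ball
      obtain ⟨w, hw, hwZ⟩ := (countable_dense_compl hZ).inter_open_nonempty _ hO
        ⟨y, hy, Metric.mem_ball_self hδ⟩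
      -- The ball without Z is connected, so vanishing near the single point w spreads over all of
      -- it.
      have hpre := IsPreconnected.ball_diff_countable z hε hZ
      have hopen : IsOpen (Metric.ball z ε \ Z) := Metric.isOpen_ball.sdiff hZc
      have han : AnalyticOnNhd ℂ h (Metric.ball z ε \ Z) :=
        (hh.mono (Set.sdiff_subset_sdiff_left hεΩ)).analyticOnNhd hopen
      have hev : h =ᶠ[𝓝 w] 0 := by
        filter_upwards [Metric.isOpen_ball.mem_nhds hw.2, hZc.isOpen_compl.mem_nhds hwZ]
          with v hv1 hv2 using H v hv1 hv2
      exact fun v hv hvZ => han.eqOn_zero_of_preconnected_of_eventuallyEq_zero hpre ⟨hw.1, hwZ⟩ hev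
        ⟨hv, hvZ⟩
  rintro z ⟨hzΩ, hzZ⟩
  obtain ⟨ε, hε, H⟩ := hsub hzΩ
  exact H z (Metric.mem_ball_self hε) hzZ

/-- The saturation of a set under multiplication by `p^ℤ`. -/
def qSat (p : ℝ) (A : Set ℂ) : Set ℂ := {ξ | ∃ m : ℤ, (p : ℂ) ^ m * ξ ∈ A}

lemma subset_qSat (p : ℝ) (A : Set ℂ) : A ⊆ qSat p A := fun ξ h => ⟨0, by simpa using h⟩

lemma qSat_eq (p : ℝ) (A : Set ℂ) : qSat p A = ⋃ m : ℤ, (fun ξ => (p : ℂ) ^ m * ξ) ⁻¹' A := by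
  ext ξ; simp [qSat]

lemma isOpen_qSat (p : ℝ) {A : Set ℂ} (hA : IsOpen A) : IsOpen (qSat p A) := by
  rw [qSat_eq]
  exact isOpen_iUnion fun m => hA.preimage (by fun_prop)

section
variable {p : ℝ} (hp0 : 0 < p) (hp1 : p < 1)
include hp0

lemma zpow_mul_mem_qSat {A : Set ℂ} (m : ℤ) {ξ : ℂ} :
    (p : ℂ) ^ m * ξ ∈ qSat p A ↔ ξ ∈ qSat p A := by
  have hp : (p : ℂ) ≠ 0 := by exact_mod_cast hp0.ne'
  constructor
  · rintro ⟨k, hk⟩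
    exact ⟨k + m, by rwa [zpow_add₀ hp, mul_assoc]⟩
  · rintro ⟨k, hk⟩
    refine ⟨k - m, ?_⟩
    rwa [← mul_assoc, ← zpow_add₀ hp, sub_add_cancel]

/-- Having both w and pw in A makes consecutive dilates of A overlap, so they form a chain. -/
lemma isConnected_qSat {A : Set ℂ} (hA : IsConnected A) {w : ℂ} (hw : w ∈ A)
    (hw' : (p : ℂ) * w ∈ A) : IsConnected (qSat p A) := by
  have hp : (p : ℂ) ≠ 0 := by exact_mod_cast hp0.ne'
  have himg : ∀ m : ℤ, (fun ξ => (p : ℂ) ^ m * ξ) ⁻¹' A = (fun ξ => (p : ℂ) ^ (-m) * ξ) '' A := by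
    intro m
    have hpm : (p : ℂ) ^ m ≠ 0 := zpow_ne_zero _ hp
    ext ξ
    constructor
    · intro h
      exact ⟨_, h, by simp only; rw [zpow_neg]; field_simp⟩
    · rintro ⟨η, h, rfl⟩
      simp only [Set.mem_preimage]
      rw [zpow_neg]
      rwa [mul_inv_cancel_left₀ hpm]
  rw [qSat_eq]
  refine IsConnected.iUnion_of_chain (fun m => ?_) fun m => ?_
  · rw [himg]
    exact hA.image _ (by fun_prop)
  · refine ⟨(p : ℂ) ^ (-m) * w, ?_, ?_⟩
    · simp only [Set.mem_preimage]
      rwa [← mul_assoc, ← zpow_add₀ hp, add_neg_cancel, zpow_zero, one_mul]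
    · simp only [Set.mem_preimage, Order.succ_eq_add_one]
      rw [← mul_assoc, ← zpow_add₀ hp, add_right_comm, add_neg_cancel, zero_add, zpow_one]
      exact hw'

include hp1

lemma isConnected_ball_union_qSat {A : Set ℂ} (hA : IsConnected A) {w : ℂ} (hw : w ∈ A)
    (hw' : (p : ℂ) * w ∈ A) {ρ : ℝ} (hρ : 0 < ρ) :
    IsConnected (Metric.ball (0 : ℂ) ρ ∪ qSat p A) := by
  refine IsConnected.union ?_ (Metric.isConnected_ball hρ) (isConnected_qSat hp0 hA hw hw')
  obtain ⟨N, hN⟩ := ((tendsto_pow_mul_zero hp0 hp1 w).eventually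
    (Metric.ball_mem_nhds 0 hρ)).exists
  refine ⟨_, hN, ?_⟩
  rw [← zpow_natCast, zpow_mul_mem_qSat hp0]
  exact subset_qSat p A hw

lemma pow_mul_mem_ball_union_qSat {A : Set ℂ} {ρ : ℝ} (k : ℕ) {ξ : ℂ}
    (hξ : ξ ∈ Metric.ball (0 : ℂ) ρ ∪ qSat p A) :
    (p : ℂ) ^ k * ξ ∈ Metric.ball (0 : ℂ) ρ ∪ qSat p A := by
  rcases hξ with h | h
  · left
    rw [mem_ball_zero_iff] at h ⊢
    rw [BorelEquation.norm_pow_mul hp0]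
    exact (mul_le_of_le_one_left (norm_nonneg _) (pow_le_one₀ hp0.le hp1.le)).trans_lt h
  · right
    rwa [← zpow_natCast, zpow_mul_mem_qSat hp0]

end

lemma isConnected_thickening {Γ : Set ℂ} (hΓ : IsConnected Γ) {δ : ℝ} (hδ : 0 < δ) :
    IsConnected (Metric.thickening δ Γ) := by
  have h := (hΓ.prod (Metric.isConnected_ball (x := (0 : ℂ)) hδ)).image
    (fun x : ℂ × ℂ => x.1 + x.2) (by fun_prop)
  convert h using 1
  ext w
  rw [Metric.mem_thickening_iff]
  constructor
  · rintro ⟨z, hz, hd⟩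
    refine ⟨(z, w - z), ⟨hz, ?_⟩, by simp⟩
    rwa [mem_ball_zero_iff, ← dist_eq_norm]
  · rintro ⟨⟨z, v⟩, ⟨hz, hv⟩, rfl⟩
    refine ⟨z, hz, ?_⟩
    rw [dist_eq_norm]
    simpa using hv

lemma exists_multiset_prod_lower_bound (S : Multiset ℂ) (Y : Set ℂ)
    (h : ∀ a ∈ S, ∃ c > 0, ∀ ξ ∈ Y, c * (1 + ‖ξ‖) ≤ ‖ξ - a‖) :
    ∃ c > 0, ∀ ξ ∈ Y, c * (1 + ‖ξ‖) ^ Multiset.card S ≤ ‖(S.map (ξ - ·)).prod‖ := by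
  induction S using Multiset.induction_on with
  | empty => exact ⟨1, one_pos, by simp⟩
  | cons a S ih =>
    obtain ⟨c, hc, H⟩ := ih fun b hb => h b (Multiset.mem_cons_of_mem hb)
    obtain ⟨c', hc', H'⟩ := h a (Multiset.mem_cons_self a S)
    refine ⟨c' * c, by positivity, fun ξ hξ => ?_⟩
    rw [Multiset.map_cons, Multiset.prod_cons, norm_mul, Multiset.card_cons, pow_succ]
    calc _ = (c' * (1 + ‖ξ‖)) * (c * (1 + ‖ξ‖) ^ Multiset.card S) := by ring
      _ ≤ _ := mul_le_mul (H' ξ hξ) (H ξ hξ) (by positivity) (norm_nonneg _)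

/-! ### Points off the spirals of the roots of P. -/

namespace BorelEquation

variable {p : ℝ} {g : PowerSeries ℂ} (E : BorelEquation p g)

/-- The points off the spirals of the roots of `P`. -/
def regularSet : Set ℂ := {ξ | ξ ≠ 0 ∧ ∀ a ∈ E.P.roots, qTheta p (-(ξ / a)) ≠ 0}

lemma P_ne_zero : E.P ≠ 0 := fun h =>
  E.eval_ne_zero 0 (Metric.mem_ball_self E.ρ_pos) (by simp [h])

lemma root_ne_zero {a : ℂ} (ha : a ∈ E.P.roots) : a ≠ 0 := by
  rintro rfl
  exact E.eval_ne_zero 0 (Metric.mem_ball_self E.ρ_pos) ((Polynomial.mem_roots E.P_ne_zero).1 ha)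

lemma neg_div_ne_zero {ξ a : ℂ} (hξ : ξ ≠ 0) (ha : a ∈ E.P.roots) : -(ξ / a) ≠ 0 :=
  neg_ne_zero.2 (div_ne_zero hξ (E.root_ne_zero ha))

section
variable (hp0 : 0 < p) (hp1 : p < 1)
include hp0 hp1

lemma isOpen_regularSet : IsOpen E.regularSet := by
  have h : E.regularSet = {0}ᶜ ∩ ⋂ a ∈ E.P.roots.toFinset,
      ({0}ᶜ ∩ (fun ξ => qTheta p (-(ξ / a))) ⁻¹' {0}ᶜ) := by
    ext ξ
    simp only [regularSet, Set.mem_ofPred_eq, Set.mem_inter_iff, Set.mem_compl_iff,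
      Set.mem_singleton_iff, Set.mem_iInter, Set.mem_preimage, Multiset.mem_toFinset]
    exact ⟨fun h => ⟨h.1, fun a ha => ⟨h.1, h.2 a ha⟩⟩, fun h => ⟨h.1, fun a ha => (h.2 a ha).2⟩⟩
  rw [h]
  refine isOpen_compl_singleton.inter (isOpen_biInter_finset fun a ha => ?_)
  have ha' := Multiset.mem_toFinset.1 ha
  refine ContinuousOn.isOpen_inter_preimage ?_ isOpen_compl_singleton isOpen_compl_singleton
  exact (continuousOn_qTheta hp0 hp1).comp (by fun_prop) fun ξ hξ => E.neg_div_ne_zero hξ ha'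

lemma exists_eq_of_notMem_regularSet {ξ : ℂ} (h : ξ ∉ E.regularSet) :
    ξ = 0 ∨ ∃ a ∈ E.P.roots, ∃ m : ℤ, ξ = a * ((p : ℂ) ^ m)⁻¹ := by
  have hp : (p : ℂ) ≠ 0 := by exact_mod_cast hp0.ne'
  by_contra! hcon
  refine h ⟨hcon.1, fun a ha => qTheta_ne_zero hp0 hp1 (E.neg_div_ne_zero hcon.1 ha)
    fun m hm => hcon.2 a ha m ?_⟩
  have ha0 := E.root_ne_zero ha
  have hpm : (p : ℂ) ^ m ≠ 0 := zpow_ne_zero _ hp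
  field_simp at hm ⊢
  linear_combination -hm

lemma countable_compl_regularSet : (E.regularSetᶜ).Countable := by
  have h : E.regularSetᶜ ⊆ {0} ∪ ⋃ a ∈ E.P.roots.toFinset, ⋃ m : ℤ, {a * ((p : ℂ) ^ m)⁻¹} := by
    intro ξ hξ
    rcases E.exists_eq_of_notMem_regularSet hp0 hp1 hξ with h | ⟨a, ha, m, h⟩
    · exact Or.inl h
    · right
      simp only [Set.mem_iUnion, Multiset.mem_toFinset]
      exact ⟨a, ha, m, h⟩
  refine Set.Countable.mono h ((Set.countable_singleton 0).union ?_)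
  exact Set.Countable.biUnion (Finset.countable_toSet _) fun a _ =>
    Set.countable_iUnion fun m => Set.countable_singleton _

lemma zpow_mul_mem_regularSet {ξ : ℂ} (m : ℤ) (h : ξ ∈ E.regularSet) :
    (p : ℂ) ^ m * ξ ∈ E.regularSet := by
  have hp : (p : ℂ) ≠ 0 := by exact_mod_cast hp0.ne'
  refine ⟨mul_ne_zero (zpow_ne_zero _ hp) h.1, fun a ha h0 => ?_⟩
  have h1 := thetaRatio_zpow_mul hp0 hp1 (E.neg_div_ne_zero h.1 ha) m
  rw [show (p : ℂ) ^ m * -(ξ / a) = -((p : ℂ) ^ m * ξ / a) by ring, thetaRatio, h0, norm_zero,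
    zero_div] at h1
  exact (thetaRatio_pos hp0 hp1 (h.2 a ha)).ne h1

/-- By compactness `thetaRatio` has a positive minimum on W for each root, and its p^ℤ-invariance
extends this to the saturation. Each linear factor of P is then at least a constant times 1 + ‖ξ‖.
-/
lemma exists_lower_bound {W : Set ℂ} (hW : IsCompact W) (hWO : W ⊆ E.regularSet) :
    ∃ c > 0, ∀ ξ ∈ qSat p W, c * (1 + ‖ξ‖) ^ E.P.natDegree ≤ ‖E.P.eval ξ‖ := by
  have hp : (p : ℂ) ≠ 0 := by exact_mod_cast hp0.ne'
  have hroot : ∀ a ∈ E.P.roots, ∃ c > 0, ∀ ξ ∈ qSat p W, c * (1 + ‖ξ‖) ≤ ‖ξ - a‖ := by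
    intro a ha
    have ha0 := E.root_ne_zero ha
    have ha1 : 0 < ‖a‖ := norm_pos_iff.2 ha0
    obtain ⟨c, hc, hcW⟩ : ∃ c > 0, ∀ w ∈ W, c ≤ thetaRatio p (-(w / a)) := by
      have hcont : ContinuousOn (fun w => thetaRatio p (-(w / a))) W :=
        (continuousOn_thetaRatio hp0 hp1).comp (by fun_prop)
          fun w hw => E.neg_div_ne_zero (hWO hw).1 ha
      rcases W.eq_empty_or_nonempty with rfl | hne
      · exact ⟨1, one_pos, by simp⟩
      obtain ⟨w₀, hw₀, hmin⟩ := hW.exists_isMinOn hne hcont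
      exact ⟨_, thetaRatio_pos hp0 hp1 ((hWO hw₀).2 a ha), fun w hw => hmin hw⟩
    refine ⟨c * min ‖a‖ 1, by positivity, fun ξ ⟨m, hm⟩ => ?_⟩
    have hξ : ξ ≠ 0 := right_ne_zero_of_mul (hWO hm).1
    have h1 := thetaRatio_zpow_mul hp0 hp1 (E.neg_div_ne_zero hξ ha) m
    have h2 := hcW _ hm
    rw [show -((p : ℂ) ^ m * ξ / a) = (p : ℂ) ^ m * -(ξ / a) by ring, h1] at h2
    have h3 := thetaRatio_mul_one_add_le hp0 hp1 (E.neg_div_ne_zero hξ ha)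
    have h4 : ‖ξ - a‖ = ‖a‖ * ‖1 + -(ξ / a)‖ := by
      rw [← norm_mul, ← norm_neg]; congr 1; field_simp; ring
    rw [norm_neg, norm_div] at h3
    rw [h4]
    have h5 : min ‖a‖ 1 * (1 + ‖ξ‖) ≤ ‖a‖ * (1 + ‖ξ‖ / ‖a‖) := by
      rw [mul_add, mul_add, mul_div_cancel₀ _ ha1.ne', mul_one, mul_one]
      exact add_le_add (min_le_left _ _)
        (mul_le_of_le_one_left (norm_nonneg _) (min_le_right _ _))
    calc c * min ‖a‖ 1 * (1 + ‖ξ‖) = c * (min ‖a‖ 1 * (1 + ‖ξ‖)) := by ring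
      _ ≤ c * (‖a‖ * (1 + ‖ξ‖ / ‖a‖)) := by gcongr
      _ = ‖a‖ * (c * (1 + ‖ξ‖ / ‖a‖)) := by ring
      _ ≤ ‖a‖ * (thetaRatio p (-(ξ / a)) * (1 + ‖ξ‖ / ‖a‖)) := by gcongr
      _ ≤ _ := by gcongr
  obtain ⟨c, hc, H⟩ := exists_multiset_prod_lower_bound _ _ hroot
  have hs : E.P.Splits := IsAlgClosed.splits E.P
  have hl : 0 < ‖E.P.leadingCoeff‖ := norm_pos_iff.2 (Polynomial.leadingCoeff_ne_zero.2 E.P_ne_zero)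
  refine ⟨‖E.P.leadingCoeff‖ * c, by positivity, fun ξ hξ => ?_⟩
  rw [hs.eval_eq_prod_roots, norm_mul, mul_assoc, hs.natDegree_eq_card_roots]
  gcongr
  exact H ξ hξ

omit hp0 hp1 in
lemma exists_lower_bound_ball :
    ∃ c > 0, ∀ ξ ∈ Metric.ball (0 : ℂ) (E.ρ / 2),
      c * (1 + ‖ξ‖) ^ E.P.natDegree ≤ ‖E.P.eval ξ‖ := by
  have hρ := E.ρ_pos
  obtain ⟨ξ₀, hξ₀, hmin⟩ := (isCompact_closedBall (0 : ℂ) (E.ρ / 2)).exists_isMinOn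
    ⟨0, by simp; positivity⟩ (E.P.continuous.norm.continuousOn)
  have h0 : 0 < ‖E.P.eval ξ₀‖ := norm_pos_iff.2 (E.eval_ne_zero ξ₀
    (Metric.closedBall_subset_ball (by linarith) hξ₀))
  refine ⟨‖E.P.eval ξ₀‖ / (1 + E.ρ) ^ E.P.natDegree, by positivity, fun ξ hξ => ?_⟩
  rw [div_mul_eq_mul_div, div_le_iff₀ (by positivity)]
  have h1 : ‖E.P.eval ξ₀‖ ≤ ‖E.P.eval ξ‖ := hmin (Metric.ball_subset_closedBall hξ)
  have h2 : ‖ξ‖ ≤ E.ρ := by linarith [mem_ball_zero_iff.1 hξ]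
  gcongr

/-- A connected neighbourhood of a segment of the spiral of a regular point, on whose saturation
the continuation is controlled. -/
lemma exists_connected_nhd {w : ℂ} (hw : w ∈ E.regularSet) :
    ∃ T : Set ℂ, IsOpen T ∧ IsConnected T ∧ w ∈ T ∧ (p : ℂ) * w ∈ T ∧ T ⊆ E.regularSet ∧
      (∃ C' c' : ℝ, 0 < C' ∧ 0 < c' ∧ ∀ ξ ∈ Metric.ball (0 : ℂ) (E.ρ / 2) ∪ qSat p T,
        ‖E.cont ξ‖ ≤ C' * eulerR p (c' * ‖ξ‖)) ∧
      DifferentiableOn ℂ E.cont (Metric.ball (0 : ℂ) (E.ρ / 2) ∪ qSat p T) := by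
  have hpw : (p : ℂ) * w ∈ E.regularSet := by
    have := E.zpow_mul_mem_regularSet hp0 hp1 1 hw
    rwa [zpow_one] at this
  have hO := E.isOpen_regularSet hp0 hp1
  -- The plane minus a countable set is path connected, so w can be joined to pw by a path of
  -- regular points. A thin thickening of the path is T.
  have hcon : IsPathConnected (E.regularSetᶜ)ᶜ :=
    (E.countable_compl_regularSet hp0 hp1).isPathConnected_compl_of_one_lt_rank
      (Complex.rank_real_complex ▸ Nat.one_lt_ofNat)
  rw [compl_compl] at hcon
  obtain ⟨γ, hγ⟩ := hcon.joinedIn w hw _ hpw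
  have hΓc : IsCompact (Set.range γ) := isCompact_range γ.continuous
  have hΓn : IsConnected (Set.range γ) := isConnected_range γ.continuous
  obtain ⟨δ, hδ, hδO⟩ := hΓc.exists_cthickening_subset_open hO
    (Set.range_subset_iff.2 hγ)
  have hsub := Metric.self_subset_thickening hδ (Set.range γ)
  have hTo : IsOpen (Metric.thickening δ (Set.range γ)) := Metric.isOpen_thickening
  have hTc := Metric.thickening_subset_cthickening δ (Set.range γ)
  obtain ⟨c₁, hc₁, H₁⟩ := E.exists_lower_bound hp0 hp1 hΓc.cthickening hδO
  obtain ⟨c₂, hc₂, H₂⟩ := E.exists_lower_bound_ball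
  have hcb := E.cont_bound hp0 hp1
    (U := Metric.ball (0 : ℂ) (E.ρ / 2) ∪ qSat p (Metric.thickening δ (Set.range γ)))
    (Metric.isOpen_ball.union (isOpen_qSat p hTo))
    (fun ξ hξ => by simpa using pow_mul_mem_ball_union_qSat hp0 hp1 1 hξ)
    (c := min c₁ c₂) (lt_min hc₁ hc₂) (fun ξ hξ => by
      have hX : 0 ≤ (1 + ‖ξ‖) ^ E.P.natDegree := by positivity
      rcases hξ with h | h
      · exact (mul_le_mul_of_nonneg_right (min_le_right _ _) hX).trans (H₂ ξ h)
      · obtain ⟨m, hm⟩ := h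
        exact (mul_le_mul_of_nonneg_right (min_le_left _ _) hX).trans (H₁ ξ ⟨m, hTc hm⟩))
  exact ⟨_, hTo, isConnected_thickening hΓn hδ, hsub ⟨0, γ.source⟩, hsub ⟨1, γ.target⟩,
    hTc.trans hδO, hcb⟩

lemma differentiableOn_cont_regularSet : DifferentiableOn ℂ E.cont E.regularSet := by
  intro w hw
  obtain ⟨T, hTo, -, hwT, -, -, -, hd⟩ := E.exists_connected_nhd hp0 hp1 hw
  have hU : IsOpen (Metric.ball (0 : ℂ) (E.ρ / 2) ∪ qSat p T) :=
    Metric.isOpen_ball.union (isOpen_qSat p hTo)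
  exact (hd.differentiableAt
    (hU.mem_nhds (Or.inr (subset_qSat p T hwT)))).differentiableWithinAt

lemma eventually_hasSum_cont :
    ∀ᶠ ξ in 𝓝 (0 : ℂ), HasSum (fun k => PowerSeries.coeff k g * ξ ^ k) (E.cont ξ) := by
  filter_upwards [Metric.ball_mem_nhds (0 : ℂ) E.ρ_pos] with ξ hξ
  rw [E.cont_eq_φ hp0 hp1 hξ]
  exact E.hasSum_φ ξ hξ

/-- Every analytic continuation of the germ agrees with `cont` off the spirals of the roots. -/
lemma eq_cont {Ω : Set ℂ} {Φ : ℂ → ℂ} (hΩo : IsOpen Ω) (hΩ : IsConnected Ω) (h0 : (0 : ℂ) ∈ Ω)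
    (hΦ : AnalyticOnNhd ℂ Φ Ω)
    (hg : ∀ᶠ x in 𝓝 (0 : ℂ), HasSum (fun n : ℕ => PowerSeries.coeff n g * x ^ n) (Φ x)) :
    ∀ z ∈ Ω, z ∈ E.regularSet → Φ z = E.cont z := by
  have h := eqOn_zero_of_diff_countable hΩo hΩ.isPreconnected
    (E.isOpen_regularSet hp0 hp1).isClosed_compl (E.countable_compl_regularSet hp0 hp1)
    (h := fun z => Φ z - E.cont z) ?_ h0 ?_
  · intro z hz hzr
    exact sub_eq_zero.1 (h z ⟨hz, not_not.2 hzr⟩)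
  · refine (hΦ.differentiableOn.mono Set.sdiff_subset).sub
      ((E.differentiableOn_cont_regularSet hp0 hp1).mono fun z hz => not_not.1 hz.2)
  · filter_upwards [hg, E.eventually_hasSum_cont hp0 hp1] with z h1 h2 _
    rw [h1.unique h2, sub_self]

end

end BorelEquation

/-! ### The canonical continuations `ext` and `psi`, and their uniqueness. -/

/-- This lets `ext` be defined pointwise, as a limit through regular points: every continuation
agrees with it on its whole domain, including points on root spirals where the singularity is
removable. -/
lemma limUnder_eq_of_dense {D : Set ℂ} (hD : Dense D) {Ω : Set ℂ} (hΩ : IsOpen Ω) {u Φ : ℂ → ℂ}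
    (hΦ : ContinuousOn Φ Ω) (h : ∀ z ∈ Ω, z ∈ D → Φ z = u z) {z : ℂ} (hz : z ∈ Ω) :
    limUnder (𝓝[D] z) u = Φ z := by
  have : (𝓝[D] z).NeBot := mem_closure_iff_nhdsWithin_neBot.1 (hD z)
  have h1 : Tendsto Φ (𝓝[D] z) (𝓝 (Φ z)) :=
    (hΦ.continuousAt (hΩ.mem_nhds hz)).tendsto.mono_left nhdsWithin_le_nhds
  refine (h1.congr' ?_).limUnder_eq
  filter_upwards [self_mem_nhdsWithin, mem_nhdsWithin_of_mem_nhds (hΩ.mem_nhds hz)] with w h1 h2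
    using h w h2 h1

section
variable {p : ℝ} (hp0 : 0 < p) (hp1 : p < 1)
include hp0 hp1

lemma divPoch_bound {V : Set ℂ} (hVo : IsOpen V) (hV : ∀ k : ℕ, ∀ ξ ∈ V, (p : ℂ) ^ k * ξ ∈ V)
    {b : ℂ → ℂ} {C c : ℝ} (hC : 0 < C) (hc : 0 < c) (hb : ∀ ξ ∈ V, ‖b ξ‖ ≤ C * eulerR p (c * ‖ξ‖))
    (hd : DifferentiableOn ℂ b V) :
    (∀ ξ ∈ V, ‖divPoch p b ξ‖ ≤ (eulerR p (-p))⁻¹ * (eulerR p p * (C * eulerR p (c * ‖ξ‖)))) ∧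
      DifferentiableOn ℂ (divPoch p b) V := by
  have hbk : ∀ ξ ∈ V, ∀ k : ℕ, ‖b ((p : ℂ) ^ k * ξ)‖ ≤ C * eulerR p (c * ‖ξ‖) := by
    intro ξ hξ k
    refine (hb _ (hV k ξ hξ)).trans ?_
    rw [BorelEquation.norm_pow_mul hp0]
    refine mul_le_mul_of_nonneg_left (eulerR_mono hp0 hp1 (by positivity) ?_) hC.le
    refine mul_le_mul_of_nonneg_left ?_ hc.le
    exact mul_le_of_le_one_left (norm_nonneg _) (pow_le_one₀ hp0.le hp1.le)
  refine ⟨fun ξ hξ => norm_divPoch_le hp0 hp1 (hbk ξ hξ), fun ξ hξ => ?_⟩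
  have hWo : IsOpen (V ∩ Metric.ball 0 (‖ξ‖ + 1)) := hVo.inter Metric.isOpen_ball
  have hW : DifferentiableOn ℂ (divPoch p b) (V ∩ Metric.ball 0 (‖ξ‖ + 1)) := by
    refine DifferentiableOn.const_mul ?_ _
    refine differentiableOn_tsum_of_summable_norm
      (u := fun k => eulerCoeff p k * p ^ k * (C * eulerR p (c * (‖ξ‖ + 1))))
      ((summable_eulerCoeff_mul_pow hp0 hp1 p).mul_right _) (fun k => ?_) hWo fun k w hw => ?_
    · refine (differentiableOn_const _).mul ?_
      exact hd.comp (by fun_prop) fun w hw => hV k w hw.1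
    · refine norm_divPoch_term_le hp0 hp1 ((hbk w hw.1 k).trans ?_) k
      refine mul_le_mul_of_nonneg_left (eulerR_mono hp0 hp1 (by positivity) ?_) hC.le
      exact mul_le_mul_of_nonneg_left (mem_ball_zero_iff.1 hw.2).le hc.le
  exact (hW.differentiableAt (hWo.mem_nhds ⟨hξ, by simp⟩)).differentiableWithinAt

/-- `divPoch` divides the Taylor coefficients by `(p;p)_n`. -/
lemma hasSum_divPoch_series {b : ℂ → ℂ} {c : ℕ → ℂ} {ξ : ℂ}
    (hb : ∀ k : ℕ, HasSum (fun n => c n * ((p : ℂ) ^ k * ξ) ^ n) (b ((p : ℂ) ^ k * ξ))) :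
    HasSum (fun n => c n / qPoch p n * ξ ^ n) (divPoch p b ξ) := by
  have hE := euler_neg_p_ne_zero hp0 hp1
  set F : ℕ × ℕ → ℂ := fun x => ((eulerCoeff p x.1 : ℂ) * (-p) ^ x.1) *
    (c x.2 * ((p : ℂ) ^ x.1 * ξ) ^ x.2) with hF
  have hs2 : Summable fun n => ‖c n * ξ ^ n‖ := by simpa using (hb 0).summable.norm
  have hsum : Summable F := by
    have h1 : Summable fun x : ℕ × ℕ => (eulerCoeff p x.1 * p ^ x.1) * ‖c x.2 * ξ ^ x.2‖ :=
      Summable.mul_of_nonneg (f := fun k => eulerCoeff p k * p ^ k)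
        (g := fun n => ‖c n * ξ ^ n‖) (summable_eulerCoeff_mul_pow hp0 hp1 p) hs2
        (fun k => mul_nonneg (eulerCoeff_pos hp0 hp1 k).le (pow_pos hp0 k).le)
        fun n => norm_nonneg _
    refine Summable.of_norm_bounded h1 fun x => ?_
    rw [hF]
    simp only
    rw [norm_mul, norm_mul, norm_pow, norm_neg, Complex.norm_real, Complex.norm_real,
      Real.norm_of_nonneg hp0.le, Real.norm_of_nonneg (eulerCoeff_pos hp0 hp1 _).le, norm_mul,
      norm_mul, norm_pow, norm_pow, BorelEquation.norm_pow_mul hp0]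
    have := eulerCoeff_pos hp0 hp1 x.1
    gcongr
    exact mul_le_of_le_one_left (norm_nonneg _) (pow_le_one₀ hp0.le hp1.le)
  have hr : ∀ k, HasSum (fun n => F (k, n)) (((eulerCoeff p k : ℂ) * (-p) ^ k) *
      b ((p : ℂ) ^ k * ξ)) := by
    intro k
    rw [hF]
    exact (hb k).mul_left ((eulerCoeff p k : ℂ) * (-p) ^ k)
  have hc : ∀ n, HasSum (fun k => F (k, n)) (euler p (-p) * (c n / qPoch p n * ξ ^ n)) := by
    intro n
    have h1 := (hasSum_euler hp0 hp1 (-(p : ℂ) ^ (n + 1))).mul_right (c n * ξ ^ n)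
    have h2 := qPoch_mul_euler hp0 hp1 n
    have hq : (qPoch p n : ℂ) ≠ 0 := by exact_mod_cast (qPoch_pos hp0 hp1 n).ne'
    have e : euler p (-p) * (c n / qPoch p n * ξ ^ n) =
        euler p (-(p : ℂ) ^ (n + 1)) * (c n * ξ ^ n) := by
      rw [← h2]; field_simp
    rw [e]
    refine h1.congr_fun fun k => ?_
    rw [hF]
    simp only
    rw [mul_pow, ← pow_mul, neg_pow (p : ℂ), neg_pow ((p : ℂ) ^ (n + 1)), ← pow_mul]
    ring
  have h1 := hsum.hasSum.prod_fiberwise hr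
  have h2 := ((Equiv.prodComm ℕ ℕ).hasSum_iff.2 hsum.hasSum).prod_fiberwise hc
  have h3 := h2.mul_left (euler p (-p))⁻¹
  have e : (euler p (-p))⁻¹ * ∑' x, F x = divPoch p b ξ := by
    rw [divPoch, h1.tsum_eq]
  rw [e] at h3
  refine h3.congr_fun fun n => ?_
  rw [inv_mul_cancel_left₀ hE]

end

/-- The dilation s serves both Borel transforms: s = 1 with u = `ext` for B_q, and s = 1 - p with u
= `psi` for 𝓑_q. -/
lemma isContinuationAlong_of_bound {q : ℝ} (hq : 1 < q) {g : PowerSeries ℂ} {A : Set ℂ}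
    (hAo : IsOpen A) (hA : IsConnected A) (hA' : ∃ w ∈ A, ((q⁻¹ : ℝ) : ℂ) * w ∈ A) {lam : ℂ}
    (hlam : lam ∈ A) {ρ s : ℝ} (hρ : 0 < ρ) (hs : 0 < s) {u : ℂ → ℂ} {C c : ℝ}
    (hc : 0 < c)
    (hu : ∀ ξ ∈ Metric.ball (0 : ℂ) ρ ∪ qSat q⁻¹ A, ‖u ξ‖ ≤ C * eulerR q⁻¹ (c * ‖ξ‖))
    (hd : DifferentiableOn ℂ u (Metric.ball (0 : ℂ) ρ ∪ qSat q⁻¹ A))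
    (hg : ∀ᶠ η in 𝓝 (0 : ℂ), HasSum (fun n : ℕ => PowerSeries.coeff n g * η ^ n) (u (s * η))) :
    IsContinuationAlong q (lam / s) g {η | (s : ℂ) * η ∈ Metric.ball (0 : ℂ) ρ ∪ qSat q⁻¹ A}
      (fun η => u (s * η)) := by
  have hq0 : 0 < q := by linarith
  have hqc : (q : ℂ) ≠ 0 := by exact_mod_cast hq0.ne'
  have hp0 : 0 < q⁻¹ := inv_pos.2 hq0
  have hp1 := inv_lt_one_of_one_lt₀ hq
  have hsc : (s : ℂ) ≠ 0 := by exact_mod_cast hs.ne'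
  obtain ⟨w, hw, hw'⟩ := hA'
  have hVo : IsOpen (Metric.ball (0 : ℂ) ρ ∪ qSat q⁻¹ A) :=
    Metric.isOpen_ball.union (isOpen_qSat _ hAo)
  have hopen : IsOpen {η | (s : ℂ) * η ∈ Metric.ball (0 : ℂ) ρ ∪ qSat q⁻¹ A} :=
    hVo.preimage (f := fun η : ℂ => (s : ℂ) * η) (by fun_prop)
  have hdiff : DifferentiableOn ℂ (fun η => u (s * η))
      {η | (s : ℂ) * η ∈ Metric.ball (0 : ℂ) ρ ∪ qSat q⁻¹ A} :=
    hd.comp (f := fun η : ℂ => (s : ℂ) * η) (by fun_prop) fun η hη => hη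
  refine ⟨hopen, ?_, ?_, ?_, hg, hdiff.analyticOnNhd hopen, ?_⟩
  · have h := (isConnected_ball_union_qSat hp0 hp1 hA hw hw' hρ).image
      (fun ξ : ℂ => (s : ℂ)⁻¹ * ξ) (by fun_prop)
    convert h using 1
    ext η
    constructor
    · intro hη
      exact ⟨_, hη, by simp only; rw [inv_mul_cancel_left₀ hsc]⟩
    · rintro ⟨ξ, hξ, rfl⟩
      change (s : ℂ) * ((s : ℂ)⁻¹ * ξ) ∈ Metric.ball (0 : ℂ) ρ ∪ qSat q⁻¹ A
      rwa [mul_inv_cancel_left₀ hsc]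
  · left; simpa using hρ
  · obtain ⟨r, hr, hrA⟩ := Metric.isOpen_iff.1 hAo lam hlam
    refine ⟨r / s, by positivity, fun m η hη => Or.inr ⟨m, hrA ?_⟩⟩
    have hqm : (q : ℂ) ^ m ≠ 0 := zpow_ne_zero _ hqc
    have hqm' : 0 < q ^ m := zpow_pos hq0 m
    rw [Metric.mem_ball, dist_eq_norm] at hη ⊢
    have e : ((q⁻¹ : ℝ) : ℂ) ^ m * (s * η) - lam =
        (s : ℂ) * ((q : ℂ) ^ m)⁻¹ * (η - lam / s * (q : ℂ) ^ m) := by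
      rw [Complex.ofReal_inv, inv_zpow]; field_simp
    rw [e, norm_mul, norm_mul, norm_inv, norm_zpow, Complex.norm_real, Complex.norm_real,
      Real.norm_of_nonneg hs.le, Real.norm_of_nonneg hq0.le]
    calc _ < s * (q ^ m)⁻¹ * (r / s * q ^ m) := by gcongr
      _ = r := by field_simp
  · refine hasQExpGrowth_of_le hq (C := C) (c := c * s) (A := 0) (by positivity) fun η hη _ => ?_
    have := hu _ hη
    rwa [norm_mul, Complex.norm_real, Real.norm_of_nonneg hs.le, ← mul_assoc] at this

namespace BorelEquation

section
variable {p : ℝ} {g : PowerSeries ℂ} (E : BorelEquation p g)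

/-- The continuation, with its removable singularities removed. -/
def ext (z : ℂ) : ℂ := limUnder (𝓝[E.regularSet] z) E.cont

/-- The continuation of the series with coefficients divided by `(p;p)_n`. -/
def psi : ℂ → ℂ := divPoch p E.ext

variable (hp0 : 0 < p) (hp1 : p < 1)
include hp0 hp1

lemma dense_regularSet : Dense E.regularSet := by
  have := countable_dense_compl (E.countable_compl_regularSet hp0 hp1)
  rwa [compl_compl] at this

lemma eq_ext {Ω : Set ℂ} {Φ : ℂ → ℂ} (hΩo : IsOpen Ω) (hΩ : IsConnected Ω) (h0 : (0 : ℂ) ∈ Ω)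
    (hΦ : AnalyticOnNhd ℂ Φ Ω)
    (hg : ∀ᶠ x in 𝓝 (0 : ℂ), HasSum (fun n : ℕ => PowerSeries.coeff n g * x ^ n) (Φ x)) :
    ∀ z ∈ Ω, Φ z = E.ext z := fun _ hz =>
  (limUnder_eq_of_dense (E.dense_regularSet hp0 hp1) hΩo hΦ.continuousOn
    (E.eq_cont hp0 hp1 hΩo hΩ h0 hΦ hg) hz).symm

lemma ext_eq_cont {U : Set ℂ} (hU : IsOpen U) (h : ContinuousOn E.cont U) :
    ∀ z ∈ U, E.ext z = E.cont z := fun _ hz =>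
  limUnder_eq_of_dense (E.dense_regularSet hp0 hp1) hU h (fun _ _ _ => rfl) hz

lemma ext_eq_cont_of_mem {z : ℂ} (hz : z ∈ E.regularSet) : E.ext z = E.cont z :=
  E.ext_eq_cont hp0 hp1 (E.isOpen_regularSet hp0 hp1)
    (E.differentiableOn_cont_regularSet hp0 hp1).continuousOn z hz

lemma ext_eq_φ {z : ℂ} (hz : z ∈ Metric.ball (0 : ℂ) E.ρ) : E.ext z = E.φ z := by
  rw [E.ext_eq_cont hp0 hp1 Metric.isOpen_ball (E.differentiableOn_φ.continuousOn.congr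
    fun w hw => E.cont_eq_φ hp0 hp1 hw) z hz, E.cont_eq_φ hp0 hp1 hz]

lemma pow_mul_mem_ball {ρ : ℝ} {ξ : ℂ} (hξ : ξ ∈ Metric.ball (0 : ℂ) ρ) (k : ℕ) :
    (p : ℂ) ^ k * ξ ∈ Metric.ball (0 : ℂ) ρ := by
  rw [mem_ball_zero_iff] at hξ ⊢
  rw [norm_pow_mul hp0]
  exact (mul_le_of_le_one_left (norm_nonneg _) (pow_le_one₀ hp0.le hp1.le)).trans_lt hξ

lemma hasSum_psi {ξ : ℂ} (hξ : ξ ∈ Metric.ball (0 : ℂ) E.ρ) :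
    HasSum (fun n => PowerSeries.coeff n g / qPoch p n * ξ ^ n) (E.psi ξ) := by
  refine hasSum_divPoch_series hp0 hp1 fun k => ?_
  have := pow_mul_mem_ball hp0 hp1 hξ k
  rw [E.ext_eq_φ hp0 hp1 this]
  exact E.hasSum_φ _ this

lemma divPoch_cont_eq_psi {z : ℂ} (hz : z ∈ E.regularSet) : divPoch p E.cont z = E.psi z := by
  rw [psi, divPoch, divPoch]
  congr 1
  refine tsum_congr fun k => ?_
  rw [E.ext_eq_cont_of_mem hp0 hp1]
  rw [← zpow_natCast]
  exact E.zpow_mul_mem_regularSet hp0 hp1 k hz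

lemma differentiableOn_psi_regularSet : DifferentiableOn ℂ E.psi E.regularSet := by
  intro w hw
  obtain ⟨T, hTo, -, hwT, -, -, ⟨C, c, hC, hc, hb⟩, hd⟩ := E.exists_connected_nhd hp0 hp1 hw
  have hU : IsOpen (Metric.ball (0 : ℂ) (E.ρ / 2) ∪ qSat p T) :=
    Metric.isOpen_ball.union (isOpen_qSat p hTo)
  have h1 := (divPoch_bound hp0 hp1 hU (fun k ξ hξ => pow_mul_mem_ball_union_qSat hp0 hp1 k hξ)
    hC hc hb hd).2
  have h2 := h1.differentiableAt (hU.mem_nhds (Or.inr (subset_qSat p T hwT)))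
  refine (h2.congr_of_eventuallyEq ?_).differentiableWithinAt
  filter_upwards [(E.isOpen_regularSet hp0 hp1).mem_nhds hw] with z hz
  exact (E.divPoch_cont_eq_psi hp0 hp1 hz).symm

/-- Uniqueness of the continuation of the series with coefficients divided by `(p;p)_n`. -/
lemma eq_psi {Ω : Set ℂ} {Ψ : ℂ → ℂ} (hΩo : IsOpen Ω) (hΩ : IsConnected Ω) (h0 : (0 : ℂ) ∈ Ω)
    (hΨ : DifferentiableOn ℂ Ψ Ω)
    (hg : ∀ᶠ x in 𝓝 (0 : ℂ),
      HasSum (fun n : ℕ => PowerSeries.coeff n g / qPoch p n * x ^ n) (Ψ x))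
    {V : Set ℂ} (hV : IsOpen V) (hψ : ContinuousOn E.psi V) :
    ∀ z ∈ Ω, z ∈ V → Ψ z = E.psi z := by
  have h := eqOn_zero_of_diff_countable hΩo hΩ.isPreconnected
    (E.isOpen_regularSet hp0 hp1).isClosed_compl (E.countable_compl_regularSet hp0 hp1)
    (h := fun z => Ψ z - E.psi z) ?_ h0 ?_
  · intro z hz hzV
    have hD := E.dense_regularSet hp0 hp1
    -- Equality holds off the countable set; both values at z are recovered as the same limit
    -- through the dense regular set.
    rw [← limUnder_eq_of_dense hD (hΩo.inter hV) (u := E.psi) (hΨ.continuousOn.mono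
      Set.inter_subset_left) (fun w hw hwr => sub_eq_zero.1 (h w ⟨hw.1, not_not.2 hwr⟩)) ⟨hz, hzV⟩,
      limUnder_eq_of_dense hD hV hψ (fun _ _ _ => rfl) hzV]
  · exact (hΨ.mono Set.sdiff_subset).sub
      ((E.differentiableOn_psi_regularSet hp0 hp1).mono fun z hz => not_not.1 hz.2)
  · filter_upwards [hg, Metric.ball_mem_nhds (0 : ℂ) E.ρ_pos] with z h1 h2 _
    rw [h1.unique (E.hasSum_psi hp0 hp1 h2), sub_self]

end

end BorelEquation

/-! ### Controlled neighbourhoods of spirals, and finiteness of the singular directions. -/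

lemma exists_natAbs_le_of_zpow_bounds {p a : ℝ} (hp0 : 0 < p) (hp1 : p < 1) (ha : 0 < a) (b : ℝ) :
    ∃ N : ℕ, ∀ m : ℤ, a < p ^ m → p ^ m < b → m ∈ Set.Icc (-(N : ℤ)) N := by
  obtain ⟨N₁, h₁⟩ := exists_pow_lt_of_lt_one ha hp1
  obtain ⟨N₂, h₂⟩ := exists_pow_lt_of_lt_one (show 0 < (max b 1)⁻¹ by positivity) hp1
  refine ⟨max N₁ N₂, fun m hm hm' => ⟨?_, ?_⟩⟩
  · by_contra! hcon
    have h3 : p ^ (-(N₂ : ℤ)) ≤ p ^ m := zpow_le_zpow_right_of_le_one₀ hp0 hp1.le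
      (by push_cast at hcon; omega)
    rw [zpow_neg, zpow_natCast] at h3
    have h4 := (lt_inv_comm₀ (pow_pos hp0 _) (by positivity)).1 h₂
    linarith [le_max_left b 1]
  · by_contra! hcon
    have h3 : p ^ m ≤ p ^ (N₁ : ℤ) := zpow_le_zpow_right_of_le_one₀ hp0 hp1.le
      (by push_cast at hcon; omega)
    rw [zpow_natCast] at h3
    linarith

/-- The saturation of a compact set of nonzero numbers is locally compact off `0`. -/
lemma exists_isCompact_qSat {p : ℝ} (hp0 : 0 < p) (hp1 : p < 1) {W : Set ℂ} (hW : IsCompact W)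
    (h0 : (0 : ℂ) ∉ W) {a : ℝ} (ha : 0 < a) (b : ℝ) :
    ∃ K ⊆ qSat p W, IsCompact K ∧ ∀ ξ ∈ qSat p W, a ≤ ‖ξ‖ → ‖ξ‖ ≤ b → ξ ∈ K := by
  have hp : (p : ℂ) ≠ 0 := by exact_mod_cast hp0.ne'
  obtain ⟨ε, hε, hεW⟩ := Metric.isOpen_iff.1 hW.isClosed.isOpen_compl 0 h0
  obtain ⟨M, hM⟩ := hW.exists_bound_of_continuousOn continuousOn_id
  set b' := max b a
  have hb' : 0 < b' := lt_max_of_lt_right ha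
  obtain ⟨N, hN⟩ := exists_natAbs_le_of_zpow_bounds hp0 hp1
    (show 0 < ε / (2 * b') by positivity) (M / a + 1)
  refine ⟨⋃ m ∈ Set.Icc (-(N : ℤ)) N, (fun w => (p : ℂ) ^ (-m) * w) '' W, ?_, ?_, ?_⟩
  · simp only [Set.iUnion_subset_iff]
    rintro m - _ ⟨w, hw, rfl⟩
    rw [zpow_mul_mem_qSat hp0]
    exact subset_qSat p W hw
  · exact (Set.finite_Icc _ _).isCompact_biUnion fun m _ => hW.image (by fun_prop)
  · rintro ξ ⟨m, hm⟩ h1 h2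
    have hn : ‖(p : ℂ) ^ m * ξ‖ = p ^ m * ‖ξ‖ := by
      rw [norm_mul, norm_zpow, Complex.norm_real, Real.norm_of_nonneg hp0.le]
    have h3 : ε ≤ p ^ m * ‖ξ‖ := by
      by_contra! hcon
      exact hεW (by rwa [mem_ball_zero_iff, hn]) hm
    have h4 : p ^ m * ‖ξ‖ ≤ M := by rw [← hn]; exact hM _ hm
    have hpm := zpow_pos hp0 m
    simp only [Set.mem_iUnion]
    refine ⟨m, hN m ?_ ?_, _, hm, ?_⟩
    · rw [div_lt_iff₀ (by positivity)]
      have : p ^ m * ‖ξ‖ ≤ p ^ m * b' := by gcongr; exact h2.trans (le_max_left _ _)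
      nlinarith
    · have : p ^ m ≤ M / a := by
        rw [le_div_iff₀ ha]
        exact (mul_le_mul_of_nonneg_left h1 hpm.le).trans h4
      linarith
    · simp only
      rw [← mul_assoc, ← zpow_add₀ hp, neg_add_cancel, zpow_zero, one_mul]

namespace BorelEquation

variable {q : ℝ} {g : PowerSeries ℂ} (E : BorelEquation q⁻¹ g) (hq : 1 < q)
include hq

/-- `A` is a neighbourhood of `lam` on whose saturation the germ continues with control. -/
structure IsGoodNhd (A : Set ℂ) (lam : ℂ) (C c : ℝ) : Prop where
  isOpen : IsOpen A
  isConnected : IsConnected A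
  mem : lam ∈ A
  exists_mem : ∃ w ∈ A, ((q⁻¹ : ℝ) : ℂ) * w ∈ A
  C_pos : 0 < C
  c_pos : 0 < c
  bound : ∀ ξ ∈ Metric.ball (0 : ℂ) (E.ρ / 2) ∪ qSat q⁻¹ A,
    ‖E.ext ξ‖ ≤ C * eulerR q⁻¹ (c * ‖ξ‖)
  differentiableOn : DifferentiableOn ℂ E.ext (Metric.ball (0 : ℂ) (E.ρ / 2) ∪ qSat q⁻¹ A)

omit hq in
lemma isOpen_ball_union_qSat (p r : ℝ) {A : Set ℂ} (hA : IsOpen A) :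
    IsOpen (Metric.ball (0 : ℂ) r ∪ qSat p A) := Metric.isOpen_ball.union (isOpen_qSat p hA)

lemma exists_isGoodNhd_of_mem_regularSet {w : ℂ} (hw : w ∈ E.regularSet) :
    ∃ A C c, E.IsGoodNhd A w C c ∧ A ⊆ E.regularSet := by
  have hp0 : 0 < q⁻¹ := inv_pos.2 (by linarith)
  have hp1 := inv_lt_one_of_one_lt₀ hq
  obtain ⟨T, hTo, hT, hwT, hwT', hTr, ⟨C, c, hC, hc, hb⟩, hd⟩ := E.exists_connected_nhd hp0 hp1 hw
  have h := E.ext_eq_cont hp0 hp1 (isOpen_ball_union_qSat q⁻¹ (E.ρ / 2) hTo) hd.continuousOn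
  exact ⟨T, C, c, ⟨hTo, hT, hwT, ⟨w, hwT, hwT'⟩, hC, hc,
    fun ξ hξ => by rw [h ξ hξ]; exact hb ξ hξ, hd.congr h⟩, hTr⟩

/-- A nonsingular spiral may still carry roots of P, so the equation alone gives no bound near it.
The given continuation controls the dilates of a disc about `lam`, and the neighbourhood T of a
nearby regular point w, which also contains pw up to the choice of point in `exists_mem`, links
these dilates together. -/
lemma exists_isGoodNhd {lam : ℂ} (hlam : lam ≠ 0) (h : MemHSpiral q lam g) :
    ∃ A C c, E.IsGoodNhd A lam C c := by
  have hq0 : 0 < q := by linarith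
  have hp0 : 0 < q⁻¹ := inv_pos.2 hq0
  have hp1 := inv_lt_one_of_one_lt₀ hq
  have hqc : (q : ℂ) ≠ 0 := by exact_mod_cast hq0.ne'
  obtain ⟨Ω, Φ, hΩ⟩ := h
  obtain ⟨r, hr, hrΩ⟩ := hΩ.discs
  have hl : 0 < ‖lam‖ := norm_pos_iff.2 hlam
  -- r/2 keeps the dilates of the closed disc inside the given discs, and ‖lam‖/2 keeps that disc
  -- away from 0.
  set r1 := min (r / 2) (‖lam‖ / 2) with hr1
  have hr10 : 0 < r1 := by positivity
  obtain ⟨w, hwB, hwr⟩ := (E.dense_regularSet hp0 hp1).inter_open_nonempty _ Metric.isOpen_ball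
    ⟨lam, Metric.mem_ball_self hr10⟩
  obtain ⟨T, C₁, c₁, hT, -⟩ := E.exists_isGoodNhd_of_mem_regularSet hq hwr
  have hW : qSat q⁻¹ (Metric.closedBall lam r1) ⊆ Ω := by
    rintro ξ ⟨m, hm⟩
    refine hrΩ m ?_
    have hqm : (q : ℂ) ^ m ≠ 0 := zpow_ne_zero _ hqc
    have hqm' : 0 < q ^ m := zpow_pos hq0 m
    rw [mem_closedBall_iff_norm] at hm
    rw [mem_ball_iff_norm]
    have e : ξ - lam * (q : ℂ) ^ m = (q : ℂ) ^ m * (((q⁻¹ : ℝ) : ℂ) ^ m * ξ - lam) := by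
      rw [Complex.ofReal_inv, inv_zpow]; field_simp
    rw [e, norm_mul, norm_zpow, Complex.norm_real, Real.norm_of_nonneg hq0.le, mul_comm]
    have : r1 < r := (min_le_left _ _).trans_lt (by linarith)
    gcongr
    linarith
  have h0W : (0 : ℂ) ∉ Metric.closedBall lam r1 := by
    rw [mem_closedBall_iff_norm, zero_sub, norm_neg]
    have : r1 ≤ ‖lam‖ / 2 := min_le_right _ _
    linarith
  have hBW : qSat q⁻¹ (Metric.ball lam r1) ⊆ qSat q⁻¹ (Metric.closedBall lam r1) :=
    fun ξ ⟨m, hm⟩ => ⟨m, Metric.ball_subset_closedBall hm⟩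
  have hext := E.eq_ext hp0 hp1 hΩ.isOpen hΩ.isConnected hΩ.zero_mem hΩ.analytic hΩ.germ
  obtain ⟨C₂, c₂, A₀, hC₂, hc₂, hgr⟩ := hΩ.growth.exists_eulerR hq
  have hρ := E.ρ_pos
  -- The growth hypothesis controls only ‖ξ‖ ≥ A₀, and T's bound already covers ‖ξ‖ < ρ/2. What lies
  -- between is inside a compact set.
  obtain ⟨K, hKW, hK, hmem⟩ := exists_isCompact_qSat hp0 hp1 (isCompact_closedBall lam r1) h0W
    (show 0 < E.ρ / 2 by positivity) A₀
  obtain ⟨M, hM⟩ := hK.exists_bound_of_continuousOn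
    (hΩ.analytic.continuousOn.mono (hKW.trans hW))
  have hsub : Metric.ball (0 : ℂ) (E.ρ / 2) ∪ qSat q⁻¹ (T ∪ Metric.ball lam r1) ⊆
      (Metric.ball (0 : ℂ) (E.ρ / 2) ∪ qSat q⁻¹ T) ∪ qSat q⁻¹ (Metric.ball lam r1) := by
    rintro ξ (h | ⟨m, h | h⟩)
    · exact Or.inl (Or.inl h)
    · exact Or.inl (Or.inr ⟨m, h⟩)
    · exact Or.inr ⟨m, h⟩
  obtain ⟨w', hw', hw''⟩ := hT.exists_mem
  have hC₁ := hT.C_pos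
  have hc₁ := hT.c_pos
  refine ⟨T ∪ Metric.ball lam r1, C₁ + C₂ + |M|, max c₁ c₂, hT.isOpen.union Metric.isOpen_ball,
    IsConnected.union ⟨w, hT.mem, hwB⟩ hT.isConnected (Metric.isConnected_ball hr10),
    Or.inr (Metric.mem_ball_self hr10), ⟨w', Or.inl hw', Or.inl hw''⟩, by positivity,
    lt_max_of_lt_left hc₁, fun ξ hξ => ?_, ?_⟩
  · have e₁ : eulerR q⁻¹ (c₁ * ‖ξ‖) ≤ eulerR q⁻¹ (max c₁ c₂ * ‖ξ‖) :=
      eulerR_mono hp0 hp1 (by positivity) (by gcongr; exact le_max_left _ _)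
    have e₂ : eulerR q⁻¹ (c₂ * ‖ξ‖) ≤ eulerR q⁻¹ (max c₁ c₂ * ‖ξ‖) :=
      eulerR_mono hp0 hp1 (by positivity) (by gcongr; exact le_max_right _ _)
    have e₀ : 1 ≤ eulerR q⁻¹ (max c₁ c₂ * ‖ξ‖) := one_le_eulerR hp0 hp1 (by positivity)
    set X := eulerR q⁻¹ (max c₁ c₂ * ‖ξ‖)
    have hX : 0 < X := by linarith
    have hle : ∀ t, t ≤ C₁ → t * X ≤ (C₁ + C₂ + |M|) * X := fun t ht => by
      gcongr; linarith [abs_nonneg M]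
    have case₁ : ξ ∈ Metric.ball (0 : ℂ) (E.ρ / 2) ∪ qSat q⁻¹ T →
        ‖E.ext ξ‖ ≤ (C₁ + C₂ + |M|) * X := fun h =>
      ((hT.bound ξ h).trans (mul_le_mul_of_nonneg_left e₁ hC₁.le)).trans (hle _ le_rfl)
    rcases hsub hξ with h | h
    · exact case₁ h
    · by_cases h1 : ‖ξ‖ < E.ρ / 2
      · exact case₁ (Or.inl (by simpa using h1))
      have h2 := hBW h
      rw [← hext ξ (hW h2)]
      rcases le_total A₀ ‖ξ‖ with h3 | h3
      · refine (hgr ξ (hW h2) h3).trans ((mul_le_mul_of_nonneg_left e₂ hC₂.le).trans ?_)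
        gcongr; linarith [abs_nonneg M]
      · refine (hM ξ (hmem ξ h2 (not_lt.1 h1) h3)).trans ?_
        calc M ≤ |M| * 1 := by rw [mul_one]; exact le_abs_self M
          _ ≤ |M| * X := by gcongr
          _ ≤ _ := by gcongr; linarith
  · intro ξ hξ
    rcases hsub hξ with h | h
    · exact (hT.differentiableOn.differentiableAt
        ((isOpen_ball_union_qSat _ _ hT.isOpen).mem_nhds h)).differentiableWithinAt
    · refine (((hΩ.analytic ξ (hW (hBW h))).differentiableAt).congr_of_eventuallyEq
        ?_).differentiableWithinAt
      filter_upwards [hΩ.isOpen.mem_nhds (hW (hBW h))] with z hz using (hext z hz).symm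

lemma IsGoodNhd.psi_bound {A : Set ℂ} {lam : ℂ} {C c : ℝ} (h : E.IsGoodNhd A lam C c) :
    (∀ ξ ∈ Metric.ball (0 : ℂ) (E.ρ / 2) ∪ qSat q⁻¹ A, ‖E.psi ξ‖ ≤
      ((eulerR q⁻¹ (-q⁻¹))⁻¹ * eulerR q⁻¹ q⁻¹ * C) * eulerR q⁻¹ (c * ‖ξ‖)) ∧
      DifferentiableOn ℂ E.psi (Metric.ball (0 : ℂ) (E.ρ / 2) ∪ qSat q⁻¹ A) := by
  have hp0 : 0 < q⁻¹ := inv_pos.2 (by linarith)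
  have hp1 := inv_lt_one_of_one_lt₀ hq
  have := divPoch_bound hp0 hp1 (isOpen_ball_union_qSat q⁻¹ (E.ρ / 2) h.isOpen)
    (fun k ξ hξ => pow_mul_mem_ball_union_qSat hp0 hp1 k hξ) h.C_pos h.c_pos h.bound
    h.differentiableOn
  exact ⟨fun ξ hξ => (this.1 ξ hξ).trans_eq (by ring), this.2⟩

lemma psi_const_pos {C : ℝ} (hC : 0 < C) :
    0 < (eulerR q⁻¹ (-q⁻¹))⁻¹ * eulerR q⁻¹ q⁻¹ * C := by
  have hp0 : 0 < q⁻¹ := inv_pos.2 (by linarith)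
  have hp1 := inv_lt_one_of_one_lt₀ hq
  have h1 := eulerR_neg_p_pos hp0 hp1
  have h2 := eulerR_pos hp0 hp1 hp0.le
  positivity

lemma IsGoodNhd.memHSpiral {A : Set ℂ} {lam : ℂ} {C c : ℝ} (h : E.IsGoodNhd A lam C c) :
    MemHSpiral q lam g := by
  have hp0 : 0 < q⁻¹ := inv_pos.2 (by linarith)
  have hp1 := inv_lt_one_of_one_lt₀ hq
  have := isContinuationAlong_of_bound hq h.isOpen h.isConnected h.exists_mem h.mem
    (half_pos E.ρ_pos) one_pos h.c_pos h.bound h.differentiableOn (g := g) ?_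
  · rw [Complex.ofReal_one, div_one] at this
    exact ⟨_, _, this⟩
  · filter_upwards [Metric.ball_mem_nhds (0 : ℂ) E.ρ_pos] with η hη
    rw [Complex.ofReal_one, one_mul, E.ext_eq_φ hp0 hp1 hη]
    exact E.hasSum_φ η hη

end BorelEquation

lemma qSpiral_eq_of_mem {q : ℝ} (hq : 1 < q) (a : ℂ) (m : ℤ) :
    qSpiral q (a * (q : ℂ) ^ m) = qSpiral q a := by
  have hqc : (q : ℂ) ≠ 0 := by exact_mod_cast (by linarith : q ≠ 0)
  ext z
  constructor
  · rintro ⟨k, rfl⟩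
    exact ⟨m + k, by simp only; rw [zpow_add₀ hqc, mul_assoc]⟩
  · rintro ⟨k, rfl⟩
    exact ⟨k - m, by simp only; rw [mul_assoc, ← zpow_add₀ hqc, add_sub_cancel]⟩

/-- Regular points have good neighbourhoods, so every singular spiral is the spiral of a root of P.
-/
lemma BorelEquation.finite_singularDirections {q : ℝ} {f : PowerSeries ℂ}
    (E : BorelEquation q⁻¹ (borelTheta q f)) (hq : 1 < q) : (singularDirections q f).Finite := by
  have hp0 : 0 < q⁻¹ := inv_pos.2 (by linarith)
  have hp1 := inv_lt_one_of_one_lt₀ hq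
  refine ((E.P.roots.toFinset.finite_toSet).image (qSpiral q)).subset ?_
  rintro S ⟨lam, hlam, rfl, h⟩
  have hr : lam ∉ E.regularSet := fun hr => by
    obtain ⟨A, C, c, hA, -⟩ := E.exists_isGoodNhd_of_mem_regularSet hq hr
    exact h (hA.memHSpiral E hq)
  rcases E.exists_eq_of_notMem_regularSet hp0 hp1 hr with h0 | ⟨a, ha, m, rfl⟩
  · exact absurd h0 hlam
  · refine ⟨a, by simpa using ha, ?_⟩
    rw [Complex.ofReal_inv, inv_zpow, inv_inv, qSpiral_eq_of_mem hq]

/-! ### The discrete sums. -/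

lemma summable_zpow_div_one_add_sq {p a : ℝ} (hp0 : 0 < p) (hp1 : p < 1) (ha : 0 < a) :
    Summable fun m : ℤ => p ^ m / (1 + a * p ^ m) ^ 2 := by
  have hgeo := summable_geometric_of_lt_one hp0.le hp1
  refine Summable.of_nat_of_neg ?_ ?_
  · refine Summable.of_nonneg_of_le (fun n => by positivity) (fun n => ?_) hgeo
    rw [zpow_natCast]
    refine div_le_self (by positivity) (one_le_pow₀ ?_)
    have : 0 < a * p ^ n := by positivity
    linarith
  · refine Summable.of_nonneg_of_le (fun n => by positivity) (fun n => ?_) (hgeo.div_const (a ^ 2))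
    rw [zpow_neg, zpow_natCast]
    have hpn : 0 < p ^ n := by positivity
    rw [div_le_div_iff₀ (by positivity) (by positivity)]
    have : p ^ n * (1 + a * (p ^ n)⁻¹) ^ 2 = (p ^ n)⁻¹ * (p ^ n + a) ^ 2 := by
      field_simp
    rw [this]
    gcongr
    linarith

lemma coeff_borelExp {q : ℝ} (hq : 1 < q) (f : PowerSeries ℂ) (n : ℕ) :
    PowerSeries.coeff n (borelExp q f) =
      PowerSeries.coeff n (borelTheta q f) / qPoch q⁻¹ n * (1 - (q : ℂ)⁻¹) ^ n := by
  have := congrArg (fun r : ℝ => (r : ℂ)) (inv_qFactorial hq n)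
  push_cast at this
  rw [borelExp, PowerSeries.coeff_mk, coeff_borelTheta, div_eq_mul_inv, this, eulerCoeff]
  push_cast
  rw [inv_pow]
  ring

namespace BorelEquation

variable {q : ℝ} {f : PowerSeries ℂ} (E : BorelEquation q⁻¹ (borelTheta q f)) (hq : 1 < q)
include hq

lemma hasSum_borelExp {η : ℂ} (hη : (1 - (q : ℂ)⁻¹) * η ∈ Metric.ball (0 : ℂ) E.ρ) :
    HasSum (fun n => PowerSeries.coeff n (borelExp q f) * η ^ n)
      (E.psi ((1 - (q : ℂ)⁻¹) * η)) := by
  refine (E.hasSum_psi (inv_pos.2 (by linarith)) (inv_lt_one_of_one_lt₀ hq) hη).congr_fun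
    fun n => ?_
  rw [coeff_borelExp hq, mul_pow]
  ring

lemma IsGoodNhd.memHSpiral_borelExp {A : Set ℂ} {lam : ℂ} {C c : ℝ} (h : E.IsGoodNhd A lam C c) :
    MemHSpiral q (lam / (1 - (q : ℂ)⁻¹)) (borelExp q f) := by
  have hp1 := inv_lt_one_of_one_lt₀ hq
  obtain ⟨h1, h2⟩ := h.psi_bound E hq
  have hs : ((1 - q⁻¹ : ℝ) : ℂ) = 1 - (q : ℂ)⁻¹ := by push_cast; rfl
  have := isContinuationAlong_of_bound hq h.isOpen h.isConnected h.exists_mem h.mem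
    (half_pos E.ρ_pos) (sub_pos.2 hp1) h.c_pos h1 h2 (g := borelExp q f) ?_
  · rw [hs] at this
    exact ⟨_, _, this⟩
  · have : Tendsto (fun η : ℂ => (1 - (q : ℂ)⁻¹) * η) (𝓝 0) (𝓝 0) :=
      Continuous.tendsto' (by fun_prop) _ _ (by simp)
    filter_upwards [this.eventually (Metric.ball_mem_nhds 0 E.ρ_pos)] with η hη
    rw [hs]
    exact E.hasSum_borelExp hq hη

lemma mem_of_isContinuationAlong {g : PowerSeries ℂ} {lam : ℂ} {Ω : Set ℂ} {Φ : ℂ → ℂ}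
    (h : IsContinuationAlong q lam g Ω Φ) (m : ℤ) : ((q⁻¹ : ℝ) : ℂ) ^ m * lam ∈ Ω := by
  obtain ⟨r, hr, hrΩ⟩ := h.discs
  have := hrΩ (-m) (Metric.mem_ball_self (mul_pos hr (zpow_pos (by linarith) _)))
  rwa [mul_comm, zpow_neg, ← inv_zpow, ← Complex.ofReal_inv] at this

/-- The values on the spiral of any continuation of the first Borel transform. -/
lemma continuation_borelTheta_eq {lam : ℂ} {Ω : Set ℂ} {Φ : ℂ → ℂ}
    (h : IsContinuationAlong q lam (borelTheta q f) Ω Φ) (m : ℤ) :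
    Φ (((q⁻¹ : ℝ) : ℂ) ^ m * lam) = E.ext (((q⁻¹ : ℝ) : ℂ) ^ m * lam) :=
  E.eq_ext (inv_pos.2 (by linarith)) (inv_lt_one_of_one_lt₀ hq) h.isOpen h.isConnected h.zero_mem
    h.analytic h.germ _ (mem_of_isContinuationAlong hq h m)

/-- The values on the spiral of any continuation of the second Borel transform. -/
lemma IsGoodNhd.continuation_borelExp_eq {A : Set ℂ} {lam : ℂ} {C c : ℝ}
    (h : E.IsGoodNhd A lam C c) {Ω : Set ℂ} {Ψ : ℂ → ℂ}
    (hΨ : IsContinuationAlong q (lam / (1 - (q : ℂ)⁻¹)) (borelExp q f) Ω Ψ) (m : ℤ) :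
    Ψ (((q⁻¹ : ℝ) : ℂ) ^ m * lam / (1 - (q : ℂ)⁻¹)) = E.psi (((q⁻¹ : ℝ) : ℂ) ^ m * lam) := by
  have hp0 : 0 < q⁻¹ := inv_pos.2 (by linarith)
  have hp1 := inv_lt_one_of_one_lt₀ hq
  have hs : (1 - (q : ℂ)⁻¹) ≠ 0 := by
    have : ((1 - q⁻¹ : ℝ) : ℂ) ≠ 0 := by exact_mod_cast (sub_pos.2 hp1).ne'
    simpa using this
  have hmem := mem_of_isContinuationAlong hq hΨ m
  rw [← mul_div_assoc] at hmem
  have hset : {ξ : ℂ | ξ / (1 - (q : ℂ)⁻¹) ∈ Ω} = (fun η => (1 - (q : ℂ)⁻¹) * η) '' Ω := by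
    ext ξ
    constructor
    · intro hξ
      exact ⟨_, hξ, by simp only; rw [mul_div_cancel₀ _ hs]⟩
    · rintro ⟨η, hη, rfl⟩
      change (1 - (q : ℂ)⁻¹) * η / (1 - (q : ℂ)⁻¹) ∈ Ω
      rwa [mul_div_cancel_left₀ _ hs]
  have hV := isOpen_ball_union_qSat q⁻¹ (E.ρ / 2) h.isOpen
  refine E.eq_psi hp0 hp1 (Ω := {ξ : ℂ | ξ / (1 - (q : ℂ)⁻¹) ∈ Ω})
    (Ψ := fun ξ => Ψ (ξ / (1 - (q : ℂ)⁻¹)))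
    (hΨ.isOpen.preimage (f := fun ξ : ℂ => ξ / (1 - (q : ℂ)⁻¹)) (by fun_prop)) ?_ ?_ ?_ ?_
    hV (h.psi_bound E hq).2.continuousOn _ hmem ?_
  · rw [hset]
    exact hΨ.isConnected.image _ (by fun_prop)
  · simpa using hΨ.zero_mem
  · exact hΨ.analytic.differentiableOn.comp (f := fun ξ : ℂ => ξ / (1 - (q : ℂ)⁻¹)) (by fun_prop)
      fun ξ hξ => hξ
  · have : Tendsto (fun ξ : ℂ => ξ / (1 - (q : ℂ)⁻¹)) (𝓝 0) (𝓝 0) :=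
      Continuous.tendsto' (by fun_prop) _ _ (by simp)
    filter_upwards [this.eventually hΨ.germ] with ξ hξ
    refine hξ.congr_fun fun n => ?_
    rw [coeff_borelExp hq, div_pow]
    field_simp
  · exact Or.inr ((zpow_mul_mem_qSat hp0 m).2 (subset_qSat _ _ h.mem))

end BorelEquation

/-- The condition X < 1/(qc) gives q²ct ≤ qt/X, so the kernel at ‖x‖ = X dominates the growth E(ct)
with a gain (1+ct)⁻². This is the origin of the radius R = 1/(qc). -/
lemma eulerR_le_div_one_add_sq {q : ℝ} (hq : 1 < q) {c X t : ℝ} (hc : 0 < c) (hX : 0 < X)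
    (hXc : X < (q * c)⁻¹) (ht : 0 ≤ t) :
    eulerR q⁻¹ (c * t) ≤ eulerR q⁻¹ (q * t / X) / (1 + c * t) ^ 2 := by
  have hp0 : 0 < q⁻¹ := inv_pos.2 (by linarith)
  have hp1 := inv_lt_one_of_one_lt₀ hq
  refine (eulerR_div_eulerR_le hp0 hp1 (by positivity)).trans ?_
  gcongr
  refine eulerR_mono hp0 hp1 (by positivity) ?_
  have h1 : X * (q * c) < 1 := by
    rwa [lt_inv_comm₀ hX (by positivity), ← one_div, lt_div_iff₀ hX, mul_comm] at hXc
  rw [le_div_iff₀ hX]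
  field_simp
  nlinarith

lemma qTheta_ne_zero_of_notMem_qSpiral {q : ℝ} (hq : 1 < q) {lam x : ℂ} (hlam : lam ≠ 0)
    (hx : x ≠ 0) (h : x ∉ qSpiral q (-lam)) : qTheta q⁻¹ (q * lam / x) ≠ 0 := by
  have hp0 : 0 < q⁻¹ := inv_pos.2 (by linarith)
  have hp1 := inv_lt_one_of_one_lt₀ hq
  have hqc : (q : ℂ) ≠ 0 := by exact_mod_cast (by linarith : q ≠ 0)
  refine qTheta_ne_zero hp0 hp1 (div_ne_zero (mul_ne_zero hqc hlam) hx) fun m hm => h ⟨1 - m, ?_⟩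
  simp only
  rw [Complex.ofReal_inv, inv_zpow] at hm
  have hqm : (q : ℂ) ^ m ≠ 0 := zpow_ne_zero _ hqc
  rw [zpow_sub₀ hqc, zpow_one]
  field_simp at hm ⊢
  linear_combination -hm

lemma qTheta_ne_zero_of_mem_slitPlane {p : ℝ} (hp0 : 0 < p) (hp1 : p < 1) {y : ℂ}
    (hy : y ∈ Complex.slitPlane) : qTheta p y ≠ 0 := by
  refine qTheta_ne_zero hp0 hp1 (Complex.slitPlane_ne_zero hy) fun m hm => ?_
  have hpm := zpow_pos hp0 m
  have h1 : y = ((-(p ^ m)⁻¹ : ℝ) : ℂ) := by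
    have : (p : ℂ) ^ m ≠ 0 := by exact_mod_cast hpm.ne'
    push_cast
    field_simp
    linear_combination hm
  rw [h1, Complex.ofReal_mem_slitPlane] at hy
  have : 0 < (p ^ m)⁻¹ := by positivity
  linarith

namespace BorelEquation

variable {q : ℝ} {f : PowerSeries ℂ} (E : BorelEquation q⁻¹ (borelTheta q f)) (hq : 1 < q)
include hq

/-- The two discrete sums are defined and agree. -/
lemma IsGoodNhd.exists_discreteSum {A : Set ℂ} {lam : ℂ} {C c : ℝ} (hlam : lam ≠ 0)
    (h : E.IsGoodNhd A lam C c) {x : ℂ} (hx : x ≠ 0) (hxc : ‖x‖ < (q * c)⁻¹)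
    (hθ : qTheta q⁻¹ (q * lam / x) ≠ 0) :
    ∃ S, HasSum (fun m : ℤ => ((q⁻¹ : ℝ) : ℂ) ^ m * E.ext (((q⁻¹ : ℝ) : ℂ) ^ m * lam) /
        qTheta q⁻¹ (((q⁻¹ : ℝ) : ℂ) ^ m * (q * lam / x))) S ∧
      HasSum (fun m : ℤ => ((q⁻¹ : ℝ) : ℂ) ^ m * E.psi (((q⁻¹ : ℝ) : ℂ) ^ m * lam) /
        euler q⁻¹ (((q⁻¹ : ℝ) : ℂ) ^ m * (q * lam / x))) S ∧
      HasDiscreteThetaSum q lam f x (q * lam * S) ∧ HasDiscreteExpSum q lam f x (q * lam * S) := by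
  have hq0 : 0 < q := by linarith
  have hp0 : 0 < q⁻¹ := inv_pos.2 hq0
  have hp1 := inv_lt_one_of_one_lt₀ hq
  have hqc : (q : ℂ) ≠ 0 := by exact_mod_cast hq0.ne'
  have hpc : ((q⁻¹ : ℝ) : ℂ) ≠ 0 := by exact_mod_cast hp0.ne'
  have hs : (1 - (q : ℂ)⁻¹) ≠ 0 := by
    have : ((1 - q⁻¹ : ℝ) : ℂ) ≠ 0 := by exact_mod_cast (sub_pos.2 hp1).ne'
    simpa using this
  have hq1 : (q : ℂ) - 1 ≠ 0 := by
    rw [← mul_ne_zero_iff_left hqc, mul_sub, mul_inv_cancel₀ hqc, mul_one] at hs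
    exact hs
  have hl : 0 < ‖lam‖ := norm_pos_iff.2 hlam
  have hX : 0 < ‖x‖ := norm_pos_iff.2 hx
  have hc := h.c_pos
  have hz : (q * lam / x : ℂ) ≠ 0 := div_ne_zero (mul_ne_zero hqc hlam) hx
  have hmem : ∀ m : ℤ, ((q⁻¹ : ℝ) : ℂ) ^ m * lam ∈
      Metric.ball (0 : ℂ) (E.ρ / 2) ∪ qSat q⁻¹ A := fun m =>
    Or.inr ((zpow_mul_mem_qSat hp0 m).2 (subset_qSat _ _ h.mem))
  have hnorm : ∀ (m : ℤ) (w : ℂ), ‖((q⁻¹ : ℝ) : ℂ) ^ m * w‖ = q⁻¹ ^ m * ‖w‖ := fun m w => by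
    rw [norm_mul, norm_zpow, Complex.norm_real, Real.norm_of_nonneg hp0.le]
  have key := exists_hasSum_theta_euler hp0 hp1
    (β := fun m => E.ext (((q⁻¹ : ℝ) : ℂ) ^ m * lam))
    (γ := fun m => E.psi (((q⁻¹ : ℝ) : ℂ) ^ m * lam)) hz hθ ?_ ?_
  · obtain ⟨S, h1, h2⟩ := key
    -- The Jackson integrals equal (1-p) lam S; the prefactor q/(1-p) leaves q lam S in both cases.
    refine ⟨S, h1, h2, ⟨h.memHSpiral E hq, fun Ω Φ hΦ => ⟨(1 - (q : ℂ)⁻¹) * lam * S, ?_, ?_⟩⟩,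
      ⟨h.memHSpiral_borelExp E hq, fun Ω Ψ hΨ => ⟨(1 - (q : ℂ)⁻¹) * lam * S, ?_, ?_⟩⟩⟩
    · rw [HasJacksonIntegral, Complex.ofReal_inv]
      refine (h1.mul_left ((1 - (q : ℂ)⁻¹) * lam)).congr_fun fun m => ?_
      have e := E.continuation_borelTheta_eq hq hΦ m
      rw [Complex.ofReal_inv] at e
      rw [mul_comm lam, e, Complex.ofReal_inv]
      rw [show (q : ℂ) * ((q : ℂ)⁻¹ ^ m * lam) / x = (q : ℂ)⁻¹ ^ m * (q * lam / x) by ring]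
      ring
    · field_simp
    · rw [HasJacksonIntegral, Complex.ofReal_inv]
      refine (h2.mul_left ((1 - (q : ℂ)⁻¹) * lam)).congr_fun fun m => ?_
      have e := h.continuation_borelExp_eq E hq hΨ m
      rw [Complex.ofReal_inv] at e
      rw [mul_comm lam, e, Complex.ofReal_inv, qExp_eq hq]
      rw [show (1 - (q : ℂ)⁻¹) * ((q : ℂ) * ((q : ℂ)⁻¹ ^ m * lam) / ((1 - (q : ℂ)⁻¹) * x)) =
        (q : ℂ)⁻¹ ^ m * (q * lam / x) by field_simp]
      ring
    · field_simp
  · intro m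
    refine (hasSum_divPoch_inv hp0 hp1 (b := E.ext) (ξ := ((q⁻¹ : ℝ) : ℂ) ^ m * lam)
      (M := C * eulerR q⁻¹ (c * ‖((q⁻¹ : ℝ) : ℂ) ^ m * lam‖)) fun k => ?_).congr_fun fun k => ?_
    · have hC := h.C_pos
      refine (h.bound _ (pow_mul_mem_ball_union_qSat hp0 hp1 k (hmem m))).trans ?_
      refine mul_le_mul_of_nonneg_left (eulerR_mono hp0 hp1 (by positivity) ?_) hC.le
      refine mul_le_mul_of_nonneg_left ?_ hc.le
      rw [norm_pow_mul hp0]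
      exact mul_le_of_le_one_left (norm_nonneg _) (pow_le_one₀ hp0.le hp1.le)
    · rw [psi, zpow_add₀ hpc, mul_comm (((q⁻¹ : ℝ) : ℂ) ^ m), mul_assoc, zpow_natCast]
  · obtain ⟨hb, -⟩ := h.psi_bound E hq
    have hC' := psi_const_pos hq h.C_pos
    set C' := (eulerR q⁻¹ (-q⁻¹))⁻¹ * eulerR q⁻¹ q⁻¹ * C
    refine Summable.of_nonneg_of_le (fun m => ?_) (fun m => ?_)
      ((summable_zpow_div_one_add_sq hp0 hp1 (show 0 < c * ‖lam‖ by positivity)).mul_left C')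
    · have := eulerR_pos hp0 hp1 (norm_nonneg (((q⁻¹ : ℝ) : ℂ) ^ m * (q * lam / x)))
      positivity
    · have hpm := zpow_pos hp0 m
      have h3 := hb _ (hmem m)
      have h4 := eulerR_le_div_one_add_sq hq hc hX hxc (show 0 ≤ q⁻¹ ^ m * ‖lam‖ by positivity)
      rw [hnorm] at h3
      have e : ‖((q⁻¹ : ℝ) : ℂ) ^ m * (q * lam / x)‖ = q * (q⁻¹ ^ m * ‖lam‖) / ‖x‖ := by
        rw [hnorm, norm_div, norm_mul, Complex.norm_real, Real.norm_of_nonneg hq0.le]; ring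
      rw [e]
      have h5 := eulerR_pos hp0 hp1 (show 0 ≤ q * (q⁻¹ ^ m * ‖lam‖) / ‖x‖ by positivity)
      rw [div_le_iff₀ h5]
      calc _ ≤ q⁻¹ ^ m * (C' * (eulerR q⁻¹ (q * (q⁻¹ ^ m * ‖lam‖) / ‖x‖) /
            (1 + c * (q⁻¹ ^ m * ‖lam‖)) ^ 2)) := by gcongr; exact h3.trans (by gcongr)
        _ = _ := by rw [show c * (q⁻¹ ^ m * ‖lam‖) = c * ‖lam‖ * q⁻¹ ^ m by ring]; ring

include E in
lemma exists_radius_discreteSum {lam : ℂ} (hlam : lam ≠ 0)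
    (h : qSpiral q lam ∉ singularDirections q f) :
    ∃ R : ℝ, 0 < R ∧ ∀ x : ℂ, 0 < ‖x‖ → ‖x‖ < R → x ∉ qSpiral q (-lam) →
      ∃ s : ℂ, HasDiscreteThetaSum q lam f x s ∧ HasDiscreteExpSum q lam f x s := by
  have hmem : MemHSpiral q lam (borelTheta q f) := by
    by_contra hcon
    exact h ⟨lam, hlam, rfl, hcon⟩
  obtain ⟨A, C, c, hA⟩ := E.exists_isGoodNhd hq hlam hmem
  have hc := hA.c_pos
  refine ⟨(q * c)⁻¹, by positivity, fun x hx hxR hxs => ?_⟩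
  have hx' := norm_pos_iff.1 hx
  obtain ⟨S, -, -, h1, h2⟩ := hA.exists_discreteSum E hq hlam hx' hxR
    (qTheta_ne_zero_of_notMem_qSpiral hq hlam hx' hxs)
  exact ⟨_, h1, h2⟩

end BorelEquation

/-! ### The continuous sums. -/

lemma integrableOn_of_le_div_one_add_sq {G : ℝ → ℂ} {K c : ℝ} (hc : 0 < c)
    (hG : ContinuousOn G (Set.Ioi 0)) (hb : ∀ t : ℝ, 0 < t → ‖G t‖ ≤ K / (1 + c * t) ^ 2) :
    IntegrableOn G (Set.Ioi 0) := by
  have hK : 0 ≤ K := by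
    have := (norm_nonneg _).trans (hb 1 one_pos)
    rwa [le_div_iff₀ (by positivity), zero_mul] at this
  have h1 : IntegrableOn (fun t : ℝ => K * (1 + (c * t) ^ 2)⁻¹) (Set.Ioi 0) :=
    ((integrable_inv_one_add_sq.comp_mul_left' hc.ne').const_mul K).integrableOn
  refine h1.mono' (hG.aestronglyMeasurable measurableSet_Ioi) ?_
  filter_upwards [ae_restrict_mem measurableSet_Ioi] with t ht
  have ht' : 0 < c * t := mul_pos hc ht
  refine (hb t ht).trans ?_
  rw [← div_eq_mul_inv]
  gcongr
  nlinarith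

/-- An integral over the half line is folded over `p^ℤ` to an integral over `[1, p⁻¹]`. -/
lemma integral_Ioi_eq_integral_tsum {q : ℝ} (hq : 1 < q) {G : ℝ → ℂ} {K c : ℝ} (hc : 0 < c)
    (hG : ContinuousOn G (Set.Ioi 0)) (hb : ∀ t : ℝ, 0 < t → ‖G t‖ ≤ K / (1 + c * t) ^ 2) :
    ContinuousOn (fun t : ℝ => ∑' m : ℤ, ((q⁻¹ : ℝ) : ℂ) ^ m * G (q⁻¹ ^ m * t)) (Set.Icc 1 q) ∧
      ∫ t in Set.Ioi (0 : ℝ), G t =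
        ∫ t in (1 : ℝ)..q, ∑' m : ℤ, ((q⁻¹ : ℝ) : ℂ) ^ m * G (q⁻¹ ^ m * t) := by
  have hq0 : 0 < q := by linarith
  have hp0 : 0 < q⁻¹ := inv_pos.2 hq0
  have hp1 := inv_lt_one_of_one_lt₀ hq
  have hK : 0 ≤ K := by
    have := (norm_nonneg _).trans (hb 1 one_pos)
    rwa [le_div_iff₀ (by positivity), zero_mul] at this
  have hsum := (summable_zpow_div_one_add_sq hp0 hp1 hc).mul_left K
  have hterm : ∀ (m : ℤ), ∀ t ∈ Set.Icc 1 q, ‖((q⁻¹ : ℝ) : ℂ) ^ m * G (q⁻¹ ^ m * t)‖ ≤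
      K * (q⁻¹ ^ m / (1 + c * q⁻¹ ^ m) ^ 2) := by
    intro m t ht
    have hpm := zpow_pos hp0 m
    have ht0 : 0 < t := by linarith [ht.1]
    rw [norm_mul, norm_zpow, Complex.norm_real, Real.norm_of_nonneg hp0.le]
    calc _ ≤ q⁻¹ ^ m * (K / (1 + c * (q⁻¹ ^ m * t)) ^ 2) := by gcongr; exact hb _ (by positivity)
      _ ≤ q⁻¹ ^ m * (K / (1 + c * (q⁻¹ ^ m * 1)) ^ 2) := by gcongr; exact ht.1
      _ = _ := by rw [mul_one]; ring
  have hcont : ∀ m : ℤ, ContinuousOn (fun t : ℝ => ((q⁻¹ : ℝ) : ℂ) ^ m * G (q⁻¹ ^ m * t))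
      (Set.Icc 1 q) := fun m =>
    continuousOn_const.mul (hG.comp (by fun_prop) fun t ht =>
      mul_pos (zpow_pos hp0 m) (by linarith [ht.1]))
  refine ⟨continuousOn_tsum hcont hsum hterm, ?_⟩
  have hIoc : Set.uIoc 1 q ⊆ Set.Icc 1 q := by
    rw [Set.uIoc_of_le hq.le]; exact Set.Ioc_subset_Icc_self
  have h1 : HasSum (fun m : ℤ => ∫ t in (1 : ℝ)..q, ((q⁻¹ : ℝ) : ℂ) ^ m * G (q⁻¹ ^ m * t))
      (∫ t in (1 : ℝ)..q, ∑' m : ℤ, ((q⁻¹ : ℝ) : ℂ) ^ m * G (q⁻¹ ^ m * t)) := by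
    refine intervalIntegral.hasSum_integral_of_dominated_convergence
      (fun m _ => K * (q⁻¹ ^ m / (1 + c * q⁻¹ ^ m) ^ 2)) (fun m => ?_) (fun m => ?_) ?_ ?_ ?_
    · exact ((hcont m).mono hIoc).aestronglyMeasurable measurableSet_uIoc
    · exact Eventually.of_forall fun t ht => hterm m t (hIoc ht)
    · exact Eventually.of_forall fun _ _ => hsum
    · exact intervalIntegrable_const
    · exact Eventually.of_forall fun t ht =>
        (Summable.of_norm_bounded hsum fun m => hterm m t (hIoc ht)).hasSum
  have hmono : Monotone fun m : ℤ => q ^ m := fun _ _ h => zpow_le_zpow_right₀ hq.le h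
  have hU : (⋃ m : ℤ, Set.Ioc (q ^ m) (q ^ (m + 1))) = Set.Ioi 0 := by
    ext t
    simp only [Set.mem_iUnion, Set.mem_Ioi]
    exact ⟨fun ⟨m, hm⟩ => (zpow_pos hq0 m).trans hm.1, fun ht => exists_mem_Ioc_zpow ht hq⟩
  have h2 : HasSum (fun m : ℤ => ∫ t in Set.Ioc (q ^ m) (q ^ (m + 1)), G t)
      (∫ t in Set.Ioi (0 : ℝ), G t) := by
    rw [← hU]
    refine hasSum_integral_iUnion (fun _ => measurableSet_Ioc)
      hmono.pairwise_disjoint_on_Ioc_succ ?_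
    rw [hU]
    exact integrableOn_of_le_div_one_add_sq hc hG hb
  -- Since p^m = q^(-m), the m-th term of the folded sum is the integral over (q^(-m), q^(-m+1)].
  rw [← (Equiv.neg ℤ).hasSum_iff] at h2
  refine h2.unique (h1.congr_fun fun m => ?_)
  have h3 := intervalIntegral.smul_integral_comp_mul_left (a := 1) (b := q) G (q⁻¹ ^ m)
  rw [intervalIntegral.integral_const_mul, ← Complex.ofReal_zpow, ← Complex.real_smul, h3,
    intervalIntegral.integral_of_le (by
      have := zpow_pos hp0 m
      nlinarith)]
  simp only [Function.comp, Equiv.neg_apply]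
  rw [mul_one, inv_zpow, zpow_add₀ hq0.ne', zpow_neg, zpow_one]

section
variable {d : ℝ}

lemma norm_rayPoint (d : ℝ) {t : ℝ} (ht : 0 < t) : ‖rayPoint d t‖ = t := by
  rw [rayPoint, norm_mul, Complex.norm_exp_ofReal_mul_I, mul_one, Complex.norm_real,
    Real.norm_of_nonneg ht.le]

lemma rayPoint_ne_zero (d : ℝ) {t : ℝ} (ht : 0 < t) : rayPoint d t ≠ 0 := by
  rw [← norm_pos_iff, norm_rayPoint d ht]; exact ht

lemma rayPoint_mul (d s t : ℝ) : rayPoint d (s * t) = s * rayPoint d t := by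
  rw [rayPoint, rayPoint]; push_cast; ring

lemma continuous_rayPoint (d : ℝ) : Continuous (rayPoint d) := by
  unfold rayPoint; fun_prop

end

namespace BorelEquation

variable {q : ℝ} {g : PowerSeries ℂ} (E : BorelEquation q⁻¹ g) (hq : 1 < q)
include hq

lemma IsGoodNhd.mono {A : Set ℂ} {lam : ℂ} {C c C' c' : ℝ} (h : E.IsGoodNhd A lam C c)
    (hC : C ≤ C') (hc : c ≤ c') : E.IsGoodNhd A lam C' c' := by
  have hp0 : 0 < q⁻¹ := inv_pos.2 (by linarith)
  have hp1 := inv_lt_one_of_one_lt₀ hq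
  have hc0 := h.c_pos
  refine ⟨h.isOpen, h.isConnected, h.mem, h.exists_mem, h.C_pos.trans_le hC, h.c_pos.trans_le hc,
    fun ξ hξ => (h.bound ξ hξ).trans ?_, h.differentiableOn⟩
  have h1 : eulerR q⁻¹ (c * ‖ξ‖) ≤ eulerR q⁻¹ (c' * ‖ξ‖) :=
    eulerR_mono hp0 hp1 (by positivity) (by gcongr)
  have h2 := eulerR_pos hp0 hp1 (show 0 ≤ c * ‖ξ‖ by positivity)
  have := h.C_pos.trans_le hC
  gcongr

/-- Uniform control near a compact piece of the ray. -/
lemma exists_uniform_isGoodNhd {d : ℝ} (h : ∀ t : ℝ, 0 < t → MemHSpiral q (rayPoint d t) g) :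
    ∃ C c, ∀ t ∈ Set.Icc 1 q, ∃ A, E.IsGoodNhd A (rayPoint d t) C c := by
  refine isCompact_Icc.induction_on (p := fun S : Set ℝ =>
    ∃ C c, ∀ t ∈ S, ∃ A, E.IsGoodNhd A (rayPoint d t) C c) ⟨1, 1, by simp⟩ ?_ ?_ ?_
  · rintro s t hst ⟨C, c, H⟩
    exact ⟨C, c, fun x hx => H x (hst hx)⟩
  · rintro s t ⟨C, c, H⟩ ⟨C', c', H'⟩
    refine ⟨max C C', max c c', ?_⟩
    rintro x (hx | hx)
    · obtain ⟨A, hA⟩ := H x hx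
      exact ⟨A, hA.mono E hq (le_max_left _ _) (le_max_left _ _)⟩
    · obtain ⟨A, hA⟩ := H' x hx
      exact ⟨A, hA.mono E hq (le_max_right _ _) (le_max_right _ _)⟩
  · intro t ht
    have ht0 : 0 < t := by linarith [ht.1]
    obtain ⟨A, C, c, hA⟩ := E.exists_isGoodNhd hq (rayPoint_ne_zero d ht0) (h t ht0)
    -- A is open and the estimates mention only its saturation, so the same A, C, c serve all nearby
    -- points of the ray.
    refine ⟨rayPoint d ⁻¹' A, mem_nhdsWithin_of_mem_nhds
      ((hA.isOpen.preimage (continuous_rayPoint d)).mem_nhds hA.mem), C, c, fun s hs => ⟨A, ?_⟩⟩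
    exact ⟨hA.isOpen, hA.isConnected, hs, hA.exists_mem, hA.C_pos, hA.c_pos, hA.bound,
      hA.differentiableOn⟩

lemma exists_zpow_mul_mem_Icc {t : ℝ} (ht : 0 < t) : ∃ m : ℤ, q⁻¹ ^ m * t ∈ Set.Icc 1 q := by
  have hq0 : 0 < q := by linarith
  obtain ⟨m, h1, h2⟩ := exists_mem_Ico_zpow ht hq
  have hqm := zpow_pos hq0 m
  refine ⟨m, ?_, ?_⟩
  · rwa [inv_zpow, inv_mul_eq_div, le_div_iff₀ hqm, one_mul]
  · rw [inv_zpow, inv_mul_eq_div, div_le_iff₀ hqm]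
    rw [zpow_add₀ hq0.ne', zpow_one, mul_comm] at h2
    exact h2.le

omit hq in
lemma isGoodNhd_mem_saturation (hq : 1 < q) {d C c : ℝ}
    (h : ∀ t ∈ Set.Icc 1 q, ∃ A, E.IsGoodNhd A (rayPoint d t) C c) {t : ℝ} (ht : 0 < t) :
    ∃ (A : Set ℂ) (lam : ℂ), E.IsGoodNhd A lam C c ∧
      rayPoint d t ∈ Metric.ball (0 : ℂ) (E.ρ / 2) ∪ qSat q⁻¹ A := by
  obtain ⟨m, hm⟩ := exists_zpow_mul_mem_Icc hq ht
  obtain ⟨A, hA⟩ := h _ hm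
  refine ⟨A, _, hA, Or.inr ⟨m, ?_⟩⟩
  have := hA.mem
  rw [rayPoint_mul] at this
  simpa using this

/-- Bounds and continuity along the ray. -/
lemma ray_bounds {d C c : ℝ} (h : ∀ t ∈ Set.Icc 1 q, ∃ A, E.IsGoodNhd A (rayPoint d t) C c) :
    (∀ t : ℝ, 0 < t → ‖E.ext (rayPoint d t)‖ ≤ C * eulerR q⁻¹ (c * t)) ∧
    (∀ t : ℝ, 0 < t → ‖E.psi (rayPoint d t)‖ ≤
      ((eulerR q⁻¹ (-q⁻¹))⁻¹ * eulerR q⁻¹ q⁻¹ * C) * eulerR q⁻¹ (c * t)) ∧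
    ContinuousOn (fun t => E.ext (rayPoint d t)) (Set.Ioi 0) ∧
    ContinuousOn (fun t => E.psi (rayPoint d t)) (Set.Ioi 0) := by
  refine ⟨fun t ht => ?_, fun t ht => ?_, fun t ht => ?_, fun t ht => ?_⟩
  all_goals obtain ⟨A, lam, hA, hmem⟩ := E.isGoodNhd_mem_saturation hq h ht
  · have := hA.bound _ hmem
    rwa [norm_rayPoint d ht] at this
  · have := (hA.psi_bound E hq).1 _ hmem
    rwa [norm_rayPoint d ht] at this
  · exact (ContinuousAt.comp (f := rayPoint d) (hA.differentiableOn.continuousOn.continuousAt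
      ((isOpen_ball_union_qSat _ _ hA.isOpen).mem_nhds hmem))
      (continuous_rayPoint d).continuousAt).continuousWithinAt
  · exact (ContinuousAt.comp (f := rayPoint d)
      ((hA.psi_bound E hq).2.continuousOn.continuousAt
      ((isOpen_ball_union_qSat _ _ hA.isOpen).mem_nhds hmem))
      (continuous_rayPoint d).continuousAt).continuousWithinAt

end BorelEquation

/-- Lower bounds for the kernels along a ray off their zeros. -/
lemma exists_kernel_lower_bound {q : ℝ} (hq : 1 < q) {v : ℂ} (hv : v ∈ Complex.slitPlane) :
    ∃ κ > 0, ∀ t : ℝ, 0 < t →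
      κ * eulerR q⁻¹ (t * ‖v‖) ≤ ‖qTheta q⁻¹ (t * v)‖ ∧
      κ * eulerR q⁻¹ (t * ‖v‖) ≤ ‖euler q⁻¹ (t * v)‖ := by
  have hp0 : 0 < q⁻¹ := inv_pos.2 (by linarith)
  have hp1 := inv_lt_one_of_one_lt₀ hq
  have hv0 := Complex.slitPlane_ne_zero hv
  have hslit : ∀ t : ℝ, 0 < t → (t * v : ℂ) ∈ Complex.slitPlane := by
    intro t ht
    rw [Complex.mem_slitPlane_iff] at hv ⊢
    rw [Complex.re_ofReal_mul, Complex.im_ofReal_mul]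
    exact hv.imp (mul_pos ht) (mul_ne_zero ht.ne')
  have hcont : ContinuousOn (fun t : ℝ => thetaRatio q⁻¹ (t * v)) (Set.Icc 1 q) :=
    (continuousOn_thetaRatio hp0 hp1).comp (by fun_prop) fun t ht =>
      mul_ne_zero (by exact_mod_cast (by linarith [ht.1] : t ≠ 0)) hv0
  -- One period [1, q] suffices, because `thetaRatio` is invariant under p^ℤ. On the slit plane θ_p
  -- has no zeros, so the minimum is positive.
  obtain ⟨t₀, ht₀, hmin⟩ := isCompact_Icc.exists_isMinOn (Set.nonempty_Icc.2 hq.le) hcont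
  have ht₀0 : 0 < t₀ := by linarith [ht₀.1]
  have hκ := thetaRatio_pos hp0 hp1 (qTheta_ne_zero_of_mem_slitPlane hp0 hp1 (hslit t₀ ht₀0))
  have hE := eulerR_neg_p_pos hp0 hp1
  set κ := thetaRatio q⁻¹ (t₀ * v)
  have hle : ∀ t : ℝ, 0 < t → κ ≤ thetaRatio q⁻¹ (t * v) := by
    intro t ht
    obtain ⟨m, hm⟩ := BorelEquation.exists_zpow_mul_mem_Icc hq ht
    have h1 : κ ≤ thetaRatio q⁻¹ ((q⁻¹ ^ m * t : ℝ) * v) := hmin hm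
    have h2 := thetaRatio_zpow_mul hp0 hp1 (Complex.slitPlane_ne_zero (hslit t ht)) m
    rw [← h2]
    convert h1 using 2
    push_cast
    ring
  refine ⟨κ * min 1 (eulerR q⁻¹ (-q⁻¹)), by positivity, fun t ht => ?_⟩
  have hn : ‖(t * v : ℂ)‖ = t * ‖v‖ := by
    rw [norm_mul, Complex.norm_real, Real.norm_of_nonneg ht.le]
  have hy := Complex.slitPlane_ne_zero (hslit t ht)
  have hX := eulerR_pos hp0 hp1 (show 0 ≤ t * ‖v‖ by positivity)
  have h1 := thetaRatio_mul_eulerR_le_norm_qTheta hp0 hp1 (t * v)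
  have h2 := thetaRatio_mul_eulerR_le_norm_euler hp0 hp1 hy
  rw [hn] at h1 h2
  have hr := thetaRatio_nonneg hp0 hp1 (t * v)
  constructor
  · refine le_trans ?_ h1
    rw [mul_assoc]
    gcongr
    · exact hle t ht
    · exact min_le_right _ _
  · refine le_trans ?_ h2
    gcongr
    exact (mul_le_of_le_one_right hκ.le (min_le_left _ _)).trans (hle t ht)

namespace BorelEquation

variable {q : ℝ} {f : PowerSeries ℂ} (E : BorelEquation q⁻¹ (borelTheta q f)) (hq : 1 < q)
include hq

lemma rayContinuation_borelTheta {d : ℝ}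
    (h : ∀ t : ℝ, 0 < t → MemHSpiral q (rayPoint d t) (borelTheta q f)) :
    (∃ u, IsRayContinuation q d (borelTheta q f) u) ∧
      ∀ u, IsRayContinuation q d (borelTheta q f) u →
        ∀ t : ℝ, 0 < t → u t = E.ext (rayPoint d t) := by
  have key : ∀ {t : ℝ} {Ω : Set ℂ} {Φ : ℂ → ℂ},
      IsContinuationAlong q (rayPoint d t) (borelTheta q f) Ω Φ →
      Φ (rayPoint d t) = E.ext (rayPoint d t) := fun hΦ => by
    simpa using E.continuation_borelTheta_eq hq hΦ 0
  refine ⟨⟨fun t => E.ext (rayPoint d t), fun t ht => ?_⟩, fun u hu t ht => ?_⟩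
  · obtain ⟨Ω, Φ, hΦ⟩ := h t ht
    exact ⟨Ω, Φ, hΦ, (key hΦ).symm⟩
  · obtain ⟨Ω, Φ, hΦ, hu'⟩ := hu t ht
    rw [hu', key hΦ]

lemma rayContinuation_borelExp {d : ℝ}
    (h : ∀ t : ℝ, 0 < t → MemHSpiral q (rayPoint d t) (borelTheta q f)) :
    (∃ u, IsRayContinuation q d (borelExp q f) u) ∧
      ∀ u, IsRayContinuation q d (borelExp q f) u →
        ∀ t : ℝ, 0 < t → u t = E.psi (rayPoint d ((1 - q⁻¹) * t)) := by
  have hp1 : 0 < 1 - q⁻¹ := sub_pos.2 (inv_lt_one_of_one_lt₀ hq)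
  have e : ∀ t, rayPoint d ((1 - q⁻¹) * t) / (1 - (q : ℂ)⁻¹) = rayPoint d t := by
    intro t
    have : ((1 - q⁻¹ : ℝ) : ℂ) ≠ 0 := by exact_mod_cast hp1.ne'
    rw [rayPoint_mul, ← Complex.ofReal_inv, ← Complex.ofReal_one, ← Complex.ofReal_sub,
      mul_div_cancel_left₀ _ this]
  have key : ∀ {t : ℝ}, 0 < t → MemHSpiral q (rayPoint d t) (borelExp q f) ∧
      ∀ {Ω : Set ℂ} {Ψ : ℂ → ℂ}, IsContinuationAlong q (rayPoint d t) (borelExp q f) Ω Ψ →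
      Ψ (rayPoint d t) = E.psi (rayPoint d ((1 - q⁻¹) * t)) := by
    intro t ht
    have ht' : 0 < (1 - q⁻¹) * t := mul_pos hp1 ht
    obtain ⟨A, C, c, hA⟩ := E.exists_isGoodNhd hq (rayPoint_ne_zero d ht') (h _ ht')
    have h1 := hA.memHSpiral_borelExp E hq
    rw [e] at h1
    refine ⟨h1, fun {Ω Ψ} hΨ => ?_⟩
    rw [← e] at hΨ
    have := hA.continuation_borelExp_eq E hq hΨ 0
    rw [zpow_zero, one_mul, e] at this
    exact this
  refine ⟨⟨fun t => E.psi (rayPoint d ((1 - q⁻¹) * t)), fun t ht => ?_⟩, fun u hu t ht => ?_⟩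
  · obtain ⟨Ω, Ψ, hΨ⟩ := (key ht).1
    exact ⟨Ω, Ψ, hΨ, ((key ht).2 hΨ).symm⟩
  · obtain ⟨Ω, Ψ, hΨ, hu'⟩ := hu t ht
    rw [hu', (key ht).2 hΨ]

omit hq in
lemma norm_div_le_of_kernel_bound (hq : 1 < q) {c C κ X t : ℝ} (hc : 0 < c) (hC : 0 < C)
    (hκ : 0 < κ) (hX : 0 < X) (hXc : X < (q * c)⁻¹) (ht : 0 ≤ t) {a b : ℂ}
    (ha : ‖a‖ ≤ C * eulerR q⁻¹ (c * t)) (hb : κ * eulerR q⁻¹ (q * t / X) ≤ ‖b‖) :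
    ‖a / b‖ ≤ C / κ / (1 + c * t) ^ 2 := by
  have hp0 : 0 < q⁻¹ := inv_pos.2 (by linarith)
  have hp1 := inv_lt_one_of_one_lt₀ hq
  have h1 := eulerR_le_div_one_add_sq hq hc hX hXc ht
  have h2 := eulerR_pos hp0 hp1 (show 0 ≤ q * t / X by positivity)
  have hb0 : 0 < ‖b‖ := (mul_pos hκ h2).trans_le hb
  rw [norm_div, div_le_iff₀ hb0]
  calc ‖a‖ ≤ C * (eulerR q⁻¹ (q * t / X) / (1 + c * t) ^ 2) := ha.trans (by gcongr)
    _ = C / κ / (1 + c * t) ^ 2 * (κ * eulerR q⁻¹ (q * t / X)) := by field_simp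
    _ ≤ _ := by gcongr

-- Both integrals fold to ∫₁^q of the sums over p^ℤ, whose integrands coincide pointwise by the
-- discrete case. The constants C and c are uniform over t ∈ [1, q], so one radius works for all λ
-- on the segment.
include E in
lemma exists_radius_continuousSum {d : ℝ}
    (h : ∀ t : ℝ, 0 < t → qSpiral q (rayPoint d t) ∉ singularDirections q f) :
    ∃ R : ℝ, 0 < R ∧ ∀ x : ℂ, ‖x‖ < R →
      x * Complex.exp (-(d * Complex.I)) ∈ Complex.slitPlane →
      ∃ (s : ℂ) (σ : ℝ → ℂ),
        HasContinuousThetaSum q d f x s ∧ HasContinuousExpSum q d f x s ∧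
        (∀ t ∈ Set.Icc 1 q, HasDiscreteExpSum q (rayPoint d t) f x (σ t)) ∧
        IntervalIntegrable (fun t : ℝ => σ t / t) volume 1 q ∧
        s = 1 / (Real.log q : ℂ) * ∫ t in (1 : ℝ)..q, σ t / t := by
  have hq0 : 0 < q := by linarith
  have hqc : (q : ℂ) ≠ 0 := by exact_mod_cast hq0.ne'
  have hp0 : 0 < q⁻¹ := inv_pos.2 hq0
  have hp1 := inv_lt_one_of_one_lt₀ hq
  have hs0 : 0 < 1 - q⁻¹ := sub_pos.2 hp1
  have hmem : ∀ t : ℝ, 0 < t → MemHSpiral q (rayPoint d t) (borelTheta q f) := by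
    intro t ht
    by_contra hcon
    exact h t ht ⟨_, rayPoint_ne_zero d ht, rfl, hcon⟩
  obtain ⟨C, c, hA⟩ := E.exists_uniform_isGoodNhd hq hmem
  obtain ⟨A₁, hA₁⟩ := hA 1 ⟨le_rfl, hq.le⟩
  have hC := hA₁.C_pos
  have hc := hA₁.c_pos
  obtain ⟨hb1, hb2, hc1, hc2⟩ := E.ray_bounds hq hA
  have hC' := psi_const_pos hq hC
  set C' := (eulerR q⁻¹ (-q⁻¹))⁻¹ * eulerR q⁻¹ q⁻¹ * C
  refine ⟨(q * c)⁻¹, by positivity, fun x hxR hx => ?_⟩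
  have hx0 : x ≠ 0 := left_ne_zero_of_mul (Complex.slitPlane_ne_zero hx)
  have hX : 0 < ‖x‖ := norm_pos_iff.2 hx0
  set e : ℂ := Complex.exp (d * Complex.I) with he
  set v : ℂ := q * e / x with hv
  have hvn : ‖v‖ = q / ‖x‖ := by
    rw [hv, norm_div, norm_mul, he, Complex.norm_exp_ofReal_mul_I, Complex.norm_real,
      Real.norm_of_nonneg hq0.le, mul_one]
  have hvs : v ∈ Complex.slitPlane := by
    have e1 : v = q * (x * Complex.exp (-(d * Complex.I)))⁻¹ := by
      rw [hv, Complex.exp_neg, ← he, mul_inv, inv_inv]; ring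
    have hn := Complex.normSq_pos.2 (Complex.slitPlane_ne_zero hx)
    rw [e1, Complex.mem_slitPlane_iff, Complex.re_ofReal_mul, Complex.im_ofReal_mul,
      Complex.inv_re, Complex.inv_im]
    rw [Complex.mem_slitPlane_iff] at hx
    exact hx.imp (fun h => by positivity) fun h =>
      mul_ne_zero hq0.ne' (div_ne_zero (neg_ne_zero.2 h) hn.ne')
  have hray : ∀ t : ℝ, q * rayPoint d t / x = t * v := fun t => by rw [rayPoint, hv]; ring
  obtain ⟨κ, hκ, hker⟩ := exists_kernel_lower_bound hq hvs
  have hker' : ∀ t : ℝ, 0 < t → κ * eulerR q⁻¹ (q * t / ‖x‖) ≤ ‖qTheta q⁻¹ (t * v)‖ ∧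
      κ * eulerR q⁻¹ (q * t / ‖x‖) ≤ ‖euler q⁻¹ (t * v)‖ := by
    intro t ht
    have := hker t ht
    rwa [hvn, show t * (q / ‖x‖) = q * t / ‖x‖ by ring] at this
  have hne : ∀ t : ℝ, 0 < t → qTheta q⁻¹ (t * v) ≠ 0 ∧ euler q⁻¹ (t * v) ≠ 0 := by
    intro t ht
    have h1 := mul_pos hκ (eulerR_pos hp0 hp1 (show 0 ≤ q * t / ‖x‖ by positivity))
    exact ⟨norm_pos_iff.1 (h1.trans_le (hker' t ht).1), norm_pos_iff.1 (h1.trans_le (hker' t ht).2)⟩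
  have htv : ∀ t ∈ Set.Ioi (0 : ℝ), (t * v : ℂ) ∈ ({0}ᶜ : Set ℂ) := fun t ht =>
    mul_ne_zero (by exact_mod_cast (ne_of_gt ht)) (Complex.slitPlane_ne_zero hvs)
  set G₁ : ℝ → ℂ := fun t => E.ext (rayPoint d t) / qTheta q⁻¹ (t * v) with hG₁
  set G₂ : ℝ → ℂ := fun t => E.psi (rayPoint d t) / euler q⁻¹ (t * v) with hG₂
  have hG₁c : ContinuousOn G₁ (Set.Ioi 0) := hc1.div
    ((continuousOn_qTheta hp0 hp1).comp (by fun_prop) htv) fun t ht => (hne t ht).1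
  have hG₂c : ContinuousOn G₂ (Set.Ioi 0) := hc2.div
    ((differentiable_euler hp0 hp1).continuous.comp_continuousOn (by fun_prop))
    fun t ht => (hne t ht).2
  have hG₁b : ∀ t : ℝ, 0 < t → ‖G₁ t‖ ≤ C / κ / (1 + c * t) ^ 2 := fun t ht =>
    norm_div_le_of_kernel_bound hq hc hC hκ hX hxR ht.le (hb1 t ht) (hker' t ht).1
  have hG₂b : ∀ t : ℝ, 0 < t → ‖G₂ t‖ ≤ C' / κ / (1 + c * t) ^ 2 := fun t ht =>
    norm_div_le_of_kernel_bound hq hc hC' hκ hX hxR ht.le (hb2 t ht) (hker' t ht).2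
  obtain ⟨-, hI₁⟩ := integral_Ioi_eq_integral_tsum hq hc hG₁c hG₁b
  obtain ⟨hScont, hI₂⟩ := integral_Ioi_eq_integral_tsum hq hc hG₂c hG₂b
  set S : ℝ → ℂ := fun t => ∑' m : ℤ, ((q⁻¹ : ℝ) : ℂ) ^ m * G₂ (q⁻¹ ^ m * t) with hS
  have hdisc : ∀ t ∈ Set.Icc 1 q,
      ∑' m : ℤ, ((q⁻¹ : ℝ) : ℂ) ^ m * G₁ (q⁻¹ ^ m * t) = S t ∧
      HasDiscreteExpSum q (rayPoint d t) f x (q * rayPoint d t * S t) := by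
    intro t ht
    have ht0 : 0 < t := by linarith [ht.1]
    obtain ⟨A, hAt⟩ := hA t ht
    obtain ⟨S', h1, h2, -, h4⟩ := hAt.exists_discreteSum E hq (rayPoint_ne_zero d ht0) hx0 hxR
      (by rw [hray]; exact (hne t ht0).1)
    have e1 : ∑' m : ℤ, ((q⁻¹ : ℝ) : ℂ) ^ m * G₁ (q⁻¹ ^ m * t) = S' := by
      rw [← h1.tsum_eq]
      refine tsum_congr fun m => ?_
      rw [hG₁]
      simp only
      rw [rayPoint_mul, hray]
      push_cast
      rw [mul_assoc _ (t : ℂ) v, mul_div_assoc]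
    have e2 : S t = S' := by
      rw [← h2.tsum_eq, hS]
      refine tsum_congr fun m => ?_
      rw [hG₂]
      simp only
      rw [rayPoint_mul, hray]
      push_cast
      rw [mul_assoc _ (t : ℂ) v, mul_div_assoc]
    rw [e1, e2]
    exact ⟨rfl, h4⟩
  have hIS : ∫ t in Set.Ioi (0 : ℝ), G₁ t = ∫ t in (1 : ℝ)..q, S t := by
    rw [hI₁]
    refine intervalIntegral.integral_congr fun t ht => ?_
    rw [Set.uIcc_of_le hq.le] at ht
    exact (hdisc t ht).1
  have hint₁ := integrableOn_of_le_div_one_add_sq hc hG₁c hG₁b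
  have hint₂ := integrableOn_of_le_div_one_add_sq hc hG₂c hG₂b
  -- With λ = t e the factor λ of the discrete sum cancels against dλ/λ, leaving the continuous
  -- function q e S(t).
  have hσ : Set.EqOn (fun t : ℝ => q * rayPoint d t * S t / t) (fun t => q * e * S t)
      (Set.Icc 1 q) := by
    intro t ht
    have ht0 : (t : ℂ) ≠ 0 := by exact_mod_cast (by linarith [ht.1] : t ≠ 0)
    simp only [rayPoint, ← he]
    field_simp
  refine ⟨q * e / Real.log q * ∫ t in (1 : ℝ)..q, S t, fun t => q * rayPoint d t * S t,
    ?_, ?_, fun t ht => (hdisc t ht).2, ?_, ?_⟩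
  · obtain ⟨hex, huniq⟩ := E.rayContinuation_borelTheta hq hmem
    refine ⟨hex, fun u hu => ?_⟩
    have heq : Set.EqOn (fun t : ℝ => u t / qTheta q⁻¹ (q * rayPoint d t / x) * e)
        (fun t => G₁ t * e) (Set.Ioi 0) := by
      intro t ht
      simp only
      rw [hray, huniq u hu t ht]
    refine ⟨(integrableOn_congr_fun heq measurableSet_Ioi).2 (hint₁.mul_const e), ?_⟩
    rw [setIntegral_congr_fun measurableSet_Ioi heq, integral_mul_const, hIS]
    ring
  · obtain ⟨hex, huniq⟩ := E.rayContinuation_borelExp hq hmem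
    refine ⟨hex, fun u hu => ?_⟩
    have heq : Set.EqOn (fun t : ℝ => u t / qExp q (q * rayPoint d t / x) * e)
        (fun t => G₂ ((1 - q⁻¹) * t) * e) (Set.Ioi 0) := by
      intro t ht
      simp only
      rw [hray, huniq u hu t ht, qExp_eq hq, hG₂]
      simp only
      push_cast
      rw [mul_assoc]
    -- The dilation by 1 - p between 𝓑_q f and ψ is undone by a change of variable. Its Jacobian
    -- 1/(1-p) = q/(q-1) turns the normalisation (q-1)/ln q into q/ln q, that of the theta sum.
    have h2 : IntegrableOn (fun t => G₂ ((1 - q⁻¹) * t)) (Set.Ioi 0) := by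
      rw [integrableOn_Ioi_comp_mul_left_iff _ _ hs0, mul_zero]
      exact hint₂
    refine ⟨(integrableOn_congr_fun heq measurableSet_Ioi).2 (h2.mul_const e), ?_⟩
    rw [setIntegral_congr_fun measurableSet_Ioi heq, integral_mul_const,
      integral_comp_mul_left_Ioi _ _ hs0, mul_zero, hI₂, Complex.real_smul]
    have hq1 : (q : ℂ) - 1 ≠ 0 := by
      have : q - 1 ≠ 0 := by linarith
      exact_mod_cast this
    have e3 : (((1 - q⁻¹)⁻¹ : ℝ) : ℂ) = q / (q - 1) := by
      push_cast
      field_simp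
    rw [e3]
    field_simp
  · refine ContinuousOn.intervalIntegrable ?_
    rw [Set.uIcc_of_le hq.le]
    exact (continuousOn_const.mul hScont).congr hσ
  · have hI := intervalIntegral.integral_congr (μ := volume) ((Set.uIcc_of_le hq.le).symm ▸ hσ)
    rw [hI, intervalIntegral.integral_const_mul]
    ring

end BorelEquation

end

theorem mainTheorem2 (q : ℝ) (hq : 1 < q) (f : PowerSeries ℂ)
    (hf0 : PowerSeries.constantCoeff f = 0) (hf : IsGenericQGevrey q f) :
    (singularDirections q f).Finite ∧
    (∀ lam : ℂ, lam ≠ 0 → qSpiral q lam ∉ singularDirections q f →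
      ∃ R : ℝ, 0 < R ∧ ∀ x : ℂ, 0 < ‖x‖ → ‖x‖ < R → x ∉ qSpiral q (-lam) →
        ∃ s : ℂ, HasDiscreteThetaSum q lam f x s ∧ HasDiscreteExpSum q lam f x s) ∧
    (∀ d : ℝ, d ∈ Set.Ico (-Real.pi) Real.pi →
      (∀ t : ℝ, 0 < t → qSpiral q (rayPoint d t) ∉ singularDirections q f) →
      ∃ R : ℝ, 0 < R ∧ ∀ x : ℂ, ‖x‖ < R →
        x * Complex.exp (-(d * Complex.I)) ∈ Complex.slitPlane →
        ∃ (s : ℂ) (σ : ℝ → ℂ),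
          HasContinuousThetaSum q d f x s ∧ HasContinuousExpSum q d f x s ∧
          (∀ t ∈ Set.Icc 1 q, HasDiscreteExpSum q (rayPoint d t) f x (σ t)) ∧
          IntervalIntegrable (fun t : ℝ => σ t / t) volume 1 q ∧
          s = 1 / (Real.log q : ℂ) * ∫ t in (1 : ℝ)..q, σ t / t) := by
  obtain ⟨E⟩ := hf.borelEquation hq hf0
  exact ⟨E.finite_singularDirections hq, fun lam hlam h => E.exists_radius_discreteSum hq hlam h,
    fun d _ h => E.exists_radius_continuousSum hq h⟩
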